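/- **Average classical simulation of local expectation values.** *Setting.* Let $n$ qubits sit at distinct sites of $\mathbb{Z}^{\mathrm D}$, $\mathrm D\ge 1$. A noisy $\mathrm D$-dimensional geometrically local random circuit of depth $L$ is $$\Phi=\mathcal V^{\mathrm{single}}\circ\mathcal N^{\otimes n}\circ\mathcal U_L\circ\cdots\circ\mathcal N^{\otimes n}\circ\mathcal U_1 .$$ Each unitary layer $\mathcal U_i$ consists of $m$ consecutive sublayers of two-qubit gates with disjoint supports, each gate acting on two qubits whose sites are at $\ell_\infty$-distance at most $r$, and each qubit is acted on by at least one gate of each layer; $\mathcal V^{\mathrm{single}}$ is a final layer of single-qubit gates. All gates are independent and each is distributed according to a unitary 2-design (the laws may differ from gate to gate). $\mathcal N$ is a single-qubit channel that is not a unitary channel. Let $\mathbf t,\mathbf D\in\mathbb R^3$ be parameters of its normal form, i.e. $\mathcal N(\cdot)=U\mathcal N'(V^\dagger(\cdot)V)U^\dagger$ with $U,V$ unitary and $\mathcal N'\big(\tfrac{I+\mathbf w\cdot\boldsymbol\sigma}{2}\big)=\tfrac I2+\tfrac12(\mathbf t+\mathrm{diag}(\mathbf D)\mathbf w)\cdot\boldsymbol\sigma$,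 let $c=\frac13(\|\mathbf D\|_2^2+\|\mathbf t\|_2^2)$, and assume $c>0$ (i.e. $\mathcal N$ is not the completely depolarizing channel). For $l\in\mathbb N$ let $\Phi_{[L-l,L]}$ be the circuit that consists of the last $\min(l,L)$ noisy layers $\mathcal N^{\otimes n}\circ\mathcal U_i$ of $\Phi$, followed by $\mathcal V^{\mathrm{single}}$. Let $\rho_0=|0^n\rangle\langle 0^n|$, let $P\in\{I,X,Y,Z\}^{\otimes n}$ have weight $|P|$, let $\varepsilon,\delta>0$, and put $$ l=\max\Big(0,\Big\lceil \frac{1}{\log(c^{-1})}\log\frac{4}{\delta\varepsilon^2}\Big\rceil\Big),\qquad \hat C=\mathrm{Tr}\big(P\,\Phi_{[L-l,L]}(\rho_0)\big). $$ *Accuracy.* With probability at least $1-\delta$ over the circuit, $|\hat C-\mathrm{Tr}(P\Phi(\rho_0))|\le\varepsilon$. *Algorithm.* There is one classical algorithm (a program of a random access machine with exact complex arithmetic at unit cost, and with unit-cost random access to $L$, $m$, $P$, $\varepsilon$, $\delta$, $c$, the matrix elements of $\mathcal N$, the list of gate positions and the gate entries) that, on every instance of every such circuit and for every $P$, $\varepsilon,\delta>0$,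 outputs exactly $\hat C$. For all $\mathrm D\ge 1$, $r$, $m$, $A\in\mathbb N$ and $\eta<1$ there is a constant $K$, which depends on these only (not on $n$, $L$, the circuit, the noise, $P$, $\varepsilon$, $\delta$), such that: 1. for every $P$, $\ \mathrm{Runtime}\le\exp\!\big(K\,(|P|+1)(l+1)^{\mathrm D}\big)$; 2. if $|P|\ge1$ and $P$ is geometrically local, in the sense that its support has $\ell_\infty$-diameter at most $A|P|$, then $\mathrm{Runtime}\le\exp\!\big(K(|P|+l)^{\mathrm D}\big)$, and if moreover $\varepsilon^2\delta\le\eta$, then $$\mathrm{Runtime}\le\exp\!\left(K\left(|P|+\frac{1}{\log(c^{-1})}\log\frac{1}{\varepsilon^2\delta}\right)^{\mathrm D}\right).$$ -/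

import Mathlib

open MeasureTheory
open scoped Kronecker ComplexOrder

namespace NoisyCircuit

noncomputable section

/-! ### Unitary gates, the Haar measure, unitary two-designs -/

/-- The unitary group on the space with orthonormal basis indexed by `ι`. -/
abbrev Gate (ι : Type) [Fintype ι] [DecidableEq ι] : Type := Matrix.unitaryGroup ι ℂ

instance gateMeasurableSpace (ι : Type) [Fintype ι] [DecidableEq ι] : MeasurableSpace (Gate ι) :=
  borel _

instance gateBorelSpace (ι : Type) [Fintype ι] [DecidableEq ι] : BorelSpace (Gate ι) := ⟨rfl⟩

instance gateCompactSpace (ι : Type) [Fintype ι] [DecidableEq ι] : CompactSpace (Gate ι) := by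
  have hclosed : IsClosed {U : Matrix ι ι ℂ | star U * U = 1 ∧ U * star U = 1} :=
    (isClosed_eq (by fun_prop) continuous_const).inter
      (isClosed_eq (by fun_prop) continuous_const)
  have hK : IsCompact (Set.pi Set.univ
      fun _ : ι => Set.pi Set.univ fun _ : ι => Metric.closedBall (0 : ℂ) 1) :=
    isCompact_univ_pi fun _ => isCompact_univ_pi fun _ => isCompact_closedBall 0 1
  have hsub : {U : Matrix ι ι ℂ | star U * U = 1 ∧ U * star U = 1} ⊆ Set.pi Set.univ
      fun _ : ι => Set.pi Set.univ fun _ : ι => Metric.closedBall (0 : ℂ) 1 := by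
    intro U hU i _ j _
    have h := entry_norm_bound_of_unitary (U := U) (Unitary.mem_iff.mpr hU) i j
    simpa using h
  have hc := hK.of_isClosed_subset hclosed hsub
  have he : {U : Matrix ι ι ℂ | star U * U = 1 ∧ U * star U = 1} =
      ((Matrix.unitaryGroup ι ℂ : Submonoid (Matrix ι ι ℂ)) : Set (Matrix ι ι ℂ)) := by
    ext U
    exact Unitary.mem_iff.symm
  rw [he] at hc
  exact isCompact_iff_compactSpace.mp hc

/-- The normalized Haar measure on the unitary group. -/
def haarGate (ι : Type) [Fintype ι] [DecidableEq ι] : Measure (Gate ι) :=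
  Measure.haarMeasure ⊤

/-- `ν` is a unitary 2-design: a probability distribution on the unitary group with
`E_{V ∼ ν} [V ⊗ V · O · (V ⊗ V)†] = E_{V ∼ Haar} [V ⊗ V · O · (V ⊗ V)†]` (entry by entry)
for every operator `O` on the doubled space. -/
structure IsTwoDesign {ι : Type} [Fintype ι] [DecidableEq ι] (ν : Measure (Gate ι)) : Prop where
  isProbabilityMeasure : IsProbabilityMeasure ν
  secondMoment : ∀ (O : Matrix (ι × ι) (ι × ι) ℂ) (a b : ι × ι),
    ∫ V : Gate ι, ((V.1 ⊗ₖ V.1) * O * (V.1 ⊗ₖ V.1).conjTranspose) a b ∂ν =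
      ∫ V : Gate ι, ((V.1 ⊗ₖ V.1) * O * (V.1 ⊗ₖ V.1).conjTranspose) a b ∂(haarGate ι)

/-! ### Paulis and single-qubit channels -/

/-- Operators on one qubit. -/
abbrev Op1 : Type := Matrix (Fin 2) (Fin 2) ℂ

/-- Operators on `n` qubits, in the computational basis. -/
abbrev Op (n : ℕ) : Type := Matrix (Fin n → Fin 2) (Fin n → Fin 2) ℂ

/-- The single-qubit Paulis `I, X, Y, Z`. -/
def pauli : Fin 4 → Op1 :=
  ![1, !![0, 1; 1, 0], !![0, -Complex.I; Complex.I, 0], !![1, 0; 0, -1]]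

/-- The Pauli operator `σ_{P 0} ⊗ ⋯ ⊗ σ_{P (n-1)}`. -/
def pauliOp {n : ℕ} (P : Fin n → Fin 4) : Op n :=
  Matrix.of fun x y => ∏ q, pauli (P q) (x q) (y q)

/-- The support of a Pauli, listed in increasing order. -/
def suppList {n : ℕ} (P : Fin n → Fin 4) : List (Fin n) :=
  (List.finRange n).filter fun q => P q ≠ 0

/-- The Pauli weight `|P|`. -/
def weight {n : ℕ} (P : Fin n → Fin 4) : ℕ := (suppList P).length

/-- The state `|0ⁿ⟩⟨0ⁿ|`. -/
def zeroState (n : ℕ) : Op n := Matrix.single 0 0 1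

/-- `N ⊗ id` on one qubit and a `k`-dimensional ancilla. -/
def ampliate (N : Op1 →ₗ[ℂ] Op1) (k : ℕ) (A : Matrix (Fin 2 × Fin k) (Fin 2 × Fin k) ℂ) :
    Matrix (Fin 2 × Fin k) (Fin 2 × Fin k) ℂ :=
  Matrix.of fun a b => N (Matrix.of fun i j => A (i, a.2) (j, b.2)) a.1 b.1

/-- Single-qubit quantum channels: completely positive and trace preserving linear maps. -/
structure IsChannel (N : Op1 →ₗ[ℂ] Op1) : Prop where
  completelyPositive : ∀ (k : ℕ) (A : Matrix (Fin 2 × Fin k) (Fin 2 × Fin k) ℂ),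
    A.PosSemidef → (ampliate N k A).PosSemidef
  tracePreserving : ∀ A : Op1, (N A).trace = A.trace

/-- The channel is conjugation by a unitary. -/
def IsUnitaryChannel (N : Op1 →ₗ[ℂ] Op1) : Prop :=
  ∃ U : Gate (Fin 2), ∀ A : Op1, N A = U.1 * A * U.1.conjTranspose

/-- The linear map with `I ↦ I + t · σ` and `σ_k ↦ d_k σ_k` for `σ = (X, Y, Z)`, that is,
`(I + w · σ) / 2 ↦ I / 2 + (t + diag(d) w) · σ / 2`. -/
def normalFormMap (t d : Fin 3 → ℝ) (A : Op1) : Op1 :=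
  (A.trace / 2) • (1 : Op1) +
    ∑ k : Fin 3, (((t k : ℂ) * A.trace + (d k : ℂ) * (pauli k.succ * A).trace) / 2) •
      pauli k.succ

/-- `t, d` are parameters of a normal form of `N`: up to unitary rotations before and after,
`N` is `normalFormMap t d`. -/
def IsNormalForm (N : Op1 →ₗ[ℂ] Op1) (t d : Fin 3 → ℝ) : Prop :=
  ∃ U V : Gate (Fin 2), ∀ A : Op1,
    N A = U.1 * normalFormMap t d (V.1.conjTranspose * A * V.1) * U.1.conjTranspose

/-- The noise parameter `c = (‖d‖₂² + ‖t‖₂²) / 3`. -/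
def noiseParam (t d : Fin 3 → ℝ) : ℝ := (∑ k, d k ^ 2 + ∑ k, t k ^ 2) / 3

/-- `N^{⊗ n}`, through its matrix elements. -/
def tensorChannel {n : ℕ} (N : Op1 →ₗ[ℂ] Op1) (A : Op n) : Op n :=
  Matrix.of fun x y => ∑ x' : Fin n → Fin 2, ∑ y' : Fin n → Fin 2,
    (∏ q, N (Matrix.single (x' q) (y' q) 1) (x q) (y q)) * A x' y'

/-! ### Geometrically local circuits -/

/-- The architecture of a `D`-dimensional geometrically local circuit with `n` qubits and `L`
layers. The qubits sit at distinct sites of `ℤ^D`. A layer consists of `m` consecutive sublayers of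
two-qubit gates with disjoint supports: in sublayer `s` of layer `i`, qubit `q` interacts with qubit
`partner i s q`, and is idle if this is `q` itself. Gates have range at most `r`, and in
every layer every qubit is acted on by at least one gate. -/
structure Architecture (D r m n L : ℕ) where
  pos : Fin n → Fin D → ℤ
  pos_injective : Function.Injective pos
  partner : Fin L → Fin m → Fin n → Fin n
  partner_partner : ∀ i s q, partner i s (partner i s q) = q
  range_le : ∀ i s q k, |pos (partner i s q) k - pos q k| ≤ (r : ℤ)
  covers : ∀ i q, ∃ s, partner i s q ≠ q

variable {D r m n L : ℕ}

/-- The two-qubit gates of the circuit: layer, sublayer, and the smaller of the two qubits. -/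
abbrev Architecture.GateLoc (arch : Architecture D r m n L) : Type :=
  {g : Fin L × Fin m × Fin n // g.2.2 < arch.partner g.1 g.2.1 g.2.2}

/-- An instance of the circuit: its two-qubit gates, and the gates of the final layer of
single-qubit gates. -/
abbrev Architecture.Sample (arch : Architecture D r m n L) : Type :=
  (arch.GateLoc → Gate (Fin 2 × Fin 2)) × (Fin n → Gate (Fin 2))

/-- The `n`-qubit unitary of sublayer `s` of layer `i`: the tensor product of its two-qubit gates
and of the identity on idle qubits. -/
def sublayerUnitary (arch : Architecture D r m n L) (ω : arch.Sample) (i : Fin L) (s : Fin m) :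
    Op n :=
  Matrix.of fun x y => ∏ q : Fin n,
    if h : q < arch.partner i s q then
      (ω.1 ⟨(i, s, q), h⟩).1 (x q, x (arch.partner i s q)) (y q, y (arch.partner i s q))
    else if arch.partner i s q = q then (if x q = y q then 1 else 0)
    else 1

/-- The unitary `U_i` of layer `i`; sublayer `0` acts first. -/
def layerUnitary (arch : Architecture D r m n L) (ω : arch.Sample) (i : Fin L) : Op n :=
  ((List.finRange m).map (sublayerUnitary arch ω i)).reverse.prod

/-- The final layer of single-qubit gates. -/
def singleLayer (arch : Architecture D r m n L) (ω : arch.Sample) : Op n :=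
  Matrix.of fun x y => ∏ q, (ω.2 q).1 (x q) (y q)

/-- One noisy layer, `N^{⊗ n} ∘ 𝒰_i`. -/
def noisyLayer (arch : Architecture D r m n L) (N : Op1 →ₗ[ℂ] Op1) (ω : arch.Sample) (ρ : Op n)
    (i : Fin L) : Op n :=
  tensorChannel N (layerUnitary arch ω i * ρ * (layerUnitary arch ω i).conjTranspose)

/-- `Φ_{[L-l,L]}`: the circuit that consists of the last `l` noisy layers only (all `L` of them if
`l ≥ L`), followed by the final layer of single-qubit gates. -/
def lastLayers (arch : Architecture D r m n L) (N : Op1 →ₗ[ℂ] Op1) (ω : arch.Sample) (l : ℕ)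
    (ρ : Op n) : Op n :=
  singleLayer arch ω *
      ((List.finRange L).drop (L - l)).foldl (noisyLayer arch N ω) ρ *
    (singleLayer arch ω).conjTranspose

/-- The whole noisy circuit
`Φ = 𝒱 ∘ N^{⊗ n} ∘ 𝒰_{L-1} ∘ ⋯ ∘ N^{⊗ n} ∘ 𝒰_0`. -/
def circuit (arch : Architecture D r m n L) (N : Op1 →ₗ[ℂ] Op1) (ω : arch.Sample)
    (ρ : Op n) : Op n :=
  lastLayers arch N ω L ρ

/-- The circuit distribution: all gates are independent, with the given laws. -/
def circuitMeasure (arch : Architecture D r m n L)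
    (ν₂ : arch.GateLoc → Measure (Gate (Fin 2 × Fin 2))) (ν₁ : Fin n → Measure (Gate (Fin 2))) :
    Measure arch.Sample :=
  (Measure.pi ν₂).prod (Measure.pi ν₁)

/-- The Pauli is geometrically local: its support has diameter at most `A |P|`. -/
def IsLocalPauli (arch : Architecture D r m n L) (A : ℕ) (P : Fin n → Fin 4) : Prop :=
  ∀ q q' : Fin n, P q ≠ 0 → P q' ≠ 0 → ∀ k, |arch.pos q k - arch.pos q' k| ≤ (A * weight P : ℕ)

end

/-! ### The machine model

A random access machine over the complex numbers: programs are `while` programs with natural-number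
variables, arrays of natural numbers and arrays of complex numbers; the input is read by
random access queries. Arithmetic is exact. Every operation has cost one: there are addition,
truncated subtraction and halving of natural numbers (no multiplication), addition,
subtraction, multiplication and conjugation of complex numbers, comparison of natural numbers and
of real parts of complex numbers, reading and writing an array cell, and reading an input. -/

/-- Random access input: a query is a tag and a tuple of indices. -/
structure Input where
  nat : ℕ → ℕ → ℕ → ℕ → ℕ
  cplx : ℕ → ℕ → ℕ → ℕ → ℕ → ℕ → ℂ

/-- The memory: variables `var x`, array cells `arr a i` and complex array cells `carr a i`. -/
structure Mem where
  var : ℕ → ℕ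
  arr : ℕ → ℕ → ℕ
  carr : ℕ → ℕ → ℂ

/-- Natural-number expressions. -/
inductive NExp where
  | lit (k : ℕ)
  | var (x : ℕ)
  | arr (a : ℕ) (i : NExp)
  | inp (tag : ℕ) (i j k : NExp)
  | add (e f : NExp)
  | sub (e f : NExp)
  | half (e : NExp)

/-- Complex expressions. -/
inductive CExp where
  | zero
  | one
  | imag
  | arr (a : ℕ) (i : NExp)
  | inp (tag : ℕ) (i j k u v : NExp)
  | add (e f : CExp)
  | sub (e f : CExp)
  | mul (e f : CExp)
  | conj (e : CExp)

def NExp.eval (I : Input) (s : Mem) : NExp → ℕ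
  | .lit k => k
  | .var x => s.var x
  | .arr a i => s.arr a (i.eval I s)
  | .inp tag i j k => I.nat tag (i.eval I s) (j.eval I s) (k.eval I s)
  | .add e f => e.eval I s + f.eval I s
  | .sub e f => e.eval I s - f.eval I s
  | .half e => e.eval I s / 2

noncomputable def CExp.eval (I : Input) (s : Mem) : CExp → ℂ
  | .zero => 0
  | .one => 1
  | .imag => Complex.I
  | .arr a i => s.carr a (i.eval I s)
  | .inp tag i j k u v =>
      I.cplx tag (i.eval I s) (j.eval I s) (k.eval I s) (u.eval I s) (v.eval I s)
  | .add e f => e.eval I s + f.eval I s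
  | .sub e f => e.eval I s - f.eval I s
  | .mul e f => e.eval I s * f.eval I s
  | .conj e => star (e.eval I s)

/-- The number of operations needed to evaluate an expression. -/
def NExp.cost : NExp → ℕ
  | .lit _ => 1
  | .var _ => 1
  | .arr _ i => i.cost + 1
  | .inp _ i j k => i.cost + j.cost + k.cost + 1
  | .add e f => e.cost + f.cost + 1
  | .sub e f => e.cost + f.cost + 1
  | .half e => e.cost + 1

/-- The number of operations needed to evaluate an expression. -/
def CExp.cost : CExp → ℕ
  | .zero => 1
  | .one => 1
  | .imag => 1
  | .arr _ i => i.cost + 1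
  | .inp _ i j k u v => i.cost + j.cost + k.cost + u.cost + v.cost + 1
  | .add e f => e.cost + f.cost + 1
  | .sub e f => e.cost + f.cost + 1
  | .mul e f => e.cost + f.cost + 1
  | .conj e => e.cost + 1

/-- Programs. `ifLt` and `loop` test `e < f`; `ifLe` tests `Re e ≤ Re f`. -/
inductive Prog where
  | skip
  | setVar (x : ℕ) (e : NExp)
  | setArr (a : ℕ) (i e : NExp)
  | setCarr (a : ℕ) (i : NExp) (e : CExp)
  | seq (p q : Prog)
  | ifLt (e f : NExp) (p q : Prog)
  | ifLe (e f : CExp) (p q : Prog)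
  | loop (e f : NExp) (p : Prog)

def Mem.setVar (s : Mem) (x v : ℕ) : Mem := { s with var := Function.update s.var x v }

def Mem.setArr (s : Mem) (a i v : ℕ) : Mem :=
  { s with arr := Function.update s.arr a (Function.update (s.arr a) i v) }

noncomputable def Mem.setCarr (s : Mem) (a i : ℕ) (z : ℂ) : Mem :=
  { s with carr := Function.update s.carr a (Function.update (s.carr a) i z) }

/-- The initial memory. -/
noncomputable def Mem.init : Mem := ⟨fun _ => 0, fun _ _ => 0, fun _ _ => 0⟩

/-- `Run I p s T s'`: on input `I`, the program `p` started in memory `s` halts after exactly `T`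
operations, in memory `s'`. -/
inductive Run (I : Input) : Prog → Mem → ℕ → Mem → Prop
  | skip (s : Mem) : Run I .skip s 1 s
  | setVar (s : Mem) (x : ℕ) (e : NExp) :
      Run I (.setVar x e) s (e.cost + 1) (s.setVar x (e.eval I s))
  | setArr (s : Mem) (a : ℕ) (i e : NExp) :
      Run I (.setArr a i e) s (i.cost + e.cost + 1) (s.setArr a (i.eval I s) (e.eval I s))
  | setCarr (s : Mem) (a : ℕ) (i : NExp) (e : CExp) :
      Run I (.setCarr a i e) s (i.cost + e.cost + 1) (s.setCarr a (i.eval I s) (e.eval I s))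
  | seq {p q : Prog} {s s' s'' : Mem} {T T' : ℕ} :
      Run I p s T s' → Run I q s' T' s'' → Run I (.seq p q) s (T + T') s''
  | ifLt_pos {e f : NExp} {p q : Prog} {s s' : Mem} {T : ℕ} :
      e.eval I s < f.eval I s → Run I p s T s' →
        Run I (.ifLt e f p q) s (e.cost + f.cost + 1 + T) s'
  | ifLt_neg {e f : NExp} {p q : Prog} {s s' : Mem} {T : ℕ} :
      ¬ e.eval I s < f.eval I s → Run I q s T s' →
        Run I (.ifLt e f p q) s (e.cost + f.cost + 1 + T) s'
  | ifLe_pos {e f : CExp} {p q : Prog} {s s' : Mem} {T : ℕ} :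
      (e.eval I s).re ≤ (f.eval I s).re → Run I p s T s' →
        Run I (.ifLe e f p q) s (e.cost + f.cost + 1 + T) s'
  | ifLe_neg {e f : CExp} {p q : Prog} {s s' : Mem} {T : ℕ} :
      ¬ (e.eval I s).re ≤ (f.eval I s).re → Run I q s T s' →
        Run I (.ifLe e f p q) s (e.cost + f.cost + 1 + T) s'
  | loop_stop {e f : NExp} {p : Prog} {s : Mem} :
      ¬ e.eval I s < f.eval I s → Run I (.loop e f p) s (e.cost + f.cost + 1) s
  | loop_step {e f : NExp} {p : Prog} {s s' s'' : Mem} {T T' : ℕ} :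
      e.eval I s < f.eval I s → Run I p s T s' → Run I (.loop e f p) s' T' s'' →
        Run I (.loop e f p) s (e.cost + f.cost + 1 + T + T') s''

variable {D r m n L : ℕ}

/-- The classical description of the problem, as the machine reads it (indices start at `0`, and
queries out of range return `0`).
* natural numbers: tags `0, 1, 2` give the number of layers, the number of sublayers of a
  layer and the weight of `P`; tag `3` the `k`-th qubit of the support of `P`; tag `4` the
  letter of `P` at qubit `q`; tag `5` the partner of qubit `q` in sublayer `s` of layer `i`;
* complex numbers: tags `0, 1, 2` give `ε`, `δ` and the noise parameter `c`; tag `3` the entry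
  `(a, b)` of the final gate on qubit `q`; tag `4` the entry `(a, b)` of `N (|a'⟩⟨b'|)`; tag `5` the
  entry `(a, b)`, with `a, b < 4`, of the two-qubit gate in sublayer `s` of layer `i` whose smaller
  qubit is `q`. -/
noncomputable def encode (arch : Architecture D r m n L) (N : Op1 →ₗ[ℂ] Op1) (ω : arch.Sample)
    (P : Fin n → Fin 4) (ε δ c : ℝ) : Input where
  nat
    | 0, _, _, _ => L
    | 1, _, _, _ => m
    | 2, _, _, _ => weight P
    | 3, k, _, _ => ((suppList P).map Fin.val).getD k 0
    | 4, q, _, _ => if hq : q < n then (P ⟨q, hq⟩ : ℕ) else 0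
    | 5, i, s, q =>
        if h : i < L ∧ s < m ∧ q < n then
          (arch.partner ⟨i, h.1⟩ ⟨s, h.2.1⟩ ⟨q, h.2.2⟩ : ℕ)
        else 0
    | _, _, _, _ => 0
  cplx
    | 0, _, _, _, _, _ => (ε : ℂ)
    | 1, _, _, _, _, _ => (δ : ℂ)
    | 2, _, _, _, _, _ => (c : ℂ)
    | 3, q, a, b, _, _ =>
        if h : q < n ∧ a < 2 ∧ b < 2 then (ω.2 ⟨q, h.1⟩).1 ⟨a, h.2.1⟩ ⟨b, h.2.2⟩ else 0
    | 4, a, b, a', b', _ =>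
        if h : (a < 2 ∧ b < 2) ∧ a' < 2 ∧ b' < 2 then
          N (Matrix.single ⟨a', h.2.1⟩ ⟨b', h.2.2⟩ 1) ⟨a, h.1.1⟩ ⟨b, h.1.2⟩
        else 0
    | 5, i, s, q, a, b =>
        if h : (i < L ∧ s < m ∧ q < n) ∧ a < 4 ∧ b < 4 then
          if hg : (⟨q, h.1.2.2⟩ : Fin n) <
              arch.partner ⟨i, h.1.1⟩ ⟨s, h.1.2.1⟩ ⟨q, h.1.2.2⟩ then
            (ω.1 ⟨(⟨i, h.1.1⟩, ⟨s, h.1.2.1⟩, ⟨q, h.1.2.2⟩), hg⟩).1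
              (finProdFinEquiv.symm (⟨a, h.2.1⟩ : Fin (2 * 2)))
              (finProdFinEquiv.symm (⟨b, h.2.2⟩ : Fin (2 * 2)))
          else 0
        else 0
    | _, _, _, _, _, _ => 0

end NoisyCircuit

open NoisyCircuit

/-! The algorithm works in the Heisenberg picture: the observable `P` is carried backwards through
the final single-qubit layer and through the last `l` noisy layers, and then evaluated on the
initial state. The dual of a trace-preserving map fixes the identity, so gates and noise away from
the current support do nothing and only the backward light cone is stored, as an array of `4 ^ k`
coefficients for `k` qubits. The basis per qubit is `1, E₀₁, E₁₀, E₁₁`: its non-identity members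
vanish at the entry `(0, 0)`, so the expectation in the state `|0ⁿ⟩⟨0ⁿ|` is the single cell `0`
(`phi_zeroState`). The correctness and the cost of the program are proved together by loop
invariants, ending in `mainProg_reach`. The running time is governed by `k`. A sublayer enlarges the
support by distance at most `r`, so the light cone lies within distance `l * m * r` of the support
of `P`. The sites are distinct, hence counting lattice points bounds `k` (`length_near_le`,
`length_near_le_of_isLocalPauli`), and all other factors of the cost are absorbed in the exponential
(`exists_runtime_bounds`). The accuracy is a second moment estimate. In Pauli coordinates a unitary
acts by an orthogonal matrix. Under a two-design the second moments of its entries vanish unless the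
two entries coincide, and they depend on the input letter only through its support, because Haar
measure is invariant under multiplication by Paulis and by the unitary that permutes `X, Y, Z`.
Therefore the mean square of an output coordinate is a quadratic form in the coordinates further
back, and the class `Good` of such forms is propagated backwards. A layer of gates makes the form
diagonal with a diagonal that depends on the support only (`Good.gate`); for such a form the noise
acts through the average `c` of its three non-identity squared row norms, so the mass outside of the
identity shrinks by `c` (`Good.noise`). Truncation replaces the output of the discarded layers by
the initial state. Both have the same identity coordinate, so the error sees only the off-identity
part of the form after `l` layers, of mass at most `c ^ l`. The squared Pauli coordinates of the
initial state are at most `1`, so by `(a - b)² ≤ 2a² + 2b²` the mean square error is at most `4 * c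
^ l ≤ δ * ε²` (`lintegral_error_le`), and Markov's inequality concludes. That `c < 1` is the
equality case of Cauchy–Schwarz for the Choi matrix: its squared Hilbert–Schmidt norm is `1 + 3 *
c`, at most the squared trace `4`, and equality forces a single Kraus operator, hence a unitary
channel. -/

namespace NoisyCircuit

section

/-! ### Reasoning about programs -/

/-- From memory `s`, the program `p` halts within `B` operations, in a memory satisfying `Q`. -/
def Reach (I : Input) (p : Prog) (s : Mem) (B : ℕ) (Q : Mem → Prop) : Prop :=
  ∃ T s', Run I p s T s' ∧ T ≤ B ∧ Q s'

theorem Reach.mono {I : Input} {p : Prog} {s : Mem} {B B' : ℕ} {Q Q' : Mem → Prop}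
    (h : Reach I p s B Q) (hB : B ≤ B') (hQ : ∀ s', Q s' → Q' s') : Reach I p s B' Q' := by
  obtain ⟨T, s', hr, hT, hq⟩ := h
  exact ⟨T, s', hr, hT.trans hB, hQ _ hq⟩

theorem Reach.skip {I : Input} {s : Mem} {Q : Mem → Prop} (h : Q s) : Reach I .skip s 1 Q :=
  ⟨1, s, .skip s, le_rfl, h⟩

theorem Reach.setVar {I : Input} {s : Mem} {x : ℕ} {e : NExp} {Q : Mem → Prop}
    (h : Q (s.setVar x (e.eval I s))) : Reach I (.setVar x e) s (e.cost + 1) Q :=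
  ⟨_, _, .setVar s x e, le_rfl, h⟩

theorem Reach.setArr {I : Input} {s : Mem} {a : ℕ} {i e : NExp} {Q : Mem → Prop}
    (h : Q (s.setArr a (i.eval I s) (e.eval I s))) :
    Reach I (.setArr a i e) s (i.cost + e.cost + 1) Q :=
  ⟨_, _, .setArr s a i e, le_rfl, h⟩

theorem Reach.setCarr {I : Input} {s : Mem} {a : ℕ} {i : NExp} {e : CExp} {Q : Mem → Prop}
    (h : Q (s.setCarr a (i.eval I s) (e.eval I s))) :
    Reach I (.setCarr a i e) s (i.cost + e.cost + 1) Q :=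
  ⟨_, _, .setCarr s a i e, le_rfl, h⟩

theorem Reach.seq {I : Input} {p q : Prog} {s : Mem} {B B' : ℕ} {R Q : Mem → Prop}
    (h : Reach I p s B R) (h' : ∀ s', R s' → Reach I q s' B' Q) :
    Reach I (.seq p q) s (B + B') Q := by
  obtain ⟨T, s', hr, hT, hq⟩ := h
  obtain ⟨T', s'', hr', hT', hq'⟩ := h' s' hq
  exact ⟨_, s'', hr.seq hr', by omega, hq'⟩

theorem Reach.ifLt {I : Input} {e f : NExp} {p q : Prog} {s : Mem} {B : ℕ} {Q : Mem → Prop}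
    (h : e.eval I s < f.eval I s → Reach I p s B Q)
    (h' : ¬ e.eval I s < f.eval I s → Reach I q s B Q) :
    Reach I (.ifLt e f p q) s (e.cost + f.cost + 1 + B) Q := by
  by_cases hc : e.eval I s < f.eval I s
  · obtain ⟨T, s', hr, hT, hq⟩ := h hc
    exact ⟨_, s', .ifLt_pos hc hr, by omega, hq⟩
  · obtain ⟨T, s', hr, hT, hq⟩ := h' hc
    exact ⟨_, s', .ifLt_neg hc hr, by omega, hq⟩

theorem Reach.ifLe {I : Input} {e f : CExp} {p q : Prog} {s : Mem} {B : ℕ} {Q : Mem → Prop}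
    (h : (e.eval I s).re ≤ (f.eval I s).re → Reach I p s B Q)
    (h' : ¬ (e.eval I s).re ≤ (f.eval I s).re → Reach I q s B Q) :
    Reach I (.ifLe e f p q) s (e.cost + f.cost + 1 + B) Q := by
  by_cases hc : (e.eval I s).re ≤ (f.eval I s).re
  · obtain ⟨T, s', hr, hT, hq⟩ := h hc
    exact ⟨_, s', .ifLe_pos hc hr, by omega, hq⟩
  · obtain ⟨T, s', hr, hT, hq⟩ := h' hc
    exact ⟨_, s', .ifLe_neg hc hr, by omega, hq⟩

/-- A loop that runs through the stages `j, …, N` of an invariant. -/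
theorem Reach.loop {I : Input} {e f : NExp} {p : Prog} {B : ℕ} (N : ℕ) (Inv : ℕ → Mem → Prop)
    (hstep : ∀ j s, j < N → Inv j s → e.eval I s < f.eval I s ∧ Reach I p s B (Inv (j + 1)))
    (hexit : ∀ s, Inv N s → ¬ e.eval I s < f.eval I s) {s : Mem} (h0 : Inv 0 s) :
    Reach I (.loop e f p) s ((N + 1) * (e.cost + f.cost + 1 + B)) (Inv N) := by
  have key : ∀ k j s, j + k = N → Inv j s →
      Reach I (.loop e f p) s ((k + 1) * (e.cost + f.cost + 1 + B)) (Inv N) := by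
    intro k
    induction k with
    | zero =>
      intro j s hj hs
      obtain rfl : j = N := by omega
      have hrun : Run I (.loop e f p) s (e.cost + f.cost + 1) s := by
        constructor
        exact hexit s hs
      exact ⟨_, s, hrun, by omega, hs⟩
    | succ k ih =>
      intro j s hj hs
      obtain ⟨hlt, T, s', hr, hT, hs'⟩ := hstep j s (by omega) hs
      obtain ⟨T', s'', hr', hT', hs''⟩ := ih (j + 1) s' (by omega) hs'
      refine ⟨_, s'', .loop_step hlt hr hr', ?_, hs''⟩
      have : (k + 1 + 1) * (e.cost + f.cost + 1 + B)
        = (k + 1) * (e.cost + f.cost + 1 + B) + (e.cost + f.cost + 1 + B) := by ring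
      omega
  exact key N 0 s (by omega) h0

@[simp] theorem Mem.setVar_var (s : Mem) (x v y : ℕ) :
    (s.setVar x v).var y = if y = x then v else s.var y := by
  simp [Mem.setVar, Function.update_apply]

@[simp] theorem Mem.setVar_arr (s : Mem) (x v : ℕ) : (s.setVar x v).arr = s.arr := rfl

@[simp] theorem Mem.setVar_carr (s : Mem) (x v : ℕ) : (s.setVar x v).carr = s.carr := rfl

@[simp] theorem Mem.setArr_var (s : Mem) (a i v : ℕ) : (s.setArr a i v).var = s.var := rfl

@[simp] theorem Mem.setArr_arr (s : Mem) (a i v b j : ℕ) :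
    (s.setArr a i v).arr b j = if b = a ∧ j = i then v else s.arr b j := by
  by_cases h : b = a
  · subst h; simp [Mem.setArr, Function.update_apply]
  · simp [Mem.setArr, h]

@[simp] theorem Mem.setArr_carr (s : Mem) (a i v : ℕ) : (s.setArr a i v).carr = s.carr := rfl

@[simp] theorem Mem.setCarr_var (s : Mem) (a i : ℕ) (z : ℂ) : (s.setCarr a i z).var = s.var := rfl

@[simp] theorem Mem.setCarr_arr (s : Mem) (a i : ℕ) (z : ℂ) : (s.setCarr a i z).arr = s.arr := rfl

@[simp] theorem Mem.setCarr_carr (s : Mem) (a i : ℕ) (z : ℂ) (b j : ℕ) :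
    (s.setCarr a i z).carr b j = if b = a ∧ j = i then z else s.carr b j := by
  by_cases h : b = a
  · subst h; simp [Mem.setCarr, Function.update_apply]
  · simp [Mem.setCarr, h]

/-- Finite sums of complex expressions. -/
def CExp.sum (l : List CExp) : CExp := l.foldr .add .zero

theorem CExp.eval_sum (I : Input) (s : Mem) (l : List CExp) :
    (CExp.sum l).eval I s = (l.map (CExp.eval I s)).sum := by
  induction l with
  | nil => rfl
  | cons e l ih =>
    show e.eval I s + (CExp.sum l).eval I s = _
    simp [ih]

/-- The expression for `∑ i, f i`. -/
def CExp.fsum {k : ℕ} (f : Fin k → CExp) : CExp := CExp.sum ((List.finRange k).map f)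

@[simp] theorem CExp.eval_fsum (I : Input) (s : Mem) {k : ℕ} (f : Fin k → CExp) :
    (CExp.fsum f).eval I s = ∑ i, (f i).eval I s := by
  rw [CExp.fsum, CExp.eval_sum, List.map_map, Fin.sum_univ_def]
  rfl

/-- Writes the cells `i` of the complex array `a`, for the pairs `(i, e)` of the list. -/
def storeAll (a : ℕ) : List (NExp × CExp) → Prog
  | [] => .skip
  | ie :: l => .seq (.setCarr a ie.1 ie.2) (storeAll a l)

/-- An upper bound for the cost of `storeAll`. -/
def storeCost : List (NExp × CExp) → ℕ
  | [] => 1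
  | ie :: l => ie.1.cost + ie.2.cost + 1 + storeCost l

/-- `s'` differs from `s` in the complex array `a` only. -/
def SameButCarr (a : ℕ) (s s' : Mem) : Prop :=
  s'.var = s.var ∧ s'.arr = s.arr ∧ ∀ b, b ≠ a → s'.carr b = s.carr b

/-- This is a simultaneous assignment: addresses and values do not depend on the array being
written, so every write still sees the values of `s₀`, and distinct addresses keep later writes from
destroying earlier ones. -/
theorem storeAll_reach (I : Input) (a : ℕ) (s₀ : Mem) (l : List (NExp × CExp))
    (hl : ∀ ie ∈ l, ∀ s', SameButCarr a s₀ s' →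
      ie.1.eval I s' = ie.1.eval I s₀ ∧ ie.2.eval I s' = ie.2.eval I s₀)
    (hd : (l.map fun ie => ie.1.eval I s₀).Nodup) (s : Mem) (hs : SameButCarr a s₀ s) :
    Reach I (storeAll a l) s (storeCost l) fun s' => SameButCarr a s₀ s' ∧
      (∀ ie ∈ l, s'.carr a (ie.1.eval I s₀) = ie.2.eval I s₀) ∧
      ∀ i, (∀ ie ∈ l, i ≠ ie.1.eval I s₀) → s'.carr a i = s.carr a i := by
  induction l generalizing s with
  | nil => exact Reach.skip ⟨hs, by simp, by simp⟩
  | cons ie l ih =>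
    have he := hl ie (by simp) s hs
    have hs1 : SameButCarr a s₀ (s.setCarr a (ie.1.eval I s) (ie.2.eval I s)) := by
      refine ⟨hs.1, hs.2.1, fun b hb => ?_⟩
      rw [← hs.2.2 b hb]
      ext j
      simp [hb]
    rw [List.map_cons, List.nodup_cons] at hd
    refine Reach.seq (Reach.setCarr (Q := (· = s.setCarr a (ie.1.eval I s) (ie.2.eval I s))) rfl) ?_
    rintro _ rfl
    refine (ih (fun x hx => hl x (by simp [hx])) hd.2 _ hs1).mono le_rfl ?_
    rintro s' ⟨h1, h2, h3⟩
    have hnot : ∀ x ∈ l, ie.1.eval I s₀ ≠ x.1.eval I s₀ := by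
      intro x hx hxe
      exact hd.1 (hxe ▸ List.mem_map_of_mem (f := fun ie => ie.1.eval I s₀) hx)
    refine ⟨h1, ?_, ?_⟩
    · intro x hx
      rcases List.mem_cons.mp hx with rfl | hx
      · rw [h3 _ hnot]
        simp [he.1, he.2]
      · exact h2 x hx
    · intro i hi
      rw [h3 i fun x hx => hi x (by simp [hx])]
      have : i ≠ ie.1.eval I s₀ := hi ie (by simp)
      simp [he.1, this]

/-! ### Base four digits -/

theorem digit_add_same (p j x : ℕ) (hx : x < 4) (hj : j / 4 ^ p % 4 = 0) :
    (j + x * 4 ^ p) / 4 ^ p % 4 = x := by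
  rw [Nat.add_mul_div_right _ _ (by positivity)]
  omega

/-- Filling a vanishing digit causes no carry. -/
theorem digit_add_other (p p' j x : ℕ) (hx : x < 4) (hj : j / 4 ^ p % 4 = 0) (hp : p ≠ p') :
    (j + x * 4 ^ p) / 4 ^ p' % 4 = j / 4 ^ p' % 4 := by
  rcases lt_or_gt_of_ne hp with h | h
  · obtain ⟨d, rfl⟩ := Nat.exists_eq_add_of_lt h
    have e : 4 ^ (p + d + 1) = 4 ^ p * 4 * 4 ^ d := by ring
    rw [e, ← Nat.div_div_eq_div_mul, ← Nat.div_div_eq_div_mul, ← Nat.div_div_eq_div_mul,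
      ← Nat.div_div_eq_div_mul, Nat.add_mul_div_right _ _ (by positivity)]
    congr 2
    omega
  · obtain ⟨d, rfl⟩ := Nat.exists_eq_add_of_lt h
    have e : x * 4 ^ (p' + d + 1) = (x * 4 ^ d * 4) * 4 ^ p' := by ring
    rw [e, Nat.add_mul_div_right _ _ (by positivity)]
    omega

/-- `i` with the digits at `4 ^ p` and `4 ^ p'` replaced by zero. -/
def clear2 (p p' i : ℕ) : ℕ := i - i / 4 ^ p % 4 * 4 ^ p - i / 4 ^ p' % 4 * 4 ^ p'

theorem digit_sub_le (p i : ℕ) : i / 4 ^ p % 4 * 4 ^ p ≤ i :=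
  (Nat.mul_le_mul_right _ (Nat.mod_le _ _)).trans (Nat.div_mul_le_self _ _)

theorem digit_sub_same (p i : ℕ) : (i - i / 4 ^ p % 4 * 4 ^ p) / 4 ^ p % 4 = 0 := by
  have h := Nat.sub_mul_div i (4 ^ p) (i / 4 ^ p % 4)
  rw [mul_comm, h]
  omega

theorem digit_sub_other (p p' i : ℕ) (hp : p ≠ p') :
    (i - i / 4 ^ p % 4 * 4 ^ p) / 4 ^ p' % 4 = i / 4 ^ p' % 4 := by
  have h := digit_add_other p p' _ (i / 4 ^ p % 4) (by omega) (digit_sub_same p i) hp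
  rw [Nat.sub_add_cancel (digit_sub_le p i)] at h
  exact h.symm

theorem clear2_add (p p' i : ℕ) (hp : p ≠ p') :
    clear2 p p' i + i / 4 ^ p % 4 * 4 ^ p + i / 4 ^ p' % 4 * 4 ^ p' = i := by
  have h1 := digit_sub_le p i
  have h2 := digit_sub_le p' (i - i / 4 ^ p % 4 * 4 ^ p)
  rw [digit_sub_other p p' i hp] at h2
  unfold clear2
  omega

theorem clear2_digit_right (p p' i : ℕ) (hp : p ≠ p') : clear2 p p' i / 4 ^ p' % 4 = 0 := by
  have := digit_sub_same p' (i - i / 4 ^ p % 4 * 4 ^ p)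
  rwa [digit_sub_other p p' i hp] at this

theorem clear2_digit_left (p p' i : ℕ) (hp : p ≠ p') : clear2 p p' i / 4 ^ p % 4 = 0 := by
  have := digit_sub_other p' p (i - i / 4 ^ p % 4 * 4 ^ p) hp.symm
  rw [digit_sub_other p p' i hp, digit_sub_same] at this
  exact this

/-- The cell whose digits at `4 ^ p` and `4 ^ p'` are `x` and `y`. -/
def cell (p p' j x y : ℕ) : ℕ := j + x * 4 ^ p + y * 4 ^ p'

theorem cell_digit_right {p p' j x y : ℕ} (hp : p ≠ p') (hx : x < 4) (hy : y < 4)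
    (hj : j / 4 ^ p % 4 = 0) (hj' : j / 4 ^ p' % 4 = 0) :
    cell p p' j x y / 4 ^ p' % 4 = y :=
  digit_add_same _ _ _ hy (by rw [digit_add_other p p' j x hx hj hp, hj'])

theorem cell_digit_left {p p' j x y : ℕ} (hp : p ≠ p') (hx : x < 4) (hy : y < 4)
    (hj : j / 4 ^ p % 4 = 0) (hj' : j / 4 ^ p' % 4 = 0) :
    cell p p' j x y / 4 ^ p % 4 = x := by
  rw [cell, digit_add_other p' p _ y hy (by rw [digit_add_other p p' j x hx hj hp, hj']) hp.symm,
    digit_add_same _ _ _ hx hj]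

/-- With `cell_clear2` this splits the indices into blocks of sixteen cells, one block for each
index whose two chosen digits vanish. The array update treats one block at a time. -/
theorem clear2_cell {p p' j x y : ℕ} (hp : p ≠ p') (hx : x < 4) (hy : y < 4)
    (hj : j / 4 ^ p % 4 = 0) (hj' : j / 4 ^ p' % 4 = 0) :
    clear2 p p' (cell p p' j x y) = j := by
  have h := clear2_add p p' (cell p p' j x y) hp
  rw [cell_digit_left hp hx hy hj hj', cell_digit_right hp hx hy hj hj'] at h
  simp only [cell] at h ⊢
  omega

theorem cell_clear2 (p p' i : ℕ) (hp : p ≠ p') :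
    cell p p' (clear2 p p' i) (i / 4 ^ p % 4) (i / 4 ^ p' % 4) = i := clear2_add p p' i hp

end

section

/-! ### The update of the coefficient array by a two-digit linear map -/

/-- The `k`-fold sum of an expression. -/
def NExp.rep : ℕ → NExp → NExp
  | 0, _ => .lit 0
  | k + 1, e => .add (NExp.rep k e) e

@[simp] theorem NExp.eval_rep (I : Input) (s : Mem) (k : ℕ) (e : NExp) :
    (NExp.rep k e).eval I s = k * e.eval I s := by
  induction k with
  | zero => simp [NExp.rep, NExp.eval]
  | succ k ih => simp [NExp.rep, NExp.eval, ih, Nat.succ_mul]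

/-- The last base four digit of an expression. -/
def NExp.digit (e : NExp) : NExp := .sub e (NExp.rep 4 (.half (.half e)))

@[simp] theorem NExp.eval_digit (I : Input) (s : Mem) (e : NExp) :
    e.digit.eval I s = e.eval I s % 4 := by
  simp only [NExp.digit, NExp.eval, NExp.eval_rep]
  omega

/-- Variables from `t` on may have changed, and the complex arrays `0` and `1` (the coefficients and
a buffer): everything else is unchanged. -/
def Frame (t : ℕ) (s s' : Mem) : Prop :=
  (∀ x, x < t → s'.var x = s.var x) ∧ s'.arr = s.arr ∧ ∀ a, 2 ≤ a → s'.carr a = s.carr a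

theorem Frame.refl (t : ℕ) (s : Mem) : Frame t s s := ⟨fun _ _ => rfl, rfl, fun _ _ => rfl⟩

theorem Frame.trans {t : ℕ} {s s' s'' : Mem} (h : Frame t s s') (h' : Frame t s' s'') :
    Frame t s s'' :=
  ⟨fun x hx => (h'.1 x hx).trans (h.1 x hx), h'.2.1.trans h.2.1,
    fun a ha => (h'.2.2 a ha).trans (h.2.2 a ha)⟩

theorem Frame.mono {t t' : ℕ} {s s' : Mem} (h : Frame t s s') (ht : t' ≤ t) : Frame t' s s' :=
  ⟨fun x hx => h.1 x (hx.trans_le ht), h.2⟩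

theorem Frame.setVar {t : ℕ} {s s' : Mem} (h : Frame t s s') {x : ℕ} (hx : t ≤ x) (v : ℕ) :
    Frame t s (s'.setVar x v) :=
  ⟨fun y hy => by rw [Mem.setVar_var, if_neg (by omega)]; exact h.1 y hy, h.2⟩

/-- Divides variable `22` by the power of two in variable `w`; the result is in variable `23`. -/
def divide (w : ℕ) : Prog :=
  .seq (.setVar 23 (.var 22)) (.seq (.setVar 24 (.var w))
    (.loop (.lit 1) (.var 24)
      (.seq (.setVar 23 (.half (.var 23))) (.setVar 24 (.half (.var 24))))))

theorem divide_reach (I : Input) (s : Mem) (w p : ℕ) (hw : s.var w = 4 ^ p) (hw' : w < 22) :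
    Reach I (divide w) s (4 + (2 * p + 1) * 9) fun s' =>
      s'.var 23 = s.var 22 / 4 ^ p ∧ (∀ x, x ≠ 23 → x ≠ 24 → s'.var x = s.var x) ∧
        s'.arr = s.arr ∧ s'.carr = s.carr := by
  refine Reach.mono (B := 2 + (2 + (2 * p + 1) * (1 + 1 + 1 + (3 + 3)))) ?_ (by omega) fun _ h => h
  refine Reach.seq (Reach.setVar (Q := (· = s.setVar 23 (s.var 22))) rfl) ?_
  rintro _ rfl
  refine Reach.seq (Reach.setVar (Q := (· = (s.setVar 23 (s.var 22)).setVar 24 (4 ^ p))) ?_) ?_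
  · simp only [NExp.eval, Mem.setVar_var, ← hw]
    rw [if_neg (by omega)]
  rintro _ rfl
  -- Each pass halves both numbers; the counter starts at `4 ^ p = 2 ^ (2 * p)` and is `1` after `2
  -- * p` passes.
  refine (Reach.loop (2 * p) (fun j s' => s'.var 23 = s.var 22 / 2 ^ j ∧
    s'.var 24 = 2 ^ (2 * p - j) ∧ (∀ x, x ≠ 23 → x ≠ 24 → s'.var x = s.var x) ∧
        s'.arr = s.arr ∧ s'.carr = s.carr) ?_ ?_ ?_).mono le_rfl ?_
  · rintro j s' hj ⟨h1, h2, h3, h4, h5⟩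
    obtain ⟨d, hd⟩ : ∃ d, 2 * p - j = d + 1 := ⟨2 * p - j - 1, by omega⟩
    rw [hd] at h2
    have hpos : 0 < 2 ^ d := by positivity
    refine ⟨?_, ?_⟩
    · simp only [NExp.eval, h2, pow_succ]
      omega
    refine Reach.seq (Reach.setVar (Q := (· = s'.setVar 23 (s'.var 23 / 2))) rfl) ?_
    rintro _ rfl
    refine Reach.setVar ?_
    refine ⟨?_, ?_, ?_, ?_, ?_⟩
    · simp [h1, Nat.div_div_eq_div_mul, pow_succ]
    · have : 2 * p - (j + 1) = d := by omega
      simp [NExp.eval, h2, this, pow_succ]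
    · intro x hx hx'
      simp [hx, hx', h3]
    · simpa using h4
    · simpa using h5
  · rintro s' ⟨-, h2, -⟩
    simp [NExp.eval, h2]
  · refine ⟨by simp, by simp [pow_mul], ?_, rfl, rfl⟩
    intro x hx hx'
    simp [hx, hx']
  · rintro s' ⟨h1, -, h3, h4, h5⟩
    exact ⟨by rw [h1, pow_mul]; norm_num, h3, h4, h5⟩

/-- All pairs of digits. -/
def digitPairs : List (Fin 4 × Fin 4) := (List.finRange 4).product (List.finRange 4)

theorem mem_digitPairs (x : Fin 4 × Fin 4) : x ∈ digitPairs := by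
  obtain ⟨a, b⟩ := x
  exact List.mem_product.mpr ⟨List.mem_finRange a, List.mem_finRange b⟩

theorem digitPairs_nodup : digitPairs.Nodup :=
  (List.nodup_finRange 4).product (List.nodup_finRange 4)

/-- The address of the cell with digits `x`, `y` in the block of variable `22`. -/
def addr (x y : Fin 4) : NExp :=
  .add (.add (.var 22) (NExp.rep x (.var 20))) (NExp.rep y (.var 21))

theorem eval_addr (I : Input) (s : Mem) {p p' : ℕ} (h20 : s.var 20 = 4 ^ p)
    (h21 : s.var 21 = 4 ^ p') (x y : Fin 4) :
    (addr x y).eval I s = cell p p' (s.var 22) x y := by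
  simp [addr, NExp.eval, h20, h21, cell]

/-- Copies of the cells of a block to the buffer. -/
def loads : List (NExp × CExp) :=
  digitPairs.map fun x => (.lit (4 * x.1 + x.2), .arr 0 (addr x.1 x.2))

/-- The new values of the cells of a block. -/
def stores (T : Fin 4 → Fin 4 → Fin 4 → Fin 4 → CExp) : List (NExp × CExp) :=
  digitPairs.map fun u => (addr u.1 u.2, CExp.fsum fun x => CExp.fsum fun y =>
    .mul (.arr 1 (.lit (4 * x + y))) (T x y u.1 u.2))

/-- The update of one block. -/
def block (T : Fin 4 → Fin 4 → Fin 4 → Fin 4 → CExp) : Prog :=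
  .seq (storeAll 1 loads) (storeAll 0 (stores T))

/-- A bound for the cost of `block`. -/
def blockCost (T : Fin 4 → Fin 4 → Fin 4 → Fin 4 → CExp) : ℕ :=
  storeCost loads + storeCost (stores T)

/-- The digit of `i` at `4 ^ p`. -/
def dig (p i : ℕ) : Fin 4 := ⟨i / 4 ^ p % 4, Nat.mod_lt _ (by norm_num)⟩

theorem cell_injective {p p' j : ℕ} (hp : p ≠ p') (hj : j / 4 ^ p % 4 = 0)
    (hj' : j / 4 ^ p' % 4 = 0) {x y u v : Fin 4} (h : cell p p' j x y = cell p p' j u v) :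
    x = u ∧ y = v := by
  constructor <;> ext
  · rw [← cell_digit_left hp x.2 y.2 hj hj', h, cell_digit_left hp u.2 v.2 hj hj']
  · rw [← cell_digit_right hp x.2 y.2 hj hj', h, cell_digit_right hp u.2 v.2 hj hj']

/-- All sixteen old values enter every new value, so they are first copied to the buffer. The table
`T` may read only what `Frame 20` preserves, hence its values do not move while the block is being
rewritten. -/
theorem block_reach (I : Input) (s : Mem) {p p' : ℕ} (hp : p ≠ p') (h20 : s.var 20 = 4 ^ p)
    (h21 : s.var 21 = 4 ^ p') (hj : s.var 22 / 4 ^ p % 4 = 0) (hj' : s.var 22 / 4 ^ p' % 4 = 0)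
    (T : Fin 4 → Fin 4 → Fin 4 → Fin 4 → CExp) (τ : Fin 4 → Fin 4 → Fin 4 → Fin 4 → ℂ)
    (hT : ∀ s', Frame 20 s s' → ∀ x y u v, (T x y u v).eval I s' = τ x y u v) :
    Reach I (block T) s (blockCost T) fun s' => s'.var = s.var ∧ s'.arr = s.arr ∧
      (∀ a, 2 ≤ a → s'.carr a = s.carr a) ∧
      (∀ u v : Fin 4, s'.carr 0 (cell p p' (s.var 22) u v) =
        ∑ x : Fin 4, ∑ y : Fin 4, s.carr 0 (cell p p' (s.var 22) x y) * τ x y u v) ∧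
      ∀ i, (∀ u v : Fin 4, i ≠ cell p p' (s.var 22) u v) → s'.carr 0 i = s.carr 0 i := by
  refine Reach.seq (storeAll_reach I 1 s loads ?_ ?_ s ⟨rfl, rfl, fun _ _ => rfl⟩) ?_
  · intro ie hie s' hs'
    obtain ⟨x, -, rfl⟩ := List.mem_map.mp hie
    have := hs'.2.2 0 (by norm_num)
    simp [NExp.eval, CExp.eval, addr, hs'.1, this]
  · rw [loads, List.map_map]
    refine digitPairs_nodup.map ?_
    rintro ⟨x, y⟩ ⟨u, v⟩ h
    simp only [Function.comp, NExp.eval] at h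
    ext <;> simp only <;> omega
  rintro s1 ⟨h1, h2, -⟩
  have h2' : ∀ x y : Fin 4, s1.carr 1 (4 * x + y) = s.carr 0 (cell p p' (s.var 22) x y) := by
    intro x y
    have := h2 _ (List.mem_map_of_mem (mem_digitPairs (x, y)))
    simpa only [NExp.eval, CExp.eval, eval_addr I s h20 h21] using this
  have hfr : ∀ s', SameButCarr 0 s1 s' → Frame 20 s s' := by
    intro s' hs'
    refine ⟨fun x _ => by rw [hs'.1, h1.1], by rw [hs'.2.1, h1.2.1], fun a ha => ?_⟩
    rw [hs'.2.2 a (by omega), h1.2.2 a (by omega)]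
  have haddr : ∀ s', SameButCarr 0 s1 s' → ∀ u v, (addr u v).eval I s' =
      cell p p' (s.var 22) u v := by
    intro s' hs' u v
    rw [eval_addr I s' (p := p) (p' := p'), hs'.1, h1.1] <;> rw [hs'.1, h1.1] <;> assumption
  have hself : SameButCarr 0 s1 s1 := ⟨rfl, rfl, fun _ _ => rfl⟩
  have hval : ∀ s', SameButCarr 0 s1 s' → ∀ u v : Fin 4, (CExp.fsum fun x => CExp.fsum fun y =>
      CExp.mul (.arr 1 (.lit (4 * x + y))) (T x y u v)).eval I s' =
      ∑ x : Fin 4, ∑ y : Fin 4, s.carr 0 (cell p p' (s.var 22) x y) * τ x y u v := by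
    intro s' hs' u v
    simp only [CExp.eval_fsum, CExp.eval, NExp.eval, hs'.2.2 1 (by norm_num), h2',
      hT s' (hfr s' hs')]
  refine (storeAll_reach I 0 s1 (stores T) ?_ ?_ s1 hself).mono le_rfl ?_
  · intro ie hie s' hs'
    obtain ⟨u, -, rfl⟩ := List.mem_map.mp hie
    exact ⟨(haddr s' hs' _ _).trans (haddr s1 hself _ _).symm,
      (hval s' hs' _ _).trans (hval s1 hself _ _).symm⟩
  · rw [stores, List.map_map]
    refine digitPairs_nodup.map ?_
    rintro ⟨x, y⟩ ⟨u, v⟩ h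
    simp only [Function.comp, haddr s1 hself] at h
    obtain ⟨rfl, rfl⟩ := cell_injective hp hj hj' h
    rfl
  · rintro s' ⟨g1, g2, g3⟩
    have hf := hfr s' g1
    refine ⟨by rw [g1.1, h1.1], hf.2.1, hf.2.2, ?_, ?_⟩
    · intro u v
      have := g2 _ (List.mem_map_of_mem (mem_digitPairs (u, v)))
      rwa [haddr s1 hself, hval s1 hself] at this
    · intro i hi
      rw [g3 i, h1.2.2 0 (by norm_num)]
      intro ie hie
      obtain ⟨u, -, rfl⟩ := List.mem_map.mp hie
      rw [haddr s1 hself]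
      exact hi _ _

/-- Applies a linear map to the digits with weights in variables `20` and `21`. -/
def applyPair (T : Fin 4 → Fin 4 → Fin 4 → Fin 4 → CExp) : Prog :=
  .seq (.setVar 22 (.lit 0)) (.loop (.var 22) (.var 2)
    (.seq (.seq (divide 20) (.ifLt (NExp.digit (.var 23)) (.lit 1)
      (.seq (divide 21) (.ifLt (NExp.digit (.var 23)) (.lit 1) (block T) .skip)) .skip))
      (.setVar 22 (.add (.var 22) (.lit 1)))))

/-- A bound for the cost of `applyPair` on an array of size `4 ^ k`. -/
def applyCost (T : Fin 4 → Fin 4 → Fin 4 → Fin 4 → CExp) (k : ℕ) : ℕ :=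
  (4 ^ k + 1) * (36 * k + blockCost T + 100)

/-- Every index below `4 ^ k` is visited, and a block is updated when its base point, the index with
both digits zero, is met. The position `k` itself is allowed as a digit: single-qubit maps use it as
a dummy second digit. -/
theorem applyPair_reach (I : Input) (s : Mem) {p p' k : ℕ} (hp : p ≠ p') (hpk : p ≤ k)
    (hpk' : p' ≤ k) (h20 : s.var 20 = 4 ^ p)
    (h21 : s.var 21 = 4 ^ p') (hW : s.var 2 = 4 ^ k)
    (T : Fin 4 → Fin 4 → Fin 4 → Fin 4 → CExp) (τ : Fin 4 → Fin 4 → Fin 4 → Fin 4 → ℂ)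
    (hT : ∀ s', Frame 20 s s' → ∀ x y u v, (T x y u v).eval I s' = τ x y u v) :
    Reach I (applyPair T) s (applyCost T k) fun s' => Frame 20 s s' ∧
      ∀ i, s'.carr 0 i = if clear2 p p' i < 4 ^ k then ∑ x : Fin 4, ∑ y : Fin 4,
        s.carr 0 (cell p p' (clear2 p p' i) x y) * τ x y (dig p i) (dig p' i)
        else s.carr 0 i := by
  have hdc : (NExp.digit (.var 23)).cost = 19 := rfl
  refine Reach.mono (B := 2 + (4 ^ k + 1) * (1 + 1 + 1 + (((4 + (2 * p + 1) * 9) +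
    (19 + 1 + 1 + ((4 + (2 * p' + 1) * 9) + (19 + 1 + 1 + (blockCost T + 1))))) + 4)))
    ?_ ?_ fun _ h => h
  swap
  · unfold applyCost
    have h1 : 1 ≤ 4 ^ k := Nat.one_le_pow _ _ (by norm_num)
    have h2 : (4 ^ k + 1) * (1 + 1 + 1 + (((4 + (2 * p + 1) * 9) +
      (19 + 1 + 1 + ((4 + (2 * p' + 1) * 9) + (19 + 1 + 1 + (blockCost T + 1))))) + 4)) ≤
      (4 ^ k + 1) * (36 * k + blockCost T + 99) := Nat.mul_le_mul_left _ (by omega)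
    have h3 : (4 ^ k + 1) * (36 * k + blockCost T + 100) =
      (4 ^ k + 1) * (36 * k + blockCost T + 99) + (4 ^ k + 1) := by ring
    omega
  set new : ℕ → ℂ := fun i => ∑ x : Fin 4, ∑ y : Fin 4,
        s.carr 0 (cell p p' (clear2 p p' i) x y) * τ x y (dig p i) (dig p' i) with hnew
  refine Reach.seq (Reach.setVar (Q := (· = s.setVar 22 0)) rfl) ?_
  rintro _ rfl
  -- Invariant: exactly the blocks with base point below `J` carry their new values.
  refine (Reach.loop (4 ^ k) (fun J s' => Frame 20 s s' ∧ s'.var 20 = 4 ^ p ∧ s'.var 21 = 4 ^ p' ∧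
    s'.var 22 = J ∧ ∀ i, s'.carr 0 i = if clear2 p p' i < J then new i else s.carr 0 i)
    ?_ ?_ ?_).mono le_rfl ?_
  · rintro J s1 hJ ⟨hf, g20, g21, g22, gC⟩
    refine ⟨by simp [NExp.eval, g22, hf.1, hW, hJ], ?_⟩
    refine Reach.seq (R := fun s' => Frame 20 s s' ∧ s'.var 20 = 4 ^ p ∧ s'.var 21 = 4 ^ p' ∧
      s'.var 22 = J ∧ ∀ i, s'.carr 0 i = if clear2 p p' i < J + 1 then new i else s.carr 0 i) ?_ ?_
    swap
    · rintro s' ⟨f1, f2, f3, f4, f5⟩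
      refine Reach.setVar ⟨⟨fun x hx => ?_, f1.2.1, f1.2.2⟩, ?_, ?_, ?_, ?_⟩
      · simp [show x ≠ 22 by omega, f1.1 x hx]
      · simp [f2]
      · simp [f3]
      · simp [f4, NExp.eval]
      · simpa using f5
    -- An index with a nonzero digit is not a base point, so nothing has to be done for it.
    have hskip : ∀ s' : Mem, (J / 4 ^ p % 4 ≠ 0 ∨ J / 4 ^ p' % 4 ≠ 0) → s'.carr = s1.carr →
        ∀ i, s'.carr 0 i = if clear2 p p' i < J + 1 then new i else s.carr 0 i := by
      intro s' hne hc i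
      have : clear2 p p' i ≠ J := by
        rintro rfl
        rw [clear2_digit_left _ _ _ hp, clear2_digit_right _ _ _ hp] at hne
        simp at hne
      rw [hc, gC, if_congr (Q := clear2 p p' i < J + 1) (by omega) rfl rfl]
    refine Reach.seq (divide_reach I s1 20 p g20 (by norm_num)) ?_
    rintro s2 ⟨a1, a2, a3, a4⟩
    rw [g22] at a1
    have hf2 : Frame 20 s s2 := by
      refine hf.trans ⟨fun x hx => a2 x (by omega) (by omega), a3, fun a _ => by rw [a4]⟩
    have b20 := (a2 20 (by norm_num) (by norm_num)).trans g20
    have b21 := (a2 21 (by norm_num) (by norm_num)).trans g21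
    have b22 := (a2 22 (by norm_num) (by norm_num)).trans g22
    refine Reach.ifLt (fun hc => ?_) (fun hc => ?_)
    swap
    · simp only [NExp.eval_digit, NExp.eval, a1] at hc
      exact (Reach.skip ⟨hf2, b20, b21, b22, hskip s2 (Or.inl (by omega)) a4⟩).mono
        (by omega) fun _ h => h
    simp only [NExp.eval_digit, NExp.eval, a1, Nat.lt_one_iff] at hc
    refine Reach.seq (divide_reach I s2 21 p' b21 (by norm_num)) ?_
    rintro s3 ⟨c1, c2, c3, c4⟩
    rw [b22] at c1
    have hf3 : Frame 20 s s3 := by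
      refine hf2.trans ⟨fun x hx => c2 x (by omega) (by omega), c3, fun a _ => by rw [c4]⟩
    have d20 := (c2 20 (by norm_num) (by norm_num)).trans b20
    have d21 := (c2 21 (by norm_num) (by norm_num)).trans b21
    have d22 := (c2 22 (by norm_num) (by norm_num)).trans b22
    refine Reach.ifLt (fun hc' => ?_) (fun hc' => ?_)
    swap
    · simp only [NExp.eval_digit, NExp.eval, c1] at hc'
      exact (Reach.skip ⟨hf3, d20, d21, d22, hskip s3 (Or.inr (by omega))
        (c4.trans a4)⟩).mono (by omega) fun _ h => h
    simp only [NExp.eval_digit, NExp.eval, c1, Nat.lt_one_iff] at hc'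
    refine (block_reach I s3 hp d20 d21 (by rw [d22]; exact hc) (by rw [d22]; exact hc') T τ
      fun s' hs' => hT s' (hf3.trans hs')).mono (by omega) ?_
    rintro s4 ⟨e1, e2, e3, e4, e5⟩
    rw [d22] at e4 e5
    refine ⟨hf3.trans ⟨fun x _ => by rw [e1], e2, e3⟩, by rw [e1, d20], by rw [e1, d21],
      by rw [e1, d22], fun i => ?_⟩
    by_cases hi : clear2 p p' i = J
    · rw [if_pos (by omega)]
      have hi' : i = cell p p' J (dig p i) (dig p' i) := by
        rw [← hi]
        exact (cell_clear2 p p' i hp).symm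
      conv_lhs => rw [hi']
      rw [e4, hnew]
      refine Finset.sum_congr rfl fun x _ => Finset.sum_congr rfl fun y _ => ?_
      rw [hi, c4, a4, gC, clear2_cell hp x.2 y.2 hc hc', if_neg (lt_irrefl _)]
    · rw [e5, c4, a4, gC, if_congr (Q := clear2 p p' i < J + 1) (by omega) rfl rfl]
      rintro u v rfl
      exact hi (clear2_cell hp u.2 v.2 hc hc')
  · rintro s' ⟨hf, -, -, h22, -⟩
    simp [NExp.eval, h22, hf.1, hW]
  · refine ⟨⟨fun x hx => ?_, rfl, fun _ _ => rfl⟩, by simpa using h20, by simpa using h21,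
      by simp, by simp⟩
    simp [show x ≠ 22 by omega]
  · rintro s' ⟨hf, -, -, -, h⟩
    exact ⟨hf, h⟩

end

section

/-! ### Product operators and local maps -/

variable {n : ℕ}

/-- The operator `⨂ A q`. -/
def prodOp (A : Fin n → Op1) : Op n := Matrix.of fun x y => ∏ q, A q (x q) (y q)

theorem sum_prod_pi {κ : Type} [Fintype κ] (f : Fin n → κ → ℂ) :
    ∑ x : Fin n → κ, ∏ q, f q (x q) = ∏ q, ∑ a, f q a := by
  classical
  rw [Finset.prod_univ_sum, Fintype.piFinset_univ]

theorem sum_prod_pi2 (f : Fin n → Fin 2 → Fin 2 → ℂ) :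
    ∑ x : Fin n → Fin 2, ∑ y : Fin n → Fin 2, ∏ q, f q (x q) (y q) = ∏ q, ∑ a, ∑ b, f q a b := by
  rw [← sum_prod_pi fun q a => ∑ b, f q a b]
  exact Finset.sum_congr rfl fun x _ => sum_prod_pi fun q b => f q (x q) b

theorem prodOp_mul (A B : Fin n → Op1) : prodOp A * prodOp B = prodOp fun q => A q * B q := by
  ext x y
  simp only [prodOp, Matrix.mul_apply, Matrix.of_apply, ← Finset.prod_mul_distrib]
  exact sum_prod_pi fun q a => A q (x q) a * B q a (y q)

theorem trace_prodOp (A : Fin n → Op1) : (prodOp A).trace = ∏ q, (A q).trace := by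
  simp only [prodOp, Matrix.trace, Matrix.diag, Matrix.of_apply]
  exact sum_prod_pi fun q a => A q a a

theorem conjTranspose_prodOp (A : Fin n → Op1) :
    (prodOp A).conjTranspose = prodOp fun q => (A q).conjTranspose := by
  ext x y
  simp [prodOp]

theorem single_eq_prodOp (x y : Fin n → Fin 2) :
    (Matrix.single x y 1 : Op n) = prodOp fun q => Matrix.single (x q) (y q) 1 := by
  ext x' y'
  simp only [prodOp, Matrix.of_apply, Matrix.single_apply]
  by_cases h : x = x' ∧ y = y'
  · simp [h.1, h.2]
  · rw [if_neg h]
    have : ∃ q, ¬ (x q = x' q ∧ y q = y' q) := by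
      by_contra hc
      push Not at hc
      exact h ⟨funext fun q => (hc q).1, funext fun q => (hc q).2⟩
    obtain ⟨q, hq⟩ := this
    exact (Finset.prod_eq_zero (Finset.mem_univ q) (by simp [hq])).symm

/-- Linear maps that agree on product operators are equal. -/
theorem linearMap_ext_prodOp {V : Type*} [AddCommGroup V] [Module ℂ V] {f g : Op n →ₗ[ℂ] V}
    (h : ∀ A, f (prodOp A) = g (prodOp A)) (A : Op n) : f A = g A := by
  have key : f = g := by
    refine Matrix.ext_linearMap _ fun x y => ?_
    refine LinearMap.ext_ring ?_
    simp only [LinearMap.comp_apply, Matrix.singleLinearMap_apply]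
    rw [single_eq_prodOp, h]
  rw [key]

/-- The tensor product `⨂ N q` of single-qubit maps. -/
noncomputable def tensorOp (N : Fin n → Op1 →ₗ[ℂ] Op1) : Op n →ₗ[ℂ] Op n where
  toFun A := Matrix.of fun x y => ∑ x' : Fin n → Fin 2, ∑ y' : Fin n → Fin 2,
    (∏ q, N q (Matrix.single (x' q) (y' q) 1) (x q) (y q)) * A x' y'
  map_add' A B := by
    ext x y
    simp [mul_add, Finset.sum_add_distrib]
  map_smul' c A := by
    ext x y
    simp only [Matrix.of_apply, Matrix.smul_apply, smul_eq_mul, RingHom.id_apply, Finset.mul_sum]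
    exact Finset.sum_congr rfl fun _ _ => Finset.sum_congr rfl fun _ _ => by ring

theorem tensorChannel_eq (N : Op1 →ₗ[ℂ] Op1) (A : Op n) :
    tensorChannel N A = tensorOp (fun _ => N) A := rfl

theorem op1_apply_eq (N : Op1 →ₗ[ℂ] Op1) (A : Op1) (x y : Fin 2) :
    N A x y = ∑ a, ∑ b, N (Matrix.single a b 1) x y * A a b := by
  conv_lhs => rw [Matrix.matrix_eq_sum_single A]
  simp only [map_sum, Matrix.sum_apply]
  refine Finset.sum_congr rfl fun a _ => Finset.sum_congr rfl fun b _ => ?_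
  have : Matrix.single a b (A a b) = A a b • Matrix.single a b (1 : ℂ) := by
    rw [Matrix.smul_single, smul_eq_mul, mul_one]
  rw [this, map_smul, Matrix.smul_apply, smul_eq_mul, mul_comm]

theorem tensorOp_prodOp (N : Fin n → Op1 →ₗ[ℂ] Op1) (A : Fin n → Op1) :
    tensorOp N (prodOp A) = prodOp fun q => N q (A q) := by
  ext x y
  simp only [tensorOp, LinearMap.coe_mk, AddHom.coe_mk, prodOp, Matrix.of_apply,
    ← Finset.prod_mul_distrib]
  rw [sum_prod_pi2 fun q a b => N q (Matrix.single a b 1) (x q) (y q) * A q a b]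
  exact Finset.prod_congr rfl fun q _ => (op1_apply_eq (N q) (A q) (x q) (y q)).symm

/-- Conjugation by a matrix, as a linear map. -/
noncomputable def conjMap {κ : Type} [Fintype κ] (U : Matrix κ κ ℂ) :
    Matrix κ κ ℂ →ₗ[ℂ] Matrix κ κ ℂ where
  toFun A := U * A * U.conjTranspose
  map_add' A B := by rw [mul_add, add_mul]
  map_smul' c A := by simp

@[simp] theorem conjMap_apply {κ : Type} [Fintype κ] (U A : Matrix κ κ ℂ) :
    conjMap U A = U * A * U.conjTranspose := rfl

theorem conj_prodOp (U : Fin n → Op1) (A : Op n) :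
    prodOp U * A * (prodOp U).conjTranspose = tensorOp (fun q => conjMap (U q)) A := by
  refine linearMap_ext_prodOp (f := conjMap (prodOp U)) (fun B => ?_) A
  rw [conjMap_apply, conjTranspose_prodOp, prodOp_mul, prodOp_mul, tensorOp_prodOp]
  rfl

/-- The functional `A ↦ Tr (⨂ G (w q) · A)`. -/
noncomputable def coord (G : Fin 4 → Op1) (w : Fin n → Fin 4) : Op n →ₗ[ℂ] ℂ where
  toFun A := (prodOp (fun q => G (w q)) * A).trace
  map_add' A B := by rw [mul_add, Matrix.trace_add]
  map_smul' c A := by simp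

theorem coord_apply (G : Fin 4 → Op1) (w : Fin n → Fin 4) (A : Op n) :
    coord G w A = (prodOp (fun q => G (w q)) * A).trace := rfl

theorem coord_prodOp (G : Fin 4 → Op1) (w : Fin n → Fin 4) (A : Fin n → Op1) :
    coord G w (prodOp A) = ∏ q, (G (w q) * A q).trace := by
  rw [coord_apply, prodOp_mul, trace_prodOp]

/-- The matrix `a` describes the single-qubit map `N` in the dual picture, in the basis `G`. -/
def IsDualMatrix (G : Fin 4 → Op1) (N : Op1 →ₗ[ℂ] Op1) (a : Fin 4 → Fin 4 → ℂ) : Prop :=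
  ∀ u X, (G u * N X).trace = ∑ x, a u x * (G x * X).trace

theorem coord_tensorOp {G : Fin 4 → Op1} {N : Fin n → Op1 →ₗ[ℂ] Op1}
    {a : Fin n → Fin 4 → Fin 4 → ℂ} (h : ∀ q, IsDualMatrix G (N q) (a q)) (w : Fin n → Fin 4)
    (A : Op n) :
    coord G w (tensorOp N A) = ∑ v : Fin n → Fin 4, (∏ q, a q (w q) (v q)) * coord G v A := by
  have := linearMap_ext_prodOp (f := coord G w ∘ₗ tensorOp N)
    (g := ∑ v : Fin n → Fin 4, (∏ q, a q (w q) (v q)) • coord G v) (fun B => ?_) A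
  · simpa [LinearMap.sum_apply] using this
  · simp only [LinearMap.comp_apply, tensorOp_prodOp, LinearMap.sum_apply, LinearMap.smul_apply,
      coord_prodOp, smul_eq_mul, ← Finset.prod_mul_distrib]
    rw [sum_prod_pi fun q x => a q (w q) x * (G x * B q).trace]
    exact Finset.prod_congr rfl fun q _ => h q _ _

/-- One factor of the tensor product is moved to the observable and replaced by the identity map,
which matches a machine that treats the qubits one by one. -/
theorem coord_tensorOp_site {G : Fin 4 → Op1} (N : Fin n → Op1 →ₗ[ℂ] Op1) (q : Fin n)
    {a : Fin 4 → Fin 4 → ℂ} (h : IsDualMatrix G (N q) a) (w : Fin n → Fin 4) (A : Op n) :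
    coord G w (tensorOp N A) = ∑ x, a (w q) x *
      coord G (Function.update w q x) (tensorOp (Function.update N q LinearMap.id) A) := by
  have := linearMap_ext_prodOp (f := coord G w ∘ₗ tensorOp N)
    (g := ∑ x, a (w q) x • (coord G (Function.update w q x) ∘ₗ
      tensorOp (Function.update N q LinearMap.id))) (fun B => ?_) A
  · simpa [LinearMap.sum_apply] using this
  · simp only [LinearMap.comp_apply, tensorOp_prodOp, LinearMap.sum_apply, LinearMap.smul_apply,
      coord_prodOp, smul_eq_mul]
    have hz : ∀ x, ∏ z, (G (Function.update w q x z) *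
        (Function.update N q LinearMap.id z) (B z)).trace =
        (G x * B q).trace * ∏ z ∈ {q}ᶜ, (G (w z) * N z (B z)).trace := by
      intro x
      rw [Fintype.prod_eq_mul_prod_compl q]
      simp only [Function.update_self, LinearMap.id_apply]
      refine congrArg _ (Finset.prod_congr rfl fun z hz => ?_)
      have hz' : z ≠ q := by simpa using hz
      rw [Function.update_of_ne hz', Function.update_of_ne hz']
    simp only [hz, ← mul_assoc, ← Finset.sum_mul]
    rw [Fintype.prod_eq_mul_prod_compl q, h]

theorem coord_tensorOp_of_trivial {G : Fin 4 → Op1} (N : Fin n → Op1 →ₗ[ℂ] Op1)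
    (w : Fin n → Fin 4) (h : ∀ q X, (G (w q) * N q X).trace = (G (w q) * X).trace) (A : Op n) :
    coord G w (tensorOp N A) = coord G w A := by
  refine linearMap_ext_prodOp (f := coord G w ∘ₗ tensorOp N) (fun B => ?_) A
  simp [tensorOp_prodOp, coord_prodOp, h]

/-! ### Two-qubit gates -/

/-- The values of `A` at `q` and `q'` are replaced by `X` and `Y`. -/
def update2 {β : Type} (A : Fin n → β) (q q' : Fin n) (X Y : β) : Fin n → β :=
  Function.update (Function.update A q X) q' Y

theorem update2_left {β : Type} (A : Fin n → β) {q q' : Fin n} (h : q ≠ q') (X Y : β) :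
    update2 A q q' X Y q = X := by
  simp [update2, Function.update_of_ne h]

theorem update2_right {β : Type} (A : Fin n → β) (q q' : Fin n) (X Y : β) :
    update2 A q q' X Y q' = Y := by
  simp [update2]

theorem update2_other {β : Type} (A : Fin n → β) {q q' z : Fin n} (h : z ≠ q) (h' : z ≠ q')
    (X Y : β) : update2 A q q' X Y z = A z := by
  simp [update2, Function.update_of_ne h, Function.update_of_ne h']

theorem prod_split2 {q q' : Fin n} (h : q ≠ q') (f : Fin n → ℂ) :
    ∏ z, f z = f q * f q' * ∏ z ∈ {q, q'}ᶜ, f z := by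
  rw [← Finset.prod_mul_prod_compl {q, q'} f, Finset.prod_pair h]

theorem prod_update2 {β : Type} (f : (q : Fin n) → β → ℂ) (A : Fin n → β) {q q' : Fin n}
    (h : q ≠ q') (X Y : β) :
    ∏ z, f z (update2 A q q' X Y z) = f q X * f q' Y * ∏ z ∈ {q, q'}ᶜ, f z (A z) := by
  rw [prod_split2 h, update2_left A h, update2_right]
  refine congrArg _ (Finset.prod_congr rfl fun z hz => ?_)
  simp only [Finset.mem_compl, Finset.mem_insert, Finset.mem_singleton, not_or] at hz
  rw [update2_other A hz.1 hz.2]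

/-- The two-qubit operator `V` on the qubits `q`, `q'`. -/
def pairMat (V : Matrix (Fin 2 × Fin 2) (Fin 2 × Fin 2) ℂ) (q q' : Fin n) : Op n :=
  Matrix.of fun x y => V (x q, x q') (y q, y q') * ∏ z ∈ {q, q'}ᶜ, if x z = y z then 1 else 0

/-- Expansion in matrix units reduces conjugation by a two-qubit gate to products of product
operators. -/
theorem pairMat_eq_sum (V : Matrix (Fin 2 × Fin 2) (Fin 2 × Fin 2) ℂ) {q q' : Fin n} (h : q ≠ q') :
    pairMat V q q' = ∑ α, ∑ β, V α β • prodOp (update2 (fun _ => 1) q q'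
      (Matrix.single α.1 β.1 1) (Matrix.single α.2 β.2 1)) := by
  ext x y
  simp only [Matrix.sum_apply, Matrix.smul_apply, prodOp, Matrix.of_apply, smul_eq_mul, pairMat]
  simp only [prod_update2 (fun z (X : Op1) => X (x z) (y z)) _ h]
  rw [Finset.sum_eq_single (x q, x q'), Finset.sum_eq_single (y q, y q')]
  · simp [Matrix.one_apply]
  · rintro ⟨b1, b2⟩ - hb
    rw [Ne, Prod.mk.injEq, not_and_or] at hb
    rcases hb with hb | hb <;> simp [hb, Matrix.single_apply]
  · simp
  · rintro ⟨b1, b2⟩ - hb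
    rw [Ne, Prod.mk.injEq, not_and_or] at hb
    refine Finset.sum_eq_zero fun β _ => ?_
    rcases hb with hb | hb <;> simp [hb, Matrix.single_apply]
  · simp

/-- The matrix `T` describes the conjugation by the two-qubit gate `V` in the dual picture. -/
def IsDualMatrix2 (G : Fin 4 → Op1) (V : Matrix (Fin 2 × Fin 2) (Fin 2 × Fin 2) ℂ)
    (T : Fin 4 → Fin 4 → Fin 4 → Fin 4 → ℂ) : Prop :=
  ∀ u v X, ((G u ⊗ₖ G v) * (V * X * V.conjTranspose)).trace =
    ∑ x, ∑ y, T u v x y * ((G x ⊗ₖ G y) * X).trace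

theorem single_mul_mul_single (A : Op1) (a b c d : Fin 2) :
    Matrix.single a b (1 : ℂ) * A * Matrix.single c d 1 = A b c • Matrix.single a d 1 := by
  ext i j
  fin_cases a <;> fin_cases b <;> fin_cases c <;> fin_cases d <;> fin_cases i <;> fin_cases j <;>
    simp [Matrix.mul_apply, Matrix.single_apply]

/-- By linearity a product operator may be inserted. The qubits other than `q, q'` then give the
same factor on both sides, and the two-qubit identity `hT` remains. -/
theorem coord_pairMat {G : Fin 4 → Op1} {V : Matrix (Fin 2 × Fin 2) (Fin 2 × Fin 2) ℂ}
    {q q' : Fin n} (h : q ≠ q') {T : Fin 4 → Fin 4 → Fin 4 → Fin 4 → ℂ}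
    (hT : IsDualMatrix2 G V T) (w : Fin n → Fin 4) (A : Op n) :
    coord G w (pairMat V q q' * A * (pairMat V q q').conjTranspose) =
      ∑ x, ∑ y, T (w q) (w q') x y * coord G (update2 w q q' x y) A := by
  have := linearMap_ext_prodOp (f := coord G w ∘ₗ conjMap (pairMat V q q'))
    (g := ∑ x, ∑ y, T (w q) (w q') x y • coord G (update2 w q q' x y)) (fun B => ?_) A
  · simpa [LinearMap.sum_apply] using this
  have hR : ∀ x y, coord G (update2 w q q' x y) (prodOp B) =
      ((G x ⊗ₖ G y) * (B q ⊗ₖ B q')).trace * ∏ z ∈ {q, q'}ᶜ, (G (w z) * B z).trace := by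
    intro x y
    rw [coord_prodOp, prod_update2 (fun z u => (G u * B z).trace) w h,
      ← Matrix.mul_kronecker_mul, Matrix.trace_kronecker]
  have hL : ∀ α β α' β' : Fin 2 × Fin 2,
      coord G w (prodOp (update2 (fun _ => 1) q q' (Matrix.single α.1 β.1 1)
        (Matrix.single α.2 β.2 1)) * prodOp B * (prodOp (update2 (fun _ => 1) q q'
        (Matrix.single α'.1 β'.1 1) (Matrix.single α'.2 β'.2 1))).conjTranspose) =
      (G (w q) α'.1 α.1 * G (w q') α'.2 α.2 * (B q β.1 β'.1 * B q' β.2 β'.2)) *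
        ∏ z ∈ {q, q'}ᶜ, (G (w z) * B z).trace := by
    intro α β α' β'
    rw [conjTranspose_prodOp, prodOp_mul, prodOp_mul, coord_prodOp, prod_split2 h]
    have e : ∀ z ∈ ({q, q'}ᶜ : Finset (Fin n)), (G (w z) *
        (update2 (fun _ => (1 : Op1)) q q' (Matrix.single α.1 β.1 1) (Matrix.single α.2 β.2 1) z *
        B z * (update2 (fun _ => (1 : Op1)) q q' (Matrix.single α'.1 β'.1 1)
        (Matrix.single α'.2 β'.2 1) z).conjTranspose)).trace = (G (w z) * B z).trace := by
      intro z hz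
      simp only [Finset.mem_compl, Finset.mem_insert, Finset.mem_singleton, not_or] at hz
      simp [update2_other _ hz.1 hz.2]
    rw [Finset.prod_congr rfl e]
    simp only [update2_left _ h, update2_right, Matrix.conjTranspose_single, star_one,
      single_mul_mul_single, Matrix.mul_smul, Matrix.trace_smul, Matrix.trace_mul_single,
      smul_eq_mul]
    simp
    left
    ring
  simp only [LinearMap.comp_apply, conjMap_apply, LinearMap.sum_apply, LinearMap.smul_apply,
    smul_eq_mul, hR, ← mul_assoc, ← Finset.sum_mul]
  rw [← hT, pairMat_eq_sum V h]
  simp only [Matrix.conjTranspose_sum, Matrix.conjTranspose_smul, Finset.sum_mul, Finset.mul_sum,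
    Matrix.smul_mul, Matrix.mul_smul, map_sum, map_smul, hL, smul_eq_mul]
  simp only [← mul_assoc, ← Finset.sum_mul]
  congr 1
  simp only [Matrix.trace, Matrix.diag, Matrix.mul_apply, Matrix.kroneckerMap_apply,
    Matrix.conjTranspose_apply, Finset.sum_mul]
  refine Finset.sum_congr rfl fun α' _ => Finset.sum_congr rfl fun β' _ => ?_
  rw [Finset.sum_comm]
  exact Finset.sum_congr rfl fun β _ => Finset.sum_congr rfl fun α _ => by ring

/-- The tensor product of the two-qubit operators `V q` on the pairs `q < π q` of an involution `π`
and of the identity on its fixed points. -/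
def pairLayer (π : Fin n → Fin n) (V : Fin n → Matrix (Fin 2 × Fin 2) (Fin 2 × Fin 2) ℂ) : Op n :=
  Matrix.of fun x y => ∏ q, if q < π q then V q (x q, x (π q)) (y q, y (π q))
    else if π q = q then (if x q = y q then 1 else 0) else 1

/-- Splits a single gate off a layer. Repeated use turns a layer into a sequence of gates, both in
the program and when expectations are taken. -/
theorem pairLayer_update {π : Fin n → Fin n} (hπ : ∀ q, π (π q) = q)
    (V : Fin n → Matrix (Fin 2 × Fin 2) (Fin 2 × Fin 2) ℂ) {q : Fin n} (hq : q < π q)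
    (W : Matrix (Fin 2 × Fin 2) (Fin 2 × Fin 2) ℂ) :
    pairLayer π (Function.update V q W) =
      pairMat W q (π q) * pairLayer π (Function.update V q 1) := by
  ext x y
  have hne : q ≠ π q := hq.ne
  -- Only one intermediate configuration contributes: off the pair it must agree with `x`, since
  -- `pairMat` is the identity there; on the pair it must agree with `y`, since the remaining layer
  -- has the gate `1` there.
  rw [Matrix.mul_apply, Finset.sum_eq_single (update2 x q (π q) (y q) (y (π q)))]
  · simp only [pairMat, pairLayer, Matrix.of_apply]
    have hp : ∏ z ∈ {q, π q}ᶜ, (if x z = update2 x q (π q) (y q) (y (π q)) z then (1 : ℂ) else 0)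
        = 1 := by
      refine Finset.prod_eq_one fun z hz => ?_
      simp only [Finset.mem_compl, Finset.mem_insert, Finset.mem_singleton, not_or] at hz
      rw [update2_other _ hz.1 hz.2, if_pos rfl]
    rw [hp, mul_one, update2_left _ hne, update2_right,
      Fintype.prod_eq_mul_prod_compl q,
      Fintype.prod_eq_mul_prod_compl q (fun z => if z < π z then
        (Function.update V q 1 z) (update2 x q (π q) (y q) (y (π q)) z,
          update2 x q (π q) (y q) (y (π q)) (π z)) (y z, y (π z)) else _)]
    simp only [hq, if_true, Function.update_self, update2_left _ hne, update2_right,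
      Matrix.one_apply_eq, one_mul]
    refine congrArg _ (Finset.prod_congr rfl fun z hz => ?_)
    have hz' : z ≠ q := by simpa using hz
    rw [Function.update_of_ne hz', Function.update_of_ne hz']
    by_cases hzq : z = π q
    · subst hzq
      have h1 : ¬ π q < π (π q) := by rw [hπ]; exact hq.le.not_gt
      have h2 : π (π q) ≠ π q := by rw [hπ]; exact hne
      simp [h1, h2]
    · have h1 : π z ≠ q := fun h => hzq (by rw [← h, hπ])
      have h2 : π z ≠ π q := fun h => hz' (by rw [← hπ z, h, hπ])
      rw [update2_other _ hz' hzq, update2_other _ h1 h2]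
  · intro z _ hz
    by_cases hoff : ∀ v, v ≠ q → v ≠ π q → x v = z v
    · have : ¬ (z q = y q ∧ z (π q) = y (π q)) := by
        rintro ⟨h1, h2⟩
        refine hz (funext fun v => ?_)
        by_cases hv : v = q
        · rw [hv, update2_left _ hne, h1]
        by_cases hv' : v = π q
        · rw [hv', update2_right, h2]
        · rw [update2_other _ hv hv', hoff v hv hv']
      refine mul_eq_zero_of_right _ (Finset.prod_eq_zero (Finset.mem_univ q) ?_)
      rw [if_pos hq, Function.update_self, Matrix.one_apply_ne]
      rwa [Ne, Prod.mk.injEq]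
    · push Not at hoff
      obtain ⟨v, h1, h2, h3⟩ := hoff
      refine mul_eq_zero_of_left (mul_eq_zero_of_right _
        (Finset.prod_eq_zero (i := v) (by simp [h1, h2]) (if_neg h3))) _
  · simp

theorem pairLayer_one {π : Fin n → Fin n} (hπ : ∀ q, π (π q) = q) :
    pairLayer π (fun _ => 1) = 1 := by
  ext x y
  simp only [pairLayer, Matrix.of_apply, Matrix.one_apply (α := ℂ) (i := x)]
  by_cases h : x = y
  · subst h
    rw [if_pos rfl]
    exact Finset.prod_eq_one fun q _ => by split_ifs <;> simp_all
  · obtain ⟨q, hq⟩ := Function.ne_iff.mp h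
    rw [if_neg h]
    rcases lt_trichotomy q (π q) with h1 | h1 | h1
    · exact Finset.prod_eq_zero (Finset.mem_univ q) (by simp [h1, hq])
    · exact Finset.prod_eq_zero (Finset.mem_univ q) (by simp [← h1, hq])
    -- The factor of a pair is attached to its smaller qubit, which is `π q` here.
    · exact Finset.prod_eq_zero (Finset.mem_univ (π q)) (by simp [hπ, h1, hq])

end

section

/-! ### The site basis of the machine, and tables of coefficients -/

/-- The basis `1, E₀₁, E₁₀, E₁₁`. -/
def basisInt : Fin 4 → Fin 2 → Fin 2 → ℤ :=
  ![!![1, 0; 0, 1], !![0, 1; 0, 0], !![0, 0; 1, 0], !![0, 0; 0, 1]]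

/-- The dual basis. -/
def dualInt : Fin 4 → Fin 2 → Fin 2 → ℤ :=
  ![!![1, 0; 0, 0], !![0, 1; 0, 0], !![0, 0; 1, 0], !![-1, 0; 0, 1]]

/-- The basis `1, E₀₁, E₁₀, E₁₁`, as operators. -/
def siteBasis (u : Fin 4) : Op1 := Matrix.of fun a b => (basisInt u a b : ℂ)

theorem siteBasis_zero : siteBasis 0 = 1 := by
  ext a b
  fin_cases a <;> fin_cases b <;> simp [siteBasis, basisInt]

/-- The reason for taking `E₁₁` rather than `Z`: only the identity has a nonzero expectation in the
state `|0⟩⟨0|`, so the final answer is a single coefficient. -/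
theorem siteBasis_apply_zero (u : Fin 4) : siteBasis u 0 0 = if u = 0 then 1 else 0 := by
  fin_cases u <;> simp [siteBasis, basisInt]

/-- The tables have integer entries so that duality is a finite check, which is then cast to `ℂ`. -/
theorem sum_dualInt_mul (a b c d : Fin 2) :
    ∑ x, (dualInt x a b : ℂ) * (basisInt x c d : ℂ) = if a = c ∧ b = d then 1 else 0 := by
  have h : ∑ x, dualInt x a b * basisInt x c d = if a = c ∧ b = d then 1 else 0 := by
    revert a b c d
    decide
  exact_mod_cast congrArg (Int.cast : ℤ → ℂ) h

theorem sum_dualInt_trace (X : Op1) (a b : Fin 2) :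
    ∑ x, (dualInt x b a : ℂ) * (siteBasis x * X).trace = X a b := by
  have h : ∀ x, (dualInt x b a : ℂ) * (siteBasis x * X).trace =
      ∑ p, ∑ q, (dualInt x b a : ℂ) * (basisInt x p q : ℂ) * X q p := by
    intro x
    simp only [Matrix.trace, Matrix.diag, Matrix.mul_apply, Finset.mul_sum, siteBasis,
      Matrix.of_apply, mul_assoc]
  simp only [h]
  rw [Finset.sum_comm, Finset.sum_eq_single b, Finset.sum_comm, Finset.sum_eq_single a]
  · rw [← Finset.sum_mul, sum_dualInt_mul]; simp
  · intro c _ hc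
    rw [← Finset.sum_mul, sum_dualInt_mul]; simp [hc.symm]
  · simp
  · intro c _ hc
    rw [Finset.sum_comm]
    refine Finset.sum_eq_zero fun d _ => ?_
    rw [← Finset.sum_mul, sum_dualInt_mul]; simp [hc.symm]
  · simp

theorem sum_reverse4 {α β γ δ : Type} [Fintype α] [Fintype β] [Fintype γ] [Fintype δ]
    (f : α → β → γ → δ → ℂ) :
    ∑ a, ∑ b, ∑ c, ∑ d, f a b c d = ∑ d, ∑ c, ∑ b, ∑ a, f a b c d := by
  have h1 : ∑ a, ∑ b, ∑ c, ∑ d, f a b c d =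
      ∑ p : α × β × γ × δ, f p.1 p.2.1 p.2.2.1 p.2.2.2 := by simp only [Fintype.sum_prod_type]
  have h2 : ∑ d, ∑ c, ∑ b, ∑ a, f a b c d =
      ∑ p : δ × γ × β × α, f p.2.2.2 p.2.2.1 p.2.1 p.1 := by simp only [Fintype.sum_prod_type]
  rw [h1, h2]
  exact Fintype.sum_equiv ⟨fun p => (p.2.2.2, p.2.2.1, p.2.1, p.1),
    fun p => (p.2.2.2, p.2.2.1, p.2.1, p.1), fun _ => rfl, fun _ => rfl⟩ _ _ fun _ => rfl

/-- The dual matrix of a superoperator with entries `e`, in a basis `B` with dual basis `D`. -/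
theorem trace_mul_eq_sum_dual {κ ι : Type} [Fintype κ] [Fintype ι] (B : ι → Matrix κ κ ℂ)
    (D : ι → κ → κ → ℂ) (hD : ∀ (X : Matrix κ κ ℂ) a b, ∑ x, D x b a * (B x * X).trace = X a b)
    (e : κ → κ → κ → κ → ℂ) (X Y : Matrix κ κ ℂ) (hY : ∀ c d, Y c d = ∑ a, ∑ b, e c d a b * X a b)
    (M : κ → κ → ℂ) :
    (Matrix.of M * Y).trace =
      ∑ x, (∑ a, ∑ b, D x b a * ∑ c, ∑ d, M d c * e c d a b) * (B x * X).trace := by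
  have h1 : ∑ x, (∑ a, ∑ b, D x b a * ∑ c, ∑ d, M d c * e c d a b) * (B x * X).trace =
      ∑ a, ∑ b, (∑ c, ∑ d, M d c * e c d a b) * X a b := by
    simp only [Finset.sum_mul]
    rw [Finset.sum_comm]
    refine Finset.sum_congr rfl fun a _ => ?_
    rw [Finset.sum_comm]
    refine Finset.sum_congr rfl fun b _ => ?_
    rw [← hD X a b]
    simp only [← Finset.sum_mul]
    rw [Finset.mul_sum]
    exact Finset.sum_congr rfl fun x _ => by ring
  rw [h1]
  simp only [Matrix.trace, Matrix.diag, Matrix.mul_apply, hY, Matrix.of_apply, Finset.mul_sum,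
    Finset.sum_mul]
  rw [sum_reverse4]
  rw [Finset.sum_comm]
  refine Finset.sum_congr rfl fun a _ => Finset.sum_congr rfl fun b _ =>
    Finset.sum_congr rfl fun c _ => Finset.sum_congr rfl fun d _ => by ring

/-- The dual matrix in the site basis of the map with entries `e c d a b` of `N |a⟩⟨b|`. -/
noncomputable def siteDual (e : Fin 2 → Fin 2 → Fin 2 → Fin 2 → ℂ) (u x : Fin 4) : ℂ :=
  ∑ a, ∑ b, (dualInt x b a : ℂ) * ∑ c, ∑ d, (basisInt u d c : ℂ) * e c d a b

theorem isDualMatrix_siteDual (N : Op1 →ₗ[ℂ] Op1) :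
    IsDualMatrix siteBasis N (siteDual fun c d a b => N (Matrix.single a b 1) c d) := by
  intro u X
  exact trace_mul_eq_sum_dual siteBasis (fun x a b => (dualInt x a b : ℂ)) sum_dualInt_trace _ X _
    (fun c d => op1_apply_eq N X c d) fun d c => (basisInt u d c : ℂ)

/-- The dual matrix in the site basis of the conjugation by the two-qubit gate with entries
`V (a, b) (c, d) = e a b c d`. -/
noncomputable def pairDual (e : Fin 2 → Fin 2 → Fin 2 → Fin 2 → ℂ) (u v x y : Fin 4) : ℂ :=
  ∑ a, ∑ a', ∑ b, ∑ b', (dualInt x b a : ℂ) * (dualInt y b' a' : ℂ) *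
    ∑ c, ∑ c', ∑ d, ∑ d', (basisInt u d c : ℂ) * (basisInt v d' c' : ℂ) *
      (e c c' a a' * star (e d d' b b'))

/-- Contracting one tensor factor at a time reduces this to two uses of `sum_dualInt_trace`. -/
theorem sum_dualInt_trace2 (X : Matrix (Fin 2 × Fin 2) (Fin 2 × Fin 2) ℂ) (α β : Fin 2 × Fin 2) :
    ∑ x : Fin 4 × Fin 4, ((dualInt x.1 β.1 α.1 : ℂ) * (dualInt x.2 β.2 α.2 : ℂ)) *
      ((siteBasis x.1 ⊗ₖ siteBasis x.2) * X).trace = X α β := by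
  have h : ∀ x y, ((siteBasis x ⊗ₖ siteBasis y) * X).trace =
      (siteBasis y * Matrix.of fun q p =>
        (siteBasis x * Matrix.of fun q' p' => X (q', q) (p', p)).trace).trace := by
    intro x y
    simp only [Matrix.trace, Matrix.diag, Matrix.mul_apply, Matrix.kroneckerMap_apply,
      Matrix.of_apply, Fintype.sum_prod_type, Fin.sum_univ_two]
    ring
  have h2 : ∀ x, ∑ y, ((dualInt x β.1 α.1 : ℂ) * (dualInt y β.2 α.2 : ℂ)) *
      ((siteBasis x ⊗ₖ siteBasis y) * X).trace = (dualInt x β.1 α.1 : ℂ) *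
      (siteBasis x * Matrix.of fun q' p' => X (q', α.2) (p', β.2)).trace := by
    intro x
    simp only [h, mul_assoc]
    rw [← Finset.mul_sum, sum_dualInt_trace]
    rfl
  rw [Fintype.sum_prod_type]
  simp only [h2]
  rw [sum_dualInt_trace]
  rfl

theorem conj_apply_eq {κ : Type} [Fintype κ] (V X : Matrix κ κ ℂ) (c d : κ) :
    (V * X * V.conjTranspose) c d = ∑ a, ∑ b, (V c a * star (V d b)) * X a b := by
  simp only [Matrix.mul_apply, Matrix.conjTranspose_apply, Finset.sum_mul]
  rw [Finset.sum_comm]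
  exact Finset.sum_congr rfl fun a _ => Finset.sum_congr rfl fun b _ => by ring

theorem isDualMatrix2_pairDual (V : Matrix (Fin 2 × Fin 2) (Fin 2 × Fin 2) ℂ) :
    IsDualMatrix2 siteBasis V (pairDual fun a b c d => V (a, b) (c, d)) := by
  intro u v X
  have := trace_mul_eq_sum_dual (fun x : Fin 4 × Fin 4 => siteBasis x.1 ⊗ₖ siteBasis x.2)
    (fun x β α => (dualInt x.1 β.1 α.1 : ℂ) * (dualInt x.2 β.2 α.2 : ℂ)) sum_dualInt_trace2
    (fun c d a b => V c a * star (V d b)) X _ (conj_apply_eq V X)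
    fun d c => (basisInt u d.1 c.1 : ℂ) * (basisInt v d.2 c.2 : ℂ)
  refine Eq.trans ?_ (this.trans ?_)
  · rfl
  · simp only [Fintype.sum_prod_type, pairDual]

end

section

variable {n : ℕ}

/-! ### Observables given by coefficients in the site basis -/

/-- The functional `A ↦ ∑ w, c w · Tr (⨂ B (w q) · A)`. -/
noncomputable def phi (c : (Fin n → Fin 4) → ℂ) (A : Op n) : ℂ := ∑ w, c w * coord siteBasis w A

/-- Exchanging the letter at `q` with the summation variable is an involution of the index set. This
is what passes a map from coordinates to coefficients, where its matrix acts transposed. -/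
theorem sum_update {M : Type} [AddCommMonoid M] (q : Fin n) (F : (Fin n → Fin 4) → Fin 4 → M) :
    ∑ w, ∑ x, F w x = ∑ w, ∑ u, F (Function.update w q u) (w q) := by
  have h1 : ∑ w, ∑ x, F w x = ∑ p : (Fin n → Fin 4) × Fin 4, F p.1 p.2 := by
    rw [Fintype.sum_prod_type]
  have h2 : ∑ w, ∑ u, F (Function.update w q u) (w q) =
      ∑ p : (Fin n → Fin 4) × Fin 4, F (Function.update p.1 q p.2) (p.1 q) := by
    rw [Fintype.sum_prod_type]
  rw [h1, h2]
  exact Fintype.sum_equiv ⟨fun p => (Function.update p.1 q p.2, p.1 q),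
    fun p => (Function.update p.1 q p.2, p.1 q), fun p => by simp, fun p => by simp⟩ _ _
    fun p => by simp

theorem sum_update2 {M : Type} [AddCommMonoid M] {q q' : Fin n} (h : q ≠ q')
    (F : (Fin n → Fin 4) → Fin 4 → Fin 4 → M) :
    ∑ w, ∑ x, ∑ y, F w x y = ∑ w, ∑ u, ∑ v, F (update2 w q q' u v) (w q) (w q') := by
  rw [sum_update q fun w x => ∑ y, F w x y]
  have e : ∀ w : Fin n → Fin 4, ∑ u, ∑ y, F (Function.update w q u) (w q) y =
      ∑ y, ∑ u, F (Function.update w q u) (w q) y := fun w => Finset.sum_comm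
  simp only [e]
  rw [sum_update q' fun w y => ∑ u, F (Function.update w q u) (w q) y]
  refine Finset.sum_congr rfl fun w _ => ?_
  rw [Finset.sum_comm]
  refine Finset.sum_congr rfl fun u _ => Finset.sum_congr rfl fun v _ => ?_
  rw [Function.update_of_ne h, update2, Function.update_comm h]

theorem phi_pairMat {V : Matrix (Fin 2 × Fin 2) (Fin 2 × Fin 2) ℂ}
    {q q' : Fin n} (h : q ≠ q') {T : Fin 4 → Fin 4 → Fin 4 → Fin 4 → ℂ}
    (hT : IsDualMatrix2 siteBasis V T) {c c' : (Fin n → Fin 4) → ℂ}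
    (hc : ∀ w, c' w = ∑ u, ∑ v, c (update2 w q q' u v) * T u v (w q) (w q')) (A : Op n) :
    phi c (pairMat V q q' * A * (pairMat V q q').conjTranspose) = phi c' A := by
  simp only [phi, coord_pairMat h hT, hc, Finset.mul_sum, Finset.sum_mul, ← mul_assoc]
  rw [sum_update2 h]
  refine Finset.sum_congr rfl fun w _ => Finset.sum_congr rfl fun u _ =>
    Finset.sum_congr rfl fun v _ => ?_
  have e : update2 (update2 w q q' u v) q q' (w q) (w q') = w := by
    funext z
    by_cases hz : z = q
    · rw [hz, update2_left _ h]
    by_cases hz' : z = q'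
    · rw [hz', update2_right]
    · rw [update2_other _ hz hz', update2_other _ hz hz']
  rw [update2_left _ h, update2_right, e]

theorem phi_tensorOp_site {N : Fin n → Op1 →ₗ[ℂ] Op1} {q : Fin n} {a : Fin 4 → Fin 4 → ℂ}
    (h : IsDualMatrix siteBasis (N q) a) {c c' : (Fin n → Fin 4) → ℂ}
    (hc : ∀ w, c' w = ∑ u, c (Function.update w q u) * a u (w q)) (A : Op n) :
    phi c (tensorOp N A) = phi c' (tensorOp (Function.update N q LinearMap.id) A) := by
  simp only [phi, coord_tensorOp_site N q h, hc, Finset.mul_sum, Finset.sum_mul, ← mul_assoc]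
  rw [sum_update q]
  refine Finset.sum_congr rfl fun w _ => Finset.sum_congr rfl fun u _ => ?_
  rw [Function.update_self]
  simp

/-- The light cone principle for noise: at a qubit where all terms of the observable carry the
identity, a trace-preserving map is invisible. -/
theorem phi_tensorOp_of_trivial {N : Fin n → Op1 →ₗ[ℂ] Op1} {c : (Fin n → Fin 4) → ℂ}
    (h : ∀ w, c w ≠ 0 → ∀ q, N q = LinearMap.id ∨ (w q = 0 ∧ ∀ X, (N q X).trace = X.trace))
    (A : Op n) : phi c (tensorOp N A) = phi c A := by
  refine Finset.sum_congr rfl fun w _ => ?_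
  by_cases hw : c w = 0
  · simp [hw]
  rw [coord_tensorOp_of_trivial]
  intro q X
  rcases h w hw q with hq | ⟨hq, hN⟩
  · simp [hq]
  · simp [hq, siteBasis_zero, hN]

/-- The light cone principle for gates, by unitarity and cyclicity of the trace. -/
theorem coord_pairMat_of_trivial {V : Matrix (Fin 2 × Fin 2) (Fin 2 × Fin 2) ℂ}
    (hV : V.conjTranspose * V = 1) {q q' : Fin n} (h : q ≠ q') (w : Fin n → Fin 4)
    (hq : w q = 0) (hq' : w q' = 0) (A : Op n) :
    coord siteBasis w (pairMat V q q' * A * (pairMat V q q').conjTranspose) =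
      coord siteBasis w A := by
  -- The dual matrix may be changed in the row `(0, 0)`: there the conjugation fixes the identity,
  -- so the row can be taken to be the unit vector without evaluating `pairDual`.
  have hT : IsDualMatrix2 siteBasis V fun u v x y => if u = 0 ∧ v = 0 then
      (if x = 0 ∧ y = 0 then 1 else 0) else pairDual (fun a b c d => V (a, b) (c, d)) u v x y := by
    intro u v X
    by_cases huv : u = 0 ∧ v = 0
    · obtain ⟨rfl, rfl⟩ := huv
      rw [Finset.sum_eq_single 0, Finset.sum_eq_single 0]
      · simp only [and_self, if_true, siteBasis_zero, Matrix.one_kronecker_one, one_mul]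
        rw [mul_assoc, Matrix.trace_mul_comm, mul_assoc, hV, mul_one]
      · intro y _ hy
        simp [hy]
      · simp
      · intro x _ hx
        simp [hx]
      · simp
    · simp only [huv, if_false]
      exact isDualMatrix2_pairDual V u v X
  rw [coord_pairMat h hT]
  simp only [hq, hq', and_self, if_true]
  rw [Finset.sum_eq_single 0, Finset.sum_eq_single 0]
  · have : update2 w q q' 0 0 = w := by
      rw [update2, ← hq, Function.update_eq_self, hq, ← hq', Function.update_eq_self]
    simp [this]
  · intro y _ hy; simp [hy]
  · simp
  · intro x _ hx; simp [hx]
  · simp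

theorem phi_pairMat_of_trivial {V : Matrix (Fin 2 × Fin 2) (Fin 2 × Fin 2) ℂ}
    (hV : V.conjTranspose * V = 1) {q q' : Fin n} (h : q ≠ q') {c : (Fin n → Fin 4) → ℂ}
    (hc : ∀ w, c w ≠ 0 → w q = 0 ∧ w q' = 0) (A : Op n) :
    phi c (pairMat V q q' * A * (pairMat V q q').conjTranspose) = phi c A := by
  refine Finset.sum_congr rfl fun w _ => ?_
  by_cases hw : c w = 0
  · simp [hw]
  rw [coord_pairMat_of_trivial hV h w (hc w hw).1 (hc w hw).2]

theorem phi_zeroState (c : (Fin n → Fin 4) → ℂ) : phi c (zeroState n) = c 0 := by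
  have h : ∀ w : Fin n → Fin 4, coord siteBasis w (zeroState n) = if w = 0 then 1 else 0 := by
    intro w
    rw [coord_apply, zeroState, Matrix.trace_mul_single]
    simp only [prodOp, Matrix.of_apply, Pi.zero_apply, siteBasis_apply_zero]
    by_cases hw : w = 0
    · simp [hw]
    · obtain ⟨q, hq⟩ := Function.ne_iff.mp hw
      simp only [hw, if_false, MulOpposite.op_one, one_smul]
      exact Finset.prod_eq_zero (Finset.mem_univ q) (by simpa using hq)
  simp [phi, h]

/-- The coefficients of the Paulis in the site basis. -/
noncomputable def pauliCoef : Fin 4 → Fin 4 → ℂ :=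
  ![![1, 0, 0, 0], ![0, 1, 1, 0], ![0, -Complex.I, Complex.I, 0], ![1, 0, 0, -2]]

theorem pauli_eq_sum (u : Fin 4) (a b : Fin 2) :
    pauli u a b = ∑ x, pauliCoef u x * siteBasis x a b := by
  fin_cases u <;> fin_cases a <;> fin_cases b <;>
    simp [pauli, pauliCoef, siteBasis, basisInt, Fin.sum_univ_four]; norm_num

theorem trace_pauliOp_mul (P : Fin n → Fin 4) (A : Op n) :
    (pauliOp P * A).trace = phi (fun w => ∏ q, pauliCoef (P q) (w q)) A := by
  have h : pauliOp P = ∑ w : Fin n → Fin 4, (∏ q, pauliCoef (P q) (w q)) •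
      prodOp fun q => siteBasis (w q) := by
    ext x y
    simp only [pauliOp, Matrix.of_apply, Matrix.sum_apply, Matrix.smul_apply, smul_eq_mul, prodOp,
      ← Finset.prod_mul_distrib, pauli_eq_sum]
    exact (sum_prod_pi fun q u => pauliCoef (P q) u * siteBasis u (x q) (y q)).symm
  rw [h]
  simp only [phi, coord_apply, Finset.sum_mul, Matrix.trace_sum, Matrix.smul_mul,
    Matrix.trace_smul, smul_eq_mul]

/-! ### Coefficients stored in an array -/

/-- The address of the coefficient `w`. -/
def idx (ql : List (Fin n)) (w : Fin n → Fin 4) : ℕ :=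
  Nat.ofDigits 4 (ql.map fun q => (w q : ℕ))

/-- The coefficients stored in the array `C`, for the qubits of the list `ql`. -/
noncomputable def coef (C : ℕ → ℂ) (ql : List (Fin n)) (w : Fin n → Fin 4) : ℂ :=
  open Classical in if ∀ q, q ∉ ql → w q = 0 then C (idx ql w) else 0

theorem idx_lt (ql : List (Fin n)) (w : Fin n → Fin 4) : idx ql w < 4 ^ ql.length := by
  have := Nat.ofDigits_lt_base_pow_length (b := 4) (l := ql.map fun q => (w q : ℕ)) (by norm_num)
    (fun x hx => by
      obtain ⟨q, -, rfl⟩ := List.mem_map.mp hx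
      exact (w q).2)
  simpa [idx] using this

theorem idx_cons (q : Fin n) (ql : List (Fin n)) (w : Fin n → Fin 4) :
    idx (q :: ql) w = w q + 4 * idx ql w := by
  simp [idx, Nat.ofDigits_cons]

theorem idx_append (q : Fin n) (ql : List (Fin n)) (w : Fin n → Fin 4) :
    idx (ql ++ [q]) w = idx ql w + w q * 4 ^ ql.length := by
  simp [idx, Nat.ofDigits_append, mul_comm]

theorem idx_congr {ql : List (Fin n)} {w w' : Fin n → Fin 4} (h : ∀ q ∈ ql, w q = w' q) :
    idx ql w = idx ql w' := by
  rw [idx, idx, List.map_congr_left fun q hq => by rw [h q hq]]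

theorem idx_digit {ql : List (Fin n)} (p : ℕ) (hp : p < ql.length) (w : Fin n → Fin 4) :
    idx ql w / 4 ^ p % 4 = w ql[p] := by
  induction ql generalizing p with
  | nil => simp at hp
  | cons q ql ih =>
    have hq := (w q).2
    rw [idx_cons]
    cases p with
    | zero =>
      simp
    | succ p =>
      have : (↑(w q) + 4 * idx ql w) / 4 ^ (p + 1) = idx ql w / 4 ^ p := by
        rw [pow_succ', ← Nat.div_div_eq_div_mul]
        congr 1
        omega
      rw [this, ih p (by simpa using hp)]
      simp

/-- Changing the letter at position `p` changes the address by a multiple of `4 ^ p`; the old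
contribution stands on the left to avoid subtraction. -/
theorem idx_update {ql : List (Fin n)} (hql : ql.Nodup) (p : ℕ) (hp : p < ql.length)
    (w : Fin n → Fin 4) (x : Fin 4) :
    idx ql (Function.update w ql[p] x) + w ql[p] * 4 ^ p = idx ql w + x * 4 ^ p := by
  induction ql generalizing p with
  | nil => simp at hp
  | cons q ql ih =>
    rw [List.nodup_cons] at hql
    rw [idx_cons, idx_cons]
    cases p with
    | zero =>
      have : idx ql (Function.update w q x) = idx ql w := by
        refine idx_congr fun q' hq' => Function.update_of_ne ?_ _ _
        rintro rfl
        exact hql.1 hq'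
      simp [this]
      ring
    | succ p =>
      have hp' : p < ql.length := by simpa using hp
      have hne : q ≠ ql[p] := by
        rintro h
        exact hql.1 (h ▸ List.getElem_mem hp')
      have := ih hql.2 p hp'
      simp only [List.getElem_cons_succ, Function.update_of_ne hne, pow_succ]
      linear_combination 4 * this

theorem add_digit_lt {p k j x : ℕ} (hp : p < k) (hx : x < 4) (hj : j / 4 ^ p % 4 = 0)
    (hjk : j < 4 ^ k) : j + x * 4 ^ p < 4 ^ k := by
  obtain ⟨d, rfl⟩ := Nat.exists_eq_add_of_lt hp
  have e : 4 ^ (p + d + 1) = 4 ^ p * (4 * 4 ^ d) := by ring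
  rw [e] at hjk ⊢
  have h1 : j / 4 ^ p < 4 * 4 ^ d := Nat.div_lt_of_lt_mul hjk
  refine Nat.lt_of_div_lt_div (c := 4 ^ p) ?_
  rw [Nat.add_mul_div_right _ _ (by positivity), Nat.mul_div_cancel_left _ (by positivity)]
  omega

/-- The array after the application of a linear map to the digits `p` and `p'`. -/
def IsUpdate (T : Fin 4 → Fin 4 → Fin 4 → Fin 4 → ℂ) (p p' k : ℕ) (C C' : ℕ → ℂ) : Prop :=
  ∀ i, C' i = if clear2 p p' i < 4 ^ k then ∑ x : Fin 4, ∑ y : Fin 4,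
    C (cell p p' (clear2 p p' i) x y) * T x y (dig p i) (dig p' i) else C i

theorem clear2_le (p p' i : ℕ) : clear2 p p' i ≤ i := by
  unfold clear2
  omega

section pair

variable {T : Fin 4 → Fin 4 → Fin 4 → Fin 4 → ℂ} {ql : List (Fin n)} {C C' : ℕ → ℂ} {p p' : ℕ}

/-- Filling digits below position `ql.length` keeps an index below `4 ^ ql.length`. So an index out
of range has a base point out of range and is left untouched. -/
theorem IsUpdate.vanish (h : IsUpdate T p p' ql.length C C') (hpp : p ≠ p')
    (hp : p < ql.length) (hp' : p' < ql.length) (hC : ∀ i, 4 ^ ql.length ≤ i → C i = 0) (i : ℕ)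
    (hi : 4 ^ ql.length ≤ i) : C' i = 0 := by
  rw [h i, if_neg, hC i hi]
  intro hlt
  have h1 := clear2_add p p' i hpp
  have h2 := add_digit_lt hp (x := i / 4 ^ p % 4) (by omega) (clear2_digit_left p p' i hpp) hlt
  have h3 := add_digit_lt hp' (x := i / 4 ^ p' % 4) (by omega) (by
    rw [digit_add_other p p' _ _ (by omega) (clear2_digit_left p p' i hpp) hpp,
      clear2_digit_right p p' i hpp]) h2
  omega

theorem IsUpdate.coef (h : IsUpdate T p p' ql.length C C') (hql : ql.Nodup) (hpp : p ≠ p')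
    (hp : p < ql.length) (hp' : p' < ql.length) (w : Fin n → Fin 4) :
    coef C' ql w =
      ∑ u, ∑ v, coef C ql (update2 w ql[p] ql[p'] u v) * T u v (w ql[p]) (w ql[p']) := by
  have hne : ql[p] ≠ ql[p'] := fun e => hpp ((hql.getElem_inj_iff).mp e)
  have hs : ∀ u v, (∀ q, q ∉ ql → update2 w ql[p] ql[p'] u v q = 0) ↔ ∀ q, q ∉ ql → w q = 0 := by
    intro u v
    refine forall_congr' fun q => imp_congr_right fun hq => ?_
    rw [update2_other]
    · rintro rfl; exact hq (List.getElem_mem _)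
    · rintro rfl; exact hq (List.getElem_mem _)
  by_cases hw : ∀ q, q ∉ ql → w q = 0
  · have hcoef : ∀ u v, NoisyCircuit.coef C ql (update2 w ql[p] ql[p'] u v) =
        C (idx ql (update2 w ql[p] ql[p'] u v)) := fun u v => if_pos ((hs u v).mpr hw)
    simp only [hcoef]
    rw [NoisyCircuit.coef, if_pos hw, h, if_pos ((clear2_le _ _ _).trans_lt (idx_lt ql w))]
    have hd : ∀ p, (hp : p < ql.length) → dig p (idx ql w) = w ql[p] := by
      intro p hp
      ext
      exact idx_digit p hp w
    rw [hd p hp, hd p' hp']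
    refine Finset.sum_congr rfl fun u _ => Finset.sum_congr rfl fun v _ => ?_
    congr 2
    have h1 := idx_update hql p hp w u
    have h2 := idx_update hql p' hp' (Function.update w ql[p] u) v
    rw [Function.update_of_ne hne.symm] at h2
    have h3 := clear2_add p p' (idx ql w) hpp
    rw [idx_digit p hp, idx_digit p' hp'] at h3
    unfold cell update2
    omega
  · simp only [NoisyCircuit.coef, hs, hw, if_false, zero_mul, Finset.sum_const_zero]

variable {M : Fin 4 → Fin 4 → ℂ}

/-- A single-qubit map is run as a two-digit map whose second digit sits just past the list. That
digit is zero for all addresses in use and the table is diagonal in it, so only the sum over the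
first digit survives. -/
theorem IsUpdate.site_apply
    (h : IsUpdate (fun x y u v => if y = v then M x u else 0) p ql.length ql.length C C')
    (i : ℕ) (hi : i < 4 ^ ql.length) :
    C' i = ∑ u : Fin 4, C (i - i / 4 ^ p % 4 * 4 ^ p + u * 4 ^ p) * M u (dig p i) := by
  have h0 : dig ql.length i = 0 := by
    ext
    simp [dig, Nat.div_eq_of_lt hi]
  rw [h, if_pos ((clear2_le _ _ _).trans_lt hi)]
  refine Finset.sum_congr rfl fun u _ => ?_
  rw [h0, Finset.sum_eq_single 0]
  · simp [cell, clear2, Nat.div_eq_of_lt hi]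
  · intro y _ hy; simp [hy]
  · simp

/-- Blocks with base point in range do reach out of range, through a nonzero dummy digit. The table
preserves the dummy digit, so these cells are combinations of cells that vanish already. -/
theorem IsUpdate.site_vanish
    (h : IsUpdate (fun x y u v => if y = v then M x u else 0) p ql.length ql.length C C')
    (hp : p < ql.length) (hC : ∀ i, 4 ^ ql.length ≤ i → C i = 0) (i : ℕ)
    (hi : 4 ^ ql.length ≤ i) : C' i = 0 := by
  rw [h i]
  split_ifs with hlt
  · refine Finset.sum_eq_zero fun x _ => Finset.sum_eq_zero fun y _ => ?_
    by_cases hy : y = dig ql.length i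
    · rw [hC, zero_mul]
      have h1 := clear2_add p ql.length i hp.ne
      have h2 := add_digit_lt hp (x := i / 4 ^ p % 4) (by omega)
        (clear2_digit_left p _ i hp.ne) hlt
      have h3 : 1 ≤ (y : ℕ) := by
        rw [hy]
        by_contra h0
        have h4 : i / 4 ^ ql.length % 4 = 0 := by
          simpa [dig] using h0
        rw [h4] at h1
        omega
      exact (Nat.le_mul_of_pos_left _ h3).trans (by unfold cell; omega)
    · simp [hy]
  · exact hC i hi

theorem IsUpdate.site_coef
    (h : IsUpdate (fun x y u v => if y = v then M x u else 0) p ql.length ql.length C C')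
    (hql : ql.Nodup) (hp : p < ql.length) (w : Fin n → Fin 4) :
    NoisyCircuit.coef C' ql w =
      ∑ u, NoisyCircuit.coef C ql (Function.update w ql[p] u) * M u (w ql[p]) := by
  have hs : ∀ u, (∀ q, q ∉ ql → Function.update w ql[p] u q = 0) ↔ ∀ q, q ∉ ql → w q = 0 := by
    intro u
    refine forall_congr' fun q => imp_congr_right fun hq => ?_
    rw [Function.update_of_ne]
    rintro rfl; exact hq (List.getElem_mem _)
  by_cases hw : ∀ q, q ∉ ql → w q = 0
  · have hcoef : ∀ u, NoisyCircuit.coef C ql (Function.update w ql[p] u) =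
        C (idx ql (Function.update w ql[p] u)) := fun u => if_pos ((hs u).mpr hw)
    simp only [hcoef]
    rw [NoisyCircuit.coef, if_pos hw, h.site_apply _ (idx_lt ql w)]
    have hd : dig p (idx ql w) = w ql[p] := by
      ext
      exact idx_digit p hp w
    rw [hd]
    refine Finset.sum_congr rfl fun u _ => ?_
    congr 2
    have h1 := idx_update hql p hp w u
    have h2 := digit_sub_le p (idx ql w)
    rw [idx_digit p hp] at h2 ⊢
    omega
  · simp only [NoisyCircuit.coef, hs, hw, if_false, zero_mul, Finset.sum_const_zero]

end pair

/-- A new qubit becomes the most significant digit. As the array vanishes from `4 ^ ql.length` on,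
the extended array says that the observable is trivial at `q`, and no cell has to be written. -/
theorem coef_append {C : ℕ → ℂ} {ql : List (Fin n)} (hC : ∀ i, 4 ^ ql.length ≤ i → C i = 0)
    {q : Fin n} (hq : q ∉ ql) : coef C (ql ++ [q]) = coef C ql := by
  funext w
  unfold coef
  by_cases hw : w q = 0
  · have : (∀ q', q' ∉ ql ++ [q] → w q' = 0) ↔ ∀ q', q' ∉ ql → w q' = 0 := by
      refine ⟨fun h q' hq' => ?_, fun h q' hq' => h q' (by simp_all)⟩
      by_cases e : q' = q
      · rw [e, hw]
      · exact h q' (by simp [hq', e])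
    rw [if_congr this rfl rfl]
    simp [idx_append, hw]
  · rw [if_neg (c := ∀ q', q' ∉ ql → w q' = 0) fun h => hw (h q hq)]
    split_ifs
    · rw [idx_append]
      refine hC _ ?_
      have h3 : 1 ≤ (w q : ℕ) := by
        by_contra h0
        exact hw (by ext; simpa using h0)
      exact (Nat.le_mul_of_pos_left _ h3).trans (by omega)
    · rfl

theorem coef_eq_zero_of_mem {C : ℕ → ℂ} {ql : List (Fin n)} {w : Fin n → Fin 4}
    (h : coef C ql w ≠ 0) {q : Fin n} (hq : q ∉ ql) : w q = 0 := by
  by_contra hw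
  refine h ?_
  unfold coef
  rw [if_neg fun h => hw (h q hq)]

theorem coef_zero (C : ℕ → ℂ) (ql : List (Fin n)) : coef C ql 0 = C 0 := by
  have : idx ql (0 : Fin n → Fin 4) = 0 := by
    induction ql with
    | nil => rfl
    | cons q ql ih => rw [idx_cons, ih]; simp
  simp [coef, this]

theorem pairLayer_congr {π : Fin n → Fin n}
    {V V' : Fin n → Matrix (Fin 2 × Fin 2) (Fin 2 × Fin 2) ℂ} (h : ∀ q, q < π q → V q = V' q) :
    pairLayer π V = pairLayer π V' := by
  ext x y
  simp only [pairLayer, Matrix.of_apply]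
  refine Finset.prod_congr rfl fun q _ => ?_
  by_cases hq : q < π q
  · rw [if_pos hq, if_pos hq, h q hq]
  · rw [if_neg hq, if_neg hq]

/-- The gates are replaced by `1` one after the other; each of them is `1` already or acts on two
qubits where the observable is the identity. -/
theorem phi_pairLayer_of_trivial {π : Fin n → Fin n} (hπ : ∀ q, π (π q) = q)
    {V : Fin n → Matrix (Fin 2 × Fin 2) (Fin 2 × Fin 2) ℂ}
    (hV : ∀ q, (V q).conjTranspose * V q = 1) {c : (Fin n → Fin 4) → ℂ}
    (hc : ∀ q, q < π q → V q = 1 ∨ ∀ w, c w ≠ 0 → w q = 0 ∧ w (π q) = 0) (A : Op n) :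
    phi c (pairLayer π V * A * (pairLayer π V).conjTranspose) = phi c A := by
  have key : ∀ S : Finset (Fin n), phi c (pairLayer π V * A * (pairLayer π V).conjTranspose) =
      phi c (pairLayer π (fun q => if q ∈ S then 1 else V q) * A *
        (pairLayer π (fun q => if q ∈ S then 1 else V q)).conjTranspose) := by
    intro S
    induction S using Finset.induction_on with
    | empty => simp
    | insert q S hq ih =>
      rw [ih]
      have e : ∀ W, (Function.update (fun q => if q ∈ S then 1 else V q) q W :
          Fin n → Matrix (Fin 2 × Fin 2) (Fin 2 × Fin 2) ℂ) =
          fun z => if z = q then W else if z ∈ S then 1 else V z := by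
        intro W
        funext z
        by_cases hz : z = q
        · subst hz; simp
        · simp [hz]
      have h1 : (fun q => if q ∈ S then 1 else V q) =
          Function.update (fun q => if q ∈ S then 1 else V q) q (V q) := by
        rw [e]; funext z
        by_cases hz : z = q
        · subst hz; simp [hq]
        · simp [hz]
      have h2 : (fun z => if z ∈ insert q S then 1 else V z) =
          Function.update (fun q => if q ∈ S then 1 else V q) q 1 := by
        rw [e]; funext z
        by_cases hz : z = q
        · subst hz; simp
        · simp [hz]
      rw [h2]
      by_cases hlt : q < π q
      · rcases hc q hlt with h3 | h3
        · rw [h3] at h1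
          rw [← h1]
        · rw [h1, pairLayer_update hπ _ hlt, Matrix.conjTranspose_mul]
          have := phi_pairMat_of_trivial (hV q) hlt.ne h3
            (pairLayer π (Function.update (fun q => if q ∈ S then 1 else V q) q 1) * A *
            (pairLayer π (Function.update (fun q => if q ∈ S then 1 else V q) q 1)).conjTranspose)
          simp only [mul_assoc] at this ⊢
          rw [this]
          simp
      · rw [pairLayer_congr (V := fun q => if q ∈ S then 1 else V q)]
        intro z hz
        have : z ≠ q := by rintro rfl; exact hlt hz
        rw [Function.update_of_ne this]
  rw [key Finset.univ]
  simp [pairLayer_one hπ]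

end

section

/-! ### The program -/

/-- The integers `-1, 0, 1` as expressions. -/
def CExp.sign (z : ℤ) : CExp := if z = 0 then .zero else if 0 < z then .one else .sub .zero .one

theorem CExp.eval_sign (I : Input) (s : Mem) {z : ℤ} (h : z = 0 ∨ z = 1 ∨ z = -1) :
    (CExp.sign z).eval I s = z := by
  rcases h with rfl | rfl | rfl <;> simp [CExp.sign, CExp.eval]

theorem basisInt_sign (u : Fin 4) (a b : Fin 2) :
    basisInt u a b = 0 ∨ basisInt u a b = 1 ∨ basisInt u a b = -1 := by
  revert u a b
  decide

theorem dualInt_sign (u : Fin 4) (a b : Fin 2) :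
    dualInt u a b = 0 ∨ dualInt u a b = 1 ∨ dualInt u a b = -1 := by
  revert u a b
  decide

/-- The expression for `siteDual`. -/
def siteExp (e : Fin 2 → Fin 2 → Fin 2 → Fin 2 → CExp) (u x : Fin 4) : CExp :=
  .fsum fun a : Fin 2 => .fsum fun b : Fin 2 => .mul (.sign (dualInt x b a))
    (.fsum fun c : Fin 2 => .fsum fun d : Fin 2 => .mul (.sign (basisInt u d c)) (e c d a b))

theorem eval_siteExp (I : Input) (s : Mem) (e : Fin 2 → Fin 2 → Fin 2 → Fin 2 → CExp)
    (u x : Fin 4) :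
    (siteExp e u x).eval I s = siteDual (fun c d a b => (e c d a b).eval I s) u x := by
  simp only [siteExp, CExp.eval_fsum, CExp.eval, CExp.eval_sign I s (basisInt_sign _ _ _),
    CExp.eval_sign I s (dualInt_sign _ _ _), siteDual]

/-- The expression for `pairDual`. -/
def pairExp (e : Fin 2 → Fin 2 → Fin 2 → Fin 2 → CExp) (u v x y : Fin 4) : CExp :=
  .fsum fun a : Fin 2 => .fsum fun a' : Fin 2 => .fsum fun b : Fin 2 => .fsum fun b' : Fin 2 =>
    .mul (.mul (.sign (dualInt x b a)) (.sign (dualInt y b' a')))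
    (.fsum fun c : Fin 2 => .fsum fun c' : Fin 2 => .fsum fun d : Fin 2 => .fsum fun d' : Fin 2 =>
      .mul (.mul (.sign (basisInt u d c)) (.sign (basisInt v d' c')))
        (.mul (e c c' a a') (.conj (e d d' b b'))))

theorem eval_pairExp (I : Input) (s : Mem) (e : Fin 2 → Fin 2 → Fin 2 → Fin 2 → CExp)
    (u v x y : Fin 4) :
    (pairExp e u v x y).eval I s = pairDual (fun a b c d => (e a b c d).eval I s) u v x y := by
  simp only [pairExp, CExp.eval_fsum, CExp.eval, CExp.eval_sign I s (basisInt_sign _ _ _),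
    CExp.eval_sign I s (dualInt_sign _ _ _), pairDual]

/-- A single-qubit map on the first of two digits. -/
def siteTable (M : Fin 4 → Fin 4 → CExp) (x y u v : Fin 4) : CExp := if y = v then M x u else .zero

/-- Applies a single-qubit map to the qubit in variable `8`. -/
def applySite (M : Fin 4 → Fin 4 → CExp) : Prog :=
  .seq (.setVar 20 (.arr 0 (.var 8))) (.seq (.setVar 21 (.var 2)) (applyPair (siteTable M)))

/-- Adds the qubit in variable `9` to the list. -/
def addQubit : Prog :=
  .seq (.setArr 0 (.var 9) (.var 2)) (.seq (.setArr 1 (.var 1) (.var 9))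
    (.seq (.setVar 1 (.add (.var 1) (.lit 1))) (.setVar 2 (NExp.rep 4 (.var 2)))))

/-- Applies a single-qubit map to all qubits of the list. -/
def siteLoop (M : Fin 4 → Fin 4 → CExp) : Prog :=
  .seq (.setVar 7 (.lit 0)) (.loop (.var 7) (.var 1)
    (.seq (.setVar 8 (.arr 1 (.var 7))) (.seq (applySite M) (.setVar 7 (.add (.var 7) (.lit 1))))))

/-- The entries of the two-qubit gate in sublayer `var 6` of layer `var 4` with smaller qubit
`var 12`. -/
def gateEntry (a b c d : Fin 2) : CExp :=
  .inp 5 (.var 4) (.var 6) (.var 12) (.lit (b + 2 * a)) (.lit (d + 2 * c))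

/-- The entries of the noise channel. -/
def noiseEntry (c d a b : Fin 2) : CExp := .inp 4 (.lit c) (.lit d) (.lit a) (.lit b) (.lit 0)

/-- The entries of the conjugation by the final gate on qubit `var 8`. -/
def finalEntry (c d a b : Fin 2) : CExp :=
  .mul (.inp 3 (.var 8) (.lit c) (.lit a) (.lit 0) (.lit 0))
    (.conj (.inp 3 (.var 8) (.lit d) (.lit b) (.lit 0) (.lit 0)))

/-- Applies the gate on the qubits in variables `8` and `9`. -/
def applyGate : Prog :=
  .seq (.ifLt (.var 8) (.var 9) (.seq (.setVar 12 (.var 8)) (.setVar 13 (.var 9)))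
    (.seq (.setVar 12 (.var 9)) (.setVar 13 (.var 8))))
  (.seq (.setVar 20 (.arr 0 (.var 12))) (.seq (.setVar 21 (.arr 0 (.var 13)))
    (applyPair (pairExp gateEntry))))

/-- The step of a sublayer for the qubit number `var 7` of the list. -/
def subBody : Prog :=
  .seq (.setVar 8 (.arr 1 (.var 7))) (.seq (.setVar 9 (.inp 5 (.var 4) (.var 6) (.var 8)))
    (.seq (.ifLt (.arr 0 (.var 9)) (.lit 1) addQubit .skip)
      (.seq (.ifLt (.arr 0 (.var 8)) (.arr 0 (.var 9)) applyGate .skip)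
        (.setVar 7 (.add (.var 7) (.lit 1))))))

/-- Sublayer `var 6` of layer `var 4`. -/
def subProg : Prog :=
  .seq (.setVar 10 (.var 1)) (.seq (.setVar 7 (.lit 0)) (.loop (.var 7) (.var 10) subBody))

/-- The number of sublayers. -/
def expM : NExp := .inp 1 (.lit 0) (.lit 0) (.lit 0)

/-- The number of layers. -/
def expL : NExp := .inp 0 (.lit 0) (.lit 0) (.lit 0)

/-- The noisy layer `var 4`. -/
def layerProg : Prog :=
  .seq (siteLoop (siteExp noiseEntry)) (.seq (.setVar 5 (.lit 0)) (.loop (.var 5) expM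
    (.seq (.setVar 6 (.sub (.sub expM (.lit 1)) (.var 5)))
      (.seq subProg (.setVar 5 (.add (.var 5) (.lit 1)))))))

/-- The last `var 0` noisy layers. -/
def layersProg : Prog :=
  .seq (.setVar 3 (.lit 0)) (.loop (.var 3) (.var 0)
    (.seq (.ifLt (.var 3) expL
      (.seq (.setVar 4 (.sub (.sub expL (.lit 1)) (.var 3))) layerProg) .skip)
      (.setVar 3 (.add (.var 3) (.lit 1)))))

/-- Computes the number of layers to be kept. -/
def depthProg : Prog :=
  .seq (.setVar 11 (.lit 1)) (.seq (.setCarr 3 (.lit 0) (.add (.add .one .one) (.add .one .one)))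
    (.loop (.lit 0) (.var 11)
      (.ifLe (.arr 3 (.lit 0)) (.mul (.inp 1 (.lit 0) (.lit 0) (.lit 0) (.lit 0) (.lit 0))
          (.mul (.inp 0 (.lit 0) (.lit 0) (.lit 0) (.lit 0) (.lit 0))
            (.inp 0 (.lit 0) (.lit 0) (.lit 0) (.lit 0) (.lit 0))))
        (.setVar 11 (.lit 0))
        (.seq (.setCarr 3 (.lit 0) (.mul (.arr 3 (.lit 0))
            (.inp 2 (.lit 0) (.lit 0) (.lit 0) (.lit 0) (.lit 0))))
          (.setVar 0 (.add (.var 0) (.lit 1)))))))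

/-- Expressions for the coefficients of the Paulis. -/
def pauliExp : Fin 4 → Fin 4 → CExp :=
  ![![.one, .zero, .zero, .zero], ![.zero, .one, .one, .zero],
    ![.zero, .sub .zero .imag, .imag, .zero], ![.one, .zero, .zero, .sub .zero (.add .one .one)]]

theorem eval_pauliExp (I : Input) (s : Mem) (u x : Fin 4) :
    (pauliExp u x).eval I s = pauliCoef u x := by
  fin_cases u <;> fin_cases x <;> simp [pauliExp, pauliCoef, CExp.eval, one_add_one_eq_two]

/-- Stores the coefficients of a Pauli. -/
def storePauli (u : Fin 4) : Prog :=
  storeAll 2 ((List.finRange 4).map fun x : Fin 4 => (.lit x, pauliExp u x))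

/-- Stores the coefficients of the letter at qubit `var 8`, if it is not the identity. -/
def loadPauli : Prog :=
  .ifLt (.inp 4 (.var 8) (.lit 0) (.lit 0)) (.lit 2) (storePauli 1)
    (.ifLt (.inp 4 (.var 8) (.lit 0) (.lit 0)) (.lit 3) (storePauli 2) (storePauli 3))

/-- The map that replaces the identity by the stored Pauli. -/
def storedExp (_ x : Fin 4) : CExp := .arr 2 (.lit x)

/-- The weight of the Pauli. -/
def expWeight : NExp := .inp 2 (.lit 0) (.lit 0) (.lit 0)

/-- Initializes the coefficients with those of the Pauli. -/
def initProg : Prog :=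
  .seq (.setVar 2 (.lit 1)) (.seq (.setCarr 0 (.lit 0) .one) (.seq (.setVar 7 (.lit 0))
    (.loop (.var 7) expWeight (.seq (.setVar 9 (.inp 3 (.var 7) (.lit 0) (.lit 0)))
      (.seq addQubit (.seq (.setVar 8 (.var 9)) (.seq loadPauli (.seq (applySite storedExp)
        (.setVar 7 (.add (.var 7) (.lit 1)))))))))))

/-- The whole program. -/
def mainProg : Prog :=
  .seq depthProg (.seq initProg (.seq (siteLoop (siteExp finalEntry)) layersProg))

/-! ### Its data structure -/

variable {n : ℕ}

/-- The memory holds coefficients for the qubits of the list `ql`. -/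
structure Holds (ql : List (Fin n)) (s : Mem) : Prop where
  nodup : ql.Nodup
  size : s.var 1 = ql.length
  width : s.var 2 = 4 ^ ql.length
  list : ∀ p (hp : p < ql.length), s.arr 1 p = (ql[p] : ℕ)
  place : ∀ p (hp : p < ql.length), s.arr 0 (ql[p] : ℕ) = 4 ^ p
  absent : ∀ q : Fin n, q ∉ ql → s.arr 0 q = 0
  vanish : ∀ i, 4 ^ ql.length ≤ i → s.carr 0 i = 0

theorem Holds.congr {ql : List (Fin n)} {s s' : Mem} (h : Holds ql s) (h1 : s'.var 1 = s.var 1)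
    (h2 : s'.var 2 = s.var 2) (ha : s'.arr = s.arr)
    (hv : ∀ i, 4 ^ ql.length ≤ i → s'.carr 0 i = 0) : Holds ql s' :=
  ⟨h.nodup, h1.trans h.size, h2.trans h.width, by rw [ha]; exact h.list, by rw [ha]; exact h.place,
    by rw [ha]; exact h.absent, hv⟩

theorem Holds.frame {ql : List (Fin n)} {s s' : Mem} (h : Holds ql s) {t : ℕ} (ht : 3 ≤ t)
    (hf : Frame t s s') (hv : ∀ i, 4 ^ ql.length ≤ i → s'.carr 0 i = 0) : Holds ql s' :=
  h.congr (hf.1 1 (by omega)) (hf.1 2 (by omega)) hf.2.1 hv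

theorem Holds.setVar {ql : List (Fin n)} {s : Mem} (h : Holds ql s) {x : ℕ} (hx : 3 ≤ x) (v : ℕ) :
    Holds ql (s.setVar x v) :=
  h.frame hx ((Frame.refl x s).setVar le_rfl v) (by simpa using h.vanish)

/-- The current observable. -/
noncomputable def obs (ql : List (Fin n)) (s : Mem) : Op n → ℂ := phi (coef (s.carr 0) ql)

/-- The width `4 ^ ql.length`, kept in variable `2`, serves as the place value of the dummy second
digit. -/
theorem applySite_reach {I : Input} {s : Mem} {ql : List (Fin n)} (h : Holds ql s) {p : ℕ}
    (hp : p < ql.length) (h8 : s.var 8 = (ql[p] : ℕ)) {M : Fin 4 → Fin 4 → CExp}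
    {a : Fin 4 → Fin 4 → ℂ}
    (hM : ∀ s', Frame 20 s s' → ∀ x u, (M x u).eval I s' = a x u) :
    Reach I (applySite M) s (5 + applyCost (siteTable M) ql.length) fun s' =>
      Frame 20 s s' ∧ Holds ql s' ∧ ∀ w, coef (s'.carr 0) ql w =
        ∑ u, coef (s.carr 0) ql (Function.update w ql[p] u) * a u (w ql[p]) := by
  refine Reach.mono (B := (1 + 1 + 1) + (2 + applyCost (siteTable M) ql.length)) ?_ (by omega)
    fun _ h => h
  refine Reach.seq (Reach.setVar (Q := (· = s.setVar 20 (4 ^ p))) ?_) ?_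
  · simp only [NExp.eval, h8, h.place p hp]
  rintro _ rfl
  refine Reach.seq (Reach.setVar
    (Q := (· = (s.setVar 20 (4 ^ p)).setVar 21 (4 ^ ql.length))) ?_) ?_
  · simp [NExp.eval, h.width]
  rintro _ rfl
  have hf : Frame 20 s ((s.setVar 20 (4 ^ p)).setVar 21 (4 ^ ql.length)) :=
    ((Frame.refl 20 s).setVar le_rfl _).setVar (by norm_num) _
  refine (applyPair_reach I _ (p := p) (p' := ql.length) (k := ql.length) hp.ne hp.le le_rfl
    (by simp) (by simp) (by simp [h.width]) (siteTable M)
    (fun x y u v => if y = v then a x u else 0) ?_).mono le_rfl ?_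
  · intro s' hs' x y u v
    unfold siteTable
    split_ifs
    · exact hM s' (hf.trans hs') x u
    · rfl
  · rintro s' ⟨h1, h2⟩
    have hU : IsUpdate (fun x y u v => if y = v then a x u else 0) p ql.length ql.length
      (s.carr 0) (s'.carr 0) := h2
    exact ⟨hf.trans h1, h.frame (by norm_num) (hf.trans h1) (hU.site_vanish hp h.vanish),
      hU.site_coef h.nodup hp⟩

theorem addQubit_reach {I : Input} {s : Mem} {ql : List (Fin n)} (h : Holds ql s) {q : Fin n}
    (hq : q ∉ ql) (h9 : s.var 9 = q) :
    Reach I addQubit s 23 fun s' => Holds (ql ++ [q]) s' ∧ s'.carr = s.carr ∧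
      ∀ x, x ≠ 1 → x ≠ 2 → s'.var x = s.var x := by
  refine Reach.mono (B := (1 + 1 + 1) + ((1 + 1 + 1) + ((3 + 1) + (9 + 1)))) ?_ (by omega)
    fun _ h => h
  refine Reach.seq (Reach.setArr (Q := (· = s.setArr 0 q (4 ^ ql.length))) ?_) ?_
  · simp only [NExp.eval, h9, h.width]
  rintro _ rfl
  refine Reach.seq (Reach.setArr
    (Q := (· = (s.setArr 0 q (4 ^ ql.length)).setArr 1 ql.length q)) ?_) ?_
  · simp [NExp.eval, h9, h.size]
  rintro _ rfl
  refine Reach.seq (Reach.setVar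
    (Q := (· = ((s.setArr 0 q (4 ^ ql.length)).setArr 1 ql.length q).setVar 1 (ql.length + 1))) ?_)
    ?_
  · simp [NExp.eval, h.size]
  rintro _ rfl
  refine Reach.setVar ⟨⟨?_, ?_, ?_, ?_, ?_, ?_, ?_⟩, rfl, ?_⟩
  · rw [← List.concat_eq_append]
    exact h.nodup.concat hq
  · simp
  · simp [NExp.eval, h.width, pow_succ, mul_comm]
  · intro p hp
    rw [List.length_append, List.length_singleton] at hp
    by_cases hpl : p = ql.length
    · subst hpl
      simp
    · have hp' : p < ql.length := by omega
      simp [hpl, List.getElem_append_left hp', h.list p hp']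
  · intro p hp
    rw [List.length_append, List.length_singleton] at hp
    by_cases hpl : p = ql.length
    · subst hpl
      simp
    · have hp' : p < ql.length := by omega
      have hne : (ql[p] : ℕ) ≠ q := by
        intro e
        exact hq (Fin.ext e ▸ List.getElem_mem hp')
      simp [List.getElem_append_left hp', h.place p hp', hne]
  · intro q' hq'
    simp only [List.mem_append, List.mem_singleton, not_or] at hq'
    have : (q' : ℕ) ≠ q := fun e => hq'.2 (Fin.ext e)
    simp [this, h.absent q' hq'.1]
  · intro i hi
    refine h.vanish i (le_trans ?_ hi)
    exact Nat.pow_le_pow_right (by norm_num) (by simp)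
  · intro x h1 h2
    simp [h1, h2]

theorem mem_take_succ {ql : List (Fin n)} {J : ℕ} (hJ : J < ql.length) {q : Fin n} :
    q ∈ ql.take (J + 1) ↔ q ∈ ql.take J ∨ q = ql[J] := by
  rw [List.take_succ_eq_append_getElem hJ, List.mem_append, List.mem_singleton]

theorem getElem_notMem_take {ql : List (Fin n)} (h : ql.Nodup) {J p : ℕ} (hp : p < ql.length)
    (hJ : J ≤ p) : ql[p] ∉ ql.take J := by
  intro hm
  obtain ⟨j, hj, e⟩ := List.mem_take_iff_getElem.mp hm
  have := (h.getElem_inj_iff).mp e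
  omega

/-- At stage `J` the maps at the first `J` listed qubits have been moved to the observable. In the
end maps are left only at unlisted qubits, where trace preservation makes them invisible. The table
may depend on the qubit, through variable `8`; this covers both the noise and the final gates. -/
theorem siteLoop_reach {I : Input} {s : Mem} {ql : List (Fin n)} (h : Holds ql s)
    {M : Fin 4 → Fin 4 → CExp} {N : Fin n → Op1 →ₗ[ℂ] Op1} {a : Fin n → Fin 4 → Fin 4 → ℂ}
    (hN : ∀ q, IsDualMatrix siteBasis (N q) (a q)) (htp : ∀ q X, (N q X).trace = X.trace)
    (hM : ∀ s' (q : Fin n), Frame 7 s s' → s'.var 8 = q → ∀ x u, (M x u).eval I s' = a q x u) :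
    Reach I (siteLoop M) s (2 + (ql.length + 1) * (15 + applyCost (siteTable M) ql.length))
      fun s' => Frame 7 s s' ∧ Holds ql s' ∧ ∀ A, obs ql s (tensorOp N A) = obs ql s' A := by
  refine Reach.seq (Reach.setVar (Q := (· = s.setVar 7 0)) rfl) ?_
  rintro _ rfl
  refine Reach.mono (B := (ql.length + 1) * (1 + 1 + 1 + ((1 + 1 + 1) +
    ((5 + applyCost (siteTable M) ql.length) + (3 + 1))))) ?_ ?_ fun _ h => h
  swap
  · exact Nat.mul_le_mul_left _ (by omega)
  refine (Reach.loop ql.length (fun J s' => Frame 7 s s' ∧ Holds ql s' ∧ s'.var 7 = J ∧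
    ∀ A, obs ql s (tensorOp N A) =
      obs ql s' (tensorOp (fun q => if q ∈ ql.take J then LinearMap.id else N q) A))
    ?_ ?_ ?_).mono le_rfl ?_
  · rintro J s1 hJ ⟨hf, hh, h7, hA⟩
    refine ⟨by simp [NExp.eval, h7, hh.size, hJ], ?_⟩
    refine Reach.seq (Reach.setVar (Q := (· = s1.setVar 8 ql[J])) ?_) ?_
    · simp only [NExp.eval, h7, hh.list J hJ]
    rintro _ rfl
    refine Reach.seq (applySite_reach (hh.setVar (x := 8) (by norm_num) _) (p := J) hJ (by simp)
      (a := a ql[J]) fun s' hs' => hM s' _ ?_ ?_) ?_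
    · exact (hf.setVar (by norm_num) _).trans (hs'.mono (by norm_num))
    · rw [hs'.1 8 (by norm_num)]; simp
    rintro s2 ⟨g1, g2, g3⟩
    refine Reach.setVar ⟨?_, ?_, ?_, ?_⟩
    · exact ((hf.setVar (by norm_num) _).trans (g1.mono (by norm_num))).setVar le_rfl _
    · exact g2.setVar (by norm_num) _
    · simp [NExp.eval, g1.1 7, h7]
    · intro A
      rw [hA A]
      have hnot := getElem_notMem_take h.nodup hJ le_rfl
      refine (phi_tensorOp_site (q := ql[J]) (a := a ql[J]) ?_ (c' := coef (s2.carr 0) ql) ?_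
        A).trans ?_
      · simp only [hnot, if_false]
        exact hN _
      · exact g3
      · unfold obs
        congr 2
        refine congrArg tensorOp (funext fun q => ?_)
        simp only [mem_take_succ hJ]
        by_cases hq : q = ql[J]
        · rw [hq]; simp
        · simp [hq]
  · rintro s' ⟨-, hh, h7, -⟩
    simp [NExp.eval, h7, hh.size]
  · refine ⟨(Frame.refl 7 s).setVar le_rfl _, h.setVar (by norm_num) _, by simp, fun A => ?_⟩
    simp [obs]
  · rintro s' ⟨h1, h2, -, h3⟩
    refine ⟨h1, h2, fun A => ?_⟩
    rw [h3 A]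
    refine phi_tensorOp_of_trivial (fun w hw q => ?_) A
    by_cases hq : q ∈ ql
    · left; simp [hq]
    · right
      refine ⟨coef_eq_zero_of_mem hw hq, fun X => ?_⟩
      simp [hq, htp]

end

/-! ### Gates and sublayers acting on the stored observable -/

section

variable {n : ℕ}

theorem applyCost_mono (T : Fin 4 → Fin 4 → Fin 4 → Fin 4 → CExp) {k k' : ℕ} (h : k ≤ k') :
    applyCost T k ≤ applyCost T k' := by
  have := Nat.pow_le_pow_right (n := 4) (by norm_num) h
  unfold applyCost
  gcongr

/-- A gate is filed under its smaller qubit, and its tensor factors are ordered accordingly; hence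
the pair is sorted before the table is read. -/
theorem applyGate_reach {I : Input} {s : Mem} {ql : List (Fin n)} (h : Holds ql s) {p p' : ℕ}
    (hp : p < ql.length) (hp' : p' < ql.length) (hpp : p ≠ p') {lo hi : Fin n} (hlo : ql[p] = lo)
    (hhi : ql[p'] = hi)
    (hs : (s.var 8 < s.var 9 ∧ s.var 8 = lo ∧ s.var 9 = hi) ∨
      (¬ s.var 8 < s.var 9 ∧ s.var 9 = lo ∧ s.var 8 = hi))
    {V : Matrix (Fin 2 × Fin 2) (Fin 2 × Fin 2) ℂ}
    (hV : ∀ a b c d : Fin 2, I.cplx 5 (s.var 4) (s.var 6) lo (b + 2 * a) (d + 2 * c) =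
      V (a, b) (c, d)) :
    Reach I applyGate s (13 + applyCost (pairExp gateEntry) ql.length) fun s' =>
      Frame 12 s s' ∧ Holds ql s' ∧ ∀ A,
        obs ql s (pairMat V lo hi * A * (pairMat V lo hi).conjTranspose) = obs ql s' A := by
  refine Reach.mono (B := (1 + 1 + 1 + ((1 + 1) + (1 + 1))) + ((2 + 1) + ((2 + 1) +
    applyCost (pairExp gateEntry) ql.length))) ?_ (by omega) fun _ h => h
  have hne : lo ≠ hi := by
    rw [← hlo, ← hhi]
    exact fun e => hpp ((h.nodup.getElem_inj_iff).mp e)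
  refine Reach.seq (R := (· = (s.setVar 12 lo).setVar 13 hi)) ?_ ?_
  · refine Reach.ifLt (fun hc => ?_) fun hc => ?_
    · simp only [NExp.eval] at hc
      rcases hs with ⟨-, h1, h2⟩ | ⟨h0, -⟩
      · refine Reach.seq (Reach.setVar (Q := (· = s.setVar 12 lo)) ?_) ?_
        · simp [NExp.eval, h1]
        rintro _ rfl
        exact Reach.setVar (by simp [NExp.eval, h2])
      · exact absurd hc h0
    · simp only [NExp.eval] at hc
      rcases hs with ⟨h0, -⟩ | ⟨-, h1, h2⟩
      · exact absurd h0 hc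
      · refine Reach.seq (Reach.setVar (Q := (· = s.setVar 12 lo)) ?_) ?_
        · simp [NExp.eval, h1]
        rintro _ rfl
        exact Reach.setVar (by simp [NExp.eval, h2])
  rintro _ rfl
  refine Reach.seq (Reach.setVar
    (Q := (· = ((s.setVar 12 lo).setVar 13 hi).setVar 20 (4 ^ p))) ?_) ?_
  · simp [NExp.eval, ← h.place p hp, hlo]
  rintro _ rfl
  refine Reach.seq (Reach.setVar
    (Q := (· = (((s.setVar 12 lo).setVar 13 hi).setVar 20 (4 ^ p)).setVar 21 (4 ^ p'))) ?_) ?_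
  · simp [NExp.eval, ← h.place p' hp', hhi]
  rintro _ rfl
  set s1 := (((s.setVar 12 lo).setVar 13 hi).setVar 20 (4 ^ p)).setVar 21 (4 ^ p') with hs1
  have hf : Frame 12 s s1 := ((((Frame.refl 12 s).setVar le_rfl _).setVar (by norm_num) _).setVar
    (by norm_num) _).setVar (by norm_num) _
  have h12 : s1.var 12 = lo := by simp [hs1]
  refine (applyPair_reach I s1 (k := ql.length) hpp hp.le hp'.le
    (by simp [hs1]) (by simp [hs1]) (by simp [hs1, h.width]) (pairExp gateEntry)
    (pairDual fun a b c d => V (a, b) (c, d)) ?_).mono le_rfl ?_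
  · intro s' hs' x y u v
    rw [eval_pairExp]
    congr 1
    funext a b c d
    simp only [gateEntry, CExp.eval, NExp.eval, hs'.1 4 (by norm_num), hs'.1 6 (by norm_num),
      hs'.1 12 (by norm_num), h12, hf.1 4 (by norm_num), hf.1 6 (by norm_num), hV]
  · rintro s' ⟨h1, h2⟩
    have hU : IsUpdate (pairDual fun a b c d => V (a, b) (c, d)) p p' ql.length
      (s.carr 0) (s'.carr 0) := h2
    have hf' : Frame 12 s s' := hf.trans (h1.mono (by norm_num))
    refine ⟨hf', h.frame (by norm_num) hf' (hU.vanish hpp hp hp' h.vanish), fun A => ?_⟩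
    refine phi_pairMat hne (isDualMatrix2_pairDual V) (fun w => ?_) A
    rw [hU.coef h.nodup hpp hp hp', hlo, hhi]

/-- The gates of a sublayer that are not yet processed after `J` steps. -/
noncomputable def pending (π : Fin n → Fin n) (V : Fin n → Matrix (Fin 2 × Fin 2) (Fin 2 × Fin 2) ℂ)
    (ql : List (Fin n)) (J : ℕ) (q : Fin n) : Matrix (Fin 2 × Fin 2) (Fin 2 × Fin 2) ℂ :=
  if q ∈ ql.take J ∨ π q ∈ ql.take J then 1 else V q

/-- The invariant of the processing of a sublayer. -/
def SubInv (π : Fin n → Fin n) (V : Fin n → Matrix (Fin 2 × Fin 2) (Fin 2 × Fin 2) ℂ)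
    (ql : List (Fin n)) (s : Mem) (J : ℕ) (s' : Mem) : Prop :=
  (∀ x, x < 7 → x ≠ 1 → x ≠ 2 → s'.var x = s.var x) ∧ s'.var 10 = ql.length ∧ s'.var 7 = J ∧
    ∃ ext, Holds (ql ++ ext) s' ∧ (∀ q ∈ ext, π q ∈ ql.take J) ∧
      ∀ A, obs ql s (pairLayer π V * A * (pairLayer π V).conjTranspose) =
        obs (ql ++ ext) s' (pairLayer π (pending π V ql J) * A *
          (pairLayer π (pending π V ql J)).conjTranspose)

/-- The step of an idle qubit, or of a qubit whose partner had its step before, leaves the pending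
gates unchanged. -/
theorem pending_succ_of_done {π : Fin n → Fin n} (hπ : ∀ q, π (π q) = q)
    (V : Fin n → Matrix (Fin 2 × Fin 2) (Fin 2 × Fin 2) ℂ) {ql : List (Fin n)} {J : ℕ}
    (hJ : J < ql.length) (h : π ql[J] = ql[J] ∨ π ql[J] ∈ ql.take J) :
    pairLayer π (pending π V ql (J + 1)) = pairLayer π (pending π V ql J) := by
  refine pairLayer_congr fun q hq => ?_
  simp only [pending, mem_take_succ hJ]
  by_cases h1 : q = ql[J]
  · subst h1
    rcases h with h | h
    · exact absurd h hq.ne'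
    · simp [h]
  · by_cases h2 : π q = ql[J]
    · have h3 : π ql[J] = q := by rw [← h2, hπ]
      rw [h3] at h
      rcases h with h | h
      · exact absurd h h1
      · simp [h]
    · simp [h1, h2]

/-- Since neither end of the pair was treated before, this step removes exactly one pending gate.
Its smaller qubit `lo` can be either end. -/
theorem pending_succ {π : Fin n → Fin n} (hπ : ∀ q, π (π q) = q)
    (V : Fin n → Matrix (Fin 2 × Fin 2) (Fin 2 × Fin 2) ℂ) {ql : List (Fin n)} {J : ℕ}
    (hJ : J < ql.length) (h0 : ql[J] ∉ ql.take J) (h1 : π ql[J] ∉ ql.take J) {lo : Fin n}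
    (hlo : lo = ql[J] ∨ lo = π ql[J]) (hlt : lo < π lo) :
    pairLayer π (pending π V ql J) =
      pairMat (V lo) lo (π lo) * pairLayer π (pending π V ql (J + 1)) := by
  have hlo' : lo ∉ ql.take J ∧ π lo ∉ ql.take J := by
    rcases hlo with rfl | rfl
    · exact ⟨h0, h1⟩
    · rw [hπ]; exact ⟨h1, h0⟩
  have e1 : pending π V ql J = Function.update (pending π V ql J) lo (V lo) := by
    rw [eq_comm, Function.update_eq_self_iff]
    simp [pending, hlo'.1, hlo'.2]
  rw [e1, pairLayer_update hπ _ hlt]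
  congr 1
  refine pairLayer_congr fun q hq => ?_
  by_cases hq' : q = lo
  · rw [hq', Function.update_self, pending, if_pos]
    rw [mem_take_succ hJ, mem_take_succ hJ]
    rcases hlo with h | h
    · simp [h]
    · right; right; rw [h, hπ]
  · rw [Function.update_of_ne hq']
    simp only [pending, mem_take_succ hJ]
    have h2 : q ≠ ql[J] := by
      rintro rfl
      rcases hlo with h | h
      · exact hq' h.symm
      · rw [h, hπ] at hlt; exact absurd hq hlt.not_gt
    have h3 : π q ≠ ql[J] := by
      intro e
      have e' : q = π ql[J] := by rw [← e, hπ]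
      rcases hlo with h | h
      · rw [h, ← e, hπ] at hlt; exact absurd hq hlt.not_gt
      · exact hq' (e'.trans h.symm)
    simp [h2, h3]

/-- The partner is added to the list if necessary, and the gate is applied only when the current
qubit precedes its partner in the list. Thus each gate that meets the original list is applied
exactly once. -/
theorem subBody_reach {I : Input} {s : Mem} {ql : List (Fin n)} (hnd : ql.Nodup)
    {π : Fin n → Fin n} (hπ : ∀ q, π (π q) = q)
    (hI : ∀ q : Fin n, I.nat 5 (s.var 4) (s.var 6) q = π q)
    {V : Fin n → Matrix (Fin 2 × Fin 2) (Fin 2 × Fin 2) ℂ}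
    (hV : ∀ q, q < π q → ∀ a b c d : Fin 2,
      I.cplx 5 (s.var 4) (s.var 6) q (b + 2 * a) (d + 2 * c) = V q (a, b) (c, d)) {kmax : ℕ}
    (hk : ∀ ql' : List (Fin n), ql'.Nodup → (∀ q ∈ ql', q ∈ ql ∨ π q ∈ ql) → ql'.length ≤ kmax)
    {J : ℕ} (hJ : J < ql.length) {s1 : Mem} (h : SubInv π V ql s J s1) :
    Reach I subBody s1 (60 + applyCost (pairExp gateEntry) kmax) (SubInv π V ql s (J + 1)) := by
  obtain ⟨hv, h10, h7, ext, hH, hext, hA⟩ := h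
  have hJ' : J < (ql ++ ext).length := by rw [List.length_append]; omega
  have hgJ : (ql ++ ext)[J] = ql[J] := List.getElem_append_left hJ
  have h0 : ql[J] ∉ ql.take J := getElem_notMem_take hnd hJ le_rfl
  refine Reach.mono (B := (2 + 1) + ((4 + 1) + ((2 + 1 + 1 + 23) + ((2 + 2 + 1 +
    (13 + applyCost (pairExp gateEntry) kmax)) + (3 + 1))))) ?_ (by omega) fun _ h => h
  set q := ql[J] with hq
  refine Reach.seq (Reach.setVar (Q := (· = s1.setVar 8 q)) ?_) ?_
  · simp only [NExp.eval, h7, hH.list J hJ', hgJ]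
  rintro _ rfl
  refine Reach.seq (Reach.setVar (Q := (· = (s1.setVar 8 q).setVar 9 (π q))) ?_) ?_
  · simp [NExp.eval, hv, hI]
  rintro _ rfl
  set s2 := (s1.setVar 8 q).setVar 9 (π q) with hs2
  have hH2 : Holds (ql ++ ext) s2 := (hH.setVar (by norm_num) _).setVar (by norm_num) _
  refine Reach.seq (R := fun s' => (∀ x, x < 12 → x ≠ 1 → x ≠ 2 → s'.var x = s2.var x) ∧
    ∃ ext', Holds (ql ++ ext') s' ∧ (∀ q ∈ ext', π q ∈ ql.take (J + 1)) ∧ π q ∈ ql ++ ext' ∧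
      obs (ql ++ ext') s' = obs (ql ++ ext) s1) ?_ ?_
  · have hext1 : ∀ q ∈ ext, π q ∈ ql.take (J + 1) :=
      fun z hz => (mem_take_succ hJ).mpr (Or.inl (hext z hz))
    -- Place values are powers of four, so a zero in array `0` says that the partner is not listed.
    refine Reach.ifLt (fun hc => ?_) fun hc => ?_
    · have hnot : π q ∉ ql ++ ext := by
        intro hm
        obtain ⟨p, hp, e⟩ := List.getElem_of_mem hm
        have := hH2.place p hp
        rw [e] at this
        simp [NExp.eval, hs2] at hc
        simp [hs2, hc] at this
        exact absurd this.symm (by positivity)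
      refine (addQubit_reach hH2 hnot (by simp [hs2])).mono le_rfl ?_
      rintro s' ⟨g1, g2, g3⟩
      refine ⟨fun x _ h1 h2 => g3 x h1 h2, ext ++ [π q], ?_, ?_, by simp, ?_⟩
      · rw [← List.append_assoc]; exact g1
      · intro z hz
        rcases List.mem_append.mp hz with hz | hz
        · exact hext1 z hz
        · rw [List.mem_singleton.mp hz, hπ, mem_take_succ hJ]; exact Or.inr rfl
      · rw [← List.append_assoc, obs, g2, coef_append hH2.vanish hnot]
        rfl
    · refine (Reach.skip ⟨fun x _ _ _ => rfl, ext, hH2, hext1, ?_, rfl⟩).mono (by norm_num)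
        fun _ h => h
      by_contra hm
      simp [NExp.eval, hs2] at hc
      have := hH.absent _ hm
      exact hc this
  rintro s3 ⟨hv3, ext', hH3, hext', hmem, hobs⟩
  have hext'' : ∀ z ∈ ql ++ ext', z ∈ ql ∨ π z ∈ ql := by
    intro z hz
    rcases List.mem_append.mp hz with hz | hz
    · exact Or.inl hz
    · exact Or.inr (List.mem_of_mem_take (hext' z hz))
  have hJ3 : J < (ql ++ ext').length := by rw [List.length_append]; omega
  have hgJ3 : (ql ++ ext')[J] = q := List.getElem_append_left hJ
  obtain ⟨p', hp', hgp'⟩ := List.getElem_of_mem hmem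
  have h8 : s3.var 8 = q := by rw [hv3 8 (by norm_num) (by norm_num) (by norm_num)]; simp [hs2]
  have h9 : s3.var 9 = π q := by rw [hv3 9 (by norm_num) (by norm_num) (by norm_num)]; simp [hs2]
  have hvar : ∀ x, x < 7 → x ≠ 1 → x ≠ 2 → s3.var x = s.var x := by
    intro x hx h1 h2
    rw [hv3 x (by omega) h1 h2, ← hv x hx h1 h2]
    simp [hs2, show x ≠ 9 by omega, show x ≠ 8 by omega]
  refine Reach.seq (R := fun s' => Frame 12 s3 s' ∧ Holds (ql ++ ext') s' ∧
      ∀ A, obs (ql ++ ext') s3 (pairLayer π (pending π V ql J) * A *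
          (pairLayer π (pending π V ql J)).conjTranspose) =
        obs (ql ++ ext') s' (pairLayer π (pending π V ql (J + 1)) * A *
          (pairLayer π (pending π V ql (J + 1))).conjTranspose)) ?_ ?_
  · have hw8 : s3.arr 0 (s3.var 8) = 4 ^ J := by
      rw [h8, ← hgJ3]; exact hH3.place J hJ3
    have hw9 : s3.arr 0 (s3.var 9) = 4 ^ p' := by
      rw [h9, ← hgp']; exact hH3.place p' hp'
    refine Reach.ifLt (fun hc => ?_) fun hc => ?_
    · simp only [NExp.eval, hw8, hw9] at hc
      -- Comparing place values is comparing positions: the partner comes later, so its gate is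
      -- still pending.
      have hlt : J < p' := (Nat.pow_lt_pow_iff_right (by norm_num)).mp hc
      have hne : π q ≠ q := by
        intro e
        have e' : (ql ++ ext')[p'] = (ql ++ ext')[J] := by rw [hgp', hgJ3, e]
        exact hlt.ne' ((hH3.nodup.getElem_inj_iff).mp e')
      have h1 : π q ∉ ql.take J := by
        have := getElem_notMem_take hH3.nodup hp' hlt.le
        rwa [hgp', List.take_append_of_le_length hJ.le] at this
      have hcost := applyCost_mono (pairExp gateEntry) (hk _ hH3.nodup hext'')
      rcases lt_or_gt_of_ne hne with hlt' | hlt'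
      · refine (applyGate_reach hH3 hp' hJ3 hlt.ne' (lo := π q) (hi := q) hgp' hgJ3
          (Or.inr ⟨?_, h9, h8⟩) (V := V (π q)) ?_).mono (by omega) ?_
        · rw [h8, h9]; exact not_lt.mpr hlt'.le
        · rw [hvar 4 (by norm_num) (by norm_num) (by norm_num),
            hvar 6 (by norm_num) (by norm_num) (by norm_num)]
          exact hV _ (by rwa [hπ])
        · rintro s' ⟨g1, g2, g3⟩
          refine ⟨g1, g2, fun A => ?_⟩
          rw [pending_succ hπ V hJ h0 h1 (Or.inr rfl) (by rwa [hπ]), ← g3]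
          simp only [hπ, Matrix.conjTranspose_mul, mul_assoc]
          rfl
      · refine (applyGate_reach hH3 hJ3 hp' hlt.ne (lo := q) (hi := π q) hgJ3 hgp'
          (Or.inl ⟨?_, h8, h9⟩) (V := V q) ?_).mono (by omega) ?_
        · rw [h8, h9]; exact hlt'
        · rw [hvar 4 (by norm_num) (by norm_num) (by norm_num),
            hvar 6 (by norm_num) (by norm_num) (by norm_num)]
          exact hV _ hlt'
        · rintro s' ⟨g1, g2, g3⟩
          refine ⟨g1, g2, fun A => ?_⟩
          rw [pending_succ hπ V hJ h0 h1 (Or.inl rfl) hlt', ← g3]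
          simp only [Matrix.conjTranspose_mul, mul_assoc]
          rfl
    · simp only [NExp.eval, hw8, hw9] at hc
      have hle : p' ≤ J := by
        by_contra hlt
        exact hc (Nat.pow_lt_pow_right (by norm_num) (not_le.mp hlt))
      refine (Reach.skip ⟨Frame.refl _ _, hH3, fun A => ?_⟩).mono (by omega) fun _ h => h
      rw [pending_succ_of_done hπ V hJ]
      -- Equal positions mean an idle qubit; an earlier position means that the gate was applied at
      -- the step of the partner.
      rcases hle.eq_or_lt with rfl | hlt
      · left; rw [← hq, ← hgp', ← hgJ3]
      · right
        have hp'l : p' < ql.length := by omega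
        rw [← hq, ← hgp', List.getElem_append_left hp'l]
        exact List.mem_take_iff_getElem.mpr ⟨p', by omega, rfl⟩
  rintro s4 ⟨f4, hH4, hA4⟩
  refine Reach.setVar ⟨?_, ?_, ?_, ext', hH4.setVar (by norm_num) _, hext', ?_⟩
  · intro x hx h1 h2
    rw [Mem.setVar_var, if_neg (by omega), f4.1 x (by omega), hvar x hx h1 h2]
  · rw [Mem.setVar_var, if_neg (by omega), f4.1 _ (by omega),
      hv3 _ (by norm_num) (by norm_num) (by norm_num)]
    simp [hs2, h10]
  · simp only [NExp.eval, Mem.setVar_var, if_true, f4.1 7 (by norm_num),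
      hv3 7 (by norm_num) (by norm_num) (by norm_num)]
    simp [hs2, h7]
  · intro A
    rw [hA A, ← hobs, hA4]
    rfl

theorem subProg_reach {I : Input} {s : Mem} {ql : List (Fin n)} (h : Holds ql s)
    {π : Fin n → Fin n} (hπ : ∀ q, π (π q) = q)
    (hI : ∀ q : Fin n, I.nat 5 (s.var 4) (s.var 6) q = π q)
    {V : Fin n → Matrix (Fin 2 × Fin 2) (Fin 2 × Fin 2) ℂ}
    (hU : ∀ q, (V q).conjTranspose * V q = 1)
    (hV : ∀ q, q < π q → ∀ a b c d : Fin 2,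
      I.cplx 5 (s.var 4) (s.var 6) q (b + 2 * a) (d + 2 * c) = V q (a, b) (c, d)) {kmax : ℕ}
    (hk : ∀ ql' : List (Fin n), ql'.Nodup → (∀ q ∈ ql', q ∈ ql ∨ π q ∈ ql) → ql'.length ≤ kmax) :
    Reach I subProg s (4 + (kmax + 1) * (63 + applyCost (pairExp gateEntry) kmax)) fun s' =>
      (∀ x, x < 7 → x ≠ 1 → x ≠ 2 → s'.var x = s.var x) ∧
        ∃ ql', Holds ql' s' ∧ (∀ q ∈ ql', q ∈ ql ∨ π q ∈ ql) ∧
          ∀ A, obs ql s (pairLayer π V * A * (pairLayer π V).conjTranspose) = obs ql' s' A := by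
  have hlen : ql.length ≤ kmax := hk ql h.nodup fun q hq => Or.inl hq
  refine Reach.mono (B := 2 + (2 + (ql.length + 1) * (1 + 1 + 1 +
    (60 + applyCost (pairExp gateEntry) kmax)))) ?_ ?_ fun _ h => h
  swap
  · have := Nat.mul_le_mul_right (1 + 1 + 1 + (60 + applyCost (pairExp gateEntry) kmax))
      (Nat.succ_le_succ hlen)
    have e : 1 + 1 + 1 + (60 + applyCost (pairExp gateEntry) kmax) =
      63 + applyCost (pairExp gateEntry) kmax := by omega
    rw [e] at this ⊢
    simp only [Nat.succ_eq_add_one] at this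
    omega
  refine Reach.seq (Reach.setVar (Q := (· = s.setVar 10 ql.length)) ?_) ?_
  · simp [NExp.eval, h.size]
  rintro _ rfl
  refine Reach.seq (Reach.setVar (Q := (· = (s.setVar 10 ql.length).setVar 7 0)) rfl) ?_
  rintro _ rfl
  refine (Reach.loop ql.length (SubInv π V ql s) ?_ ?_ ?_).mono le_rfl ?_
  · intro J s1 hJ hs1
    exact ⟨by simp [NExp.eval, hs1.2.1, hs1.2.2.1, hJ],
      subBody_reach h.nodup hπ hI hV hk hJ hs1⟩
  · intro s1 hs1
    simp [NExp.eval, hs1.2.1, hs1.2.2.1]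
  · refine ⟨?_, by simp, by simp, [], ?_, by simp, fun A => ?_⟩
    · intro x hx h1 h2
      simp [show x ≠ 7 by omega, show x ≠ 10 by omega]
    · simpa using (h.setVar (x := 10) (by norm_num) _).setVar (x := 7) (by norm_num) _
    · simp only [List.append_nil]
      rfl
  · rintro s' ⟨h1, -, -, ext, hH, hext, hA⟩
    rw [List.take_length] at hext
    refine ⟨h1, ql ++ ext, hH, ?_, fun A => ?_⟩
    · intro q hq
      rcases List.mem_append.mp hq with hq | hq
      · exact Or.inl hq
      · exact Or.inr (hext q hq)
    · rw [hA A]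
      -- The loop bound is the old length, so added qubits get no step. They need none: each is the
      -- partner of an original qubit, and every gate still pending avoids both the original and the
      -- added qubits.
      refine phi_pairLayer_of_trivial hπ ?_ ?_ A
      · intro q
        unfold pending
        split_ifs
        · simp
        · exact hU q
      · intro q hq
        by_cases hc : q ∈ ql ∨ π q ∈ ql
        · left; simp [pending, hc]
        · right
          push Not at hc
          intro w hw
          constructor
          · refine coef_eq_zero_of_mem hw fun hm => ?_
            rcases List.mem_append.mp hm with hm | hm
            · exact hc.1 hm
            · exact hc.2 (hext q hm)
          · refine coef_eq_zero_of_mem hw fun hm => ?_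
            rcases List.mem_append.mp hm with hm | hm
            · exact hc.2 hm
            · have := hext _ hm
              rw [hπ] at this
              exact hc.1 this

end

/-! ### The truncation depth and the initial observable -/

section

variable {D r m n L : ℕ}

/-- No logarithm is evaluated: `hl` characterizes the depth as the least `j` with `4 * c ^ j` below
the threshold, and the powers are generated by repeated multiplication. -/
theorem depthProg_reach {I : Input} {s : Mem} {ε δ c : ℝ} (h0 : s.var 0 = 0)
    (hε : I.cplx 0 0 0 0 0 0 = ε) (hδ : I.cplx 1 0 0 0 0 0 = δ) (hc : I.cplx 2 0 0 0 0 0 = c)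
    {l : ℕ} (hl : ∀ j, 4 * c ^ j ≤ δ * (ε * ε) ↔ l ≤ j) :
    Reach I depthProg s (11 + (l + 2) * 41) fun s' => s'.var 0 = l ∧
      (∀ x, x ≠ 0 → x ≠ 11 → s'.var x = s.var x) ∧ s'.arr = s.arr ∧
        ∀ a, a ≠ 3 → s'.carr a = s.carr a := by
  refine Reach.mono (B := 2 + ((1 + 7 + 1) + (l + 1 + 1) * (1 + 1 + 1 + ((2 + 20 + 1) +
    ((1 + 9 + 1) + (3 + 1)))))) ?_ (by omega) fun _ h => h
  refine Reach.seq (Reach.setVar (Q := (· = s.setVar 11 1)) rfl) ?_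
  rintro _ rfl
  refine Reach.seq (Reach.setCarr (Q := (· = (s.setVar 11 1).setCarr 3 0 4)) ?_) ?_
  · simp only [NExp.eval, CExp.eval]
    norm_num
  rintro _ rfl
  -- Variable `11` is the flag that keeps the loop running. After the `l` multiplications one
  -- further pass only clears it, hence the stages up to `l + 1`.
  refine (Reach.loop (l + 1) (fun j s' =>
    (if j ≤ l then s'.var 11 = 1 ∧ s'.var 0 = j ∧ s'.carr 3 0 = 4 * (c : ℂ) ^ j
      else s'.var 11 = 0 ∧ s'.var 0 = l) ∧ (∀ x, x ≠ 0 → x ≠ 11 → s'.var x = s.var x) ∧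
      s'.arr = s.arr ∧ ∀ a, a ≠ 3 → s'.carr a = s.carr a) ?_ ?_ ?_).mono le_rfl ?_
  · rintro j s1 hj ⟨h1, h2, h3, h4⟩
    rw [if_pos (by omega)] at h1
    obtain ⟨g1, g2, g3⟩ := h1
    refine ⟨by simp [NExp.eval, g1], ?_⟩
    have e1 : (s1.carr 3 0).re = 4 * c ^ j := by
      rw [g3]; norm_cast
    refine Reach.ifLe (fun hle => ?_) fun hle => ?_
    · simp only [CExp.eval, NExp.eval, hε, hδ, e1] at hle
      have : l ≤ j := by
        rw [← hl]
        exact_mod_cast hle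
      obtain rfl : j = l := by omega
      refine (Reach.setVar (Q := _) ?_).mono (by norm_num [NExp.cost]) fun _ h => h
      rw [if_neg (by omega)]
      refine ⟨⟨by simp [NExp.eval], by simpa using g2⟩, fun x hx hx' => ?_, h3, h4⟩
      simp [hx', h2 x hx hx']
    · simp only [CExp.eval, NExp.eval, hε, hδ, e1] at hle
      have : ¬ l ≤ j := by
        rw [← hl]
        exact_mod_cast hle
      refine Reach.seq (Reach.setCarr (Q := (· = s1.setCarr 3 0 (4 * (c : ℂ) ^ (j + 1)))) ?_) ?_
      · simp only [CExp.eval, NExp.eval, g3, hc, pow_succ, mul_assoc]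
      rintro _ rfl
      refine Reach.setVar ?_
      rw [if_pos (by omega)]
      refine ⟨⟨by simpa using g1, by simp [NExp.eval, g2], by simp⟩, fun x hx hx' => ?_, h3, ?_⟩
      · simp [hx, h2 x hx hx']
      · intro a ha
        rw [← h4 a ha]
        ext i
        simp [ha]
  · rintro s1 ⟨h1, -⟩
    rw [if_neg (by omega)] at h1
    simp [NExp.eval, h1.1]
  · rw [if_pos (by omega)]
    refine ⟨⟨by simp, by simpa using h0, by simp⟩, fun x hx hx' => by simp [hx'], rfl, ?_⟩
    intro a ha
    ext i
    simp [ha]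
  · rintro s' ⟨h1, h2, h3, h4⟩
    rw [if_neg (by omega)] at h1
    exact ⟨h1.2, h2, h3, h4⟩

theorem storePauli_reach (I : Input) (s : Mem) (u : Fin 4) :
    Reach I (storePauli u) s (storeCost ((List.finRange 4).map fun x : Fin 4 =>
      (.lit x, pauliExp u x))) fun s' => SameButCarr 2 s s' ∧
        ∀ x : Fin 4, s'.carr 2 x = pauliCoef u x := by
  refine (storeAll_reach I 2 s _ ?_ ?_ s ⟨rfl, rfl, fun _ _ => rfl⟩).mono le_rfl ?_
  · intro ie hie s' _
    obtain ⟨x, -, rfl⟩ := List.mem_map.mp hie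
    simp [eval_pauliExp, NExp.eval]
  · rw [List.map_map]
    refine (List.nodup_finRange 4).map fun x y h => ?_
    simpa [NExp.eval, Fin.ext_iff] using h
  · rintro s' ⟨h1, h2, -⟩
    refine ⟨h1, fun x => ?_⟩
    have := h2 _ (List.mem_map_of_mem (f := fun x : Fin 4 => (NExp.lit x, pauliExp u x))
      (List.mem_finRange x))
    simpa [NExp.eval, eval_pauliExp] using this

theorem loadPauli_reach {I : Input} {s : Mem} {u : Fin 4} (hI : I.nat 4 (s.var 8) 0 0 = u)
    (hu : u ≠ 0) : Reach I loadPauli s 100 fun s' => SameButCarr 2 s s' ∧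
      ∀ x : Fin 4, s'.carr 2 x = pauliCoef u x := by
  have hc : ∀ u : Fin 4, storeCost ((List.finRange 4).map fun x : Fin 4 =>
      (NExp.lit x, pauliExp u x)) ≤ 40 := by decide
  have hstore : ∀ u' : Fin 4, u = u' → Reach I (storePauli u') s 40 fun s' => SameButCarr 2 s s' ∧
      ∀ x : Fin 4, s'.carr 2 x = pauliCoef u x := by
    rintro _ rfl
    exact (storePauli_reach I s u).mono (hc u) fun _ h => h
  refine Reach.mono (B := 4 + 1 + 1 + (4 + 1 + 1 + 40)) ?_ (by omega) fun _ h => h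
  refine Reach.ifLt (fun h => ?_) fun h => ?_
  · refine (hstore 1 ?_).mono (by norm_num) fun _ h => h
    simp only [NExp.eval, hI] at h
    omega
  · refine Reach.ifLt (fun h' => ?_) fun h' => ?_
    · refine hstore 2 ?_
      simp only [NExp.eval, hI] at h h'
      omega
    · refine hstore 3 ?_
      simp only [NExp.eval, hI] at h h'
      omega

/-- The coefficients of the restriction of a Pauli to a list of qubits. -/
noncomputable def partialCoef (P : Fin n → Fin 4) (ql : List (Fin n)) (w : Fin n → Fin 4) : ℂ :=
  ∏ q, if q ∈ ql then pauliCoef (P q) (w q) else if w q = 0 then 1 else 0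

/-- A letter is inserted by a site map that ignores its input letter. This is correct because the
observable is the identity at `q` beforehand, so that only `u = 0` contributes. -/
theorem partialCoef_append (P : Fin n → Fin 4) {ql : List (Fin n)} {q : Fin n} (hq : q ∉ ql)
    (w : Fin n → Fin 4) :
    partialCoef P (ql ++ [q]) w =
      ∑ u, partialCoef P ql (Function.update w q u) * pauliCoef (P q) (w q) := by
  have h : ∀ u, partialCoef P ql (Function.update w q u) = (if u = 0 then 1 else 0) *
      ∏ z ∈ {q}ᶜ, if z ∈ ql then pauliCoef (P z) (w z) else if w z = 0 then 1 else 0 := by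
    intro u
    rw [partialCoef, Fintype.prod_eq_mul_prod_compl q, if_neg hq, Function.update_self]
    refine congrArg _ (Finset.prod_congr rfl fun z hz => ?_)
    rw [Function.update_of_ne (by simpa using hz)]
  simp only [h]
  rw [Finset.sum_eq_single 0]
  · rw [partialCoef, Fintype.prod_eq_mul_prod_compl q, if_pos (by simp), if_pos rfl, one_mul,
      mul_comm]
    congr 1
    refine Finset.prod_congr rfl fun z hz => ?_
    have hz' : z ≠ q := by simpa using hz
    simp [hz']
  · intro u _ hu
    simp [hu]
  · simp

/-- At stage `J` the array represents the restriction of `P` to the first `J` qubits of its support.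
-/
theorem initProg_reach {I : Input} {s : Mem} {P : Fin n → Fin 4} {ql : List (Fin n)}
    (hql : ql.Nodup) (hP : ∀ q, q ∈ ql ↔ P q ≠ 0) (h1 : s.var 1 = 0)
    (harr : ∀ a i, s.arr a i = 0) (hcarr : ∀ i, s.carr 0 i = 0)
    (hI2 : I.nat 2 0 0 0 = ql.length) (hI3 : ∀ p (hp : p < ql.length), I.nat 3 p 0 0 = ql[p])
    (hI4 : ∀ q : Fin n, I.nat 4 q 0 0 = P q) :
    Reach I initProg s (7 + (ql.length + 1) * (145 + applyCost (siteTable storedExp) ql.length))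
      fun s' => s'.var 0 = s.var 0 ∧ Holds ql s' ∧ ∀ A, (pauliOp P * A).trace = obs ql s' A := by
  refine Reach.mono (B := 2 + ((1 + 1 + 1) + (2 + (ql.length + 1) * (1 + 4 + 1 + ((4 + 1) + (23 +
    ((1 + 1) + (100 + ((5 + applyCost (siteTable storedExp) ql.length) + (3 + 1)))))))))) ?_ ?_
    fun _ h => h
  swap
  · have e : 1 + 4 + 1 + ((4 + 1) + (23 +
      ((1 + 1) + (100 + ((5 + applyCost (siteTable storedExp) ql.length) + (3 + 1)))))) =
      145 + applyCost (siteTable storedExp) ql.length := by omega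
    rw [e]
    omega
  refine Reach.seq (Reach.setVar (Q := (· = s.setVar 2 1)) rfl) ?_
  rintro _ rfl
  refine Reach.seq (Reach.setCarr (Q := (· = (s.setVar 2 1).setCarr 0 0 1)) rfl) ?_
  rintro _ rfl
  refine Reach.seq (Reach.setVar
    (Q := (· = ((s.setVar 2 1).setCarr 0 0 1).setVar 7 0)) rfl) ?_
  rintro _ rfl
  refine (Reach.loop ql.length (fun J s' => s'.var 0 = s.var 0 ∧ s'.var 7 = J ∧
    Holds (ql.take J) s' ∧ ∀ w, coef (s'.carr 0) (ql.take J) w = partialCoef P (ql.take J) w)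
    ?_ ?_ ?_).mono le_rfl ?_
  · rintro J s1 hJ ⟨g0, g7, gH, gc⟩
    refine ⟨by simp [NExp.eval, g7, hI2, hJ, expWeight], ?_⟩
    have hnot : ql[J] ∉ ql.take J := getElem_notMem_take hql hJ le_rfl
    have htake : ql.take (J + 1) = ql.take J ++ [ql[J]] := List.take_succ_eq_append_getElem hJ
    have hlen : (ql.take J).length = J := by simp; omega
    refine Reach.seq (Reach.setVar (Q := (· = s1.setVar 9 ql[J])) ?_) ?_
    · simp [NExp.eval, g7, hI3 J hJ]
    rintro _ rfl
    refine Reach.seq (addQubit_reach (gH.setVar (x := 9) (by norm_num) _) hnot (by simp)) ?_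
    rintro s2 ⟨a1, a2, a3⟩
    rw [← htake] at a1
    have b9 : s2.var 9 = ql[J] := by rw [a3 9 (by norm_num) (by norm_num)]; simp
    have b7 : s2.var 7 = J := by rw [a3 7 (by norm_num) (by norm_num)]; simpa using g7
    have b0 : s2.var 0 = s.var 0 := by rw [a3 0 (by norm_num) (by norm_num)]; simpa using g0
    refine Reach.seq (Reach.setVar (Q := (· = s2.setVar 8 ql[J])) ?_) ?_
    · simp [NExp.eval, b9]
    rintro _ rfl
    refine Reach.seq (loadPauli_reach (u := P ql[J]) ?_
      ((hP _).mp (List.getElem_mem hJ))) ?_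
    · simp [hI4]
    rintro s3 ⟨⟨c1, c2, c3⟩, c4⟩
    have hH3 : Holds (ql.take (J + 1)) s3 := by
      refine (a1.setVar (x := 8) (by norm_num) ql[J]).congr (by rw [c1]) (by rw [c1]) c2 ?_
      rw [c3 0 (by norm_num)]
      exact a1.vanish
    have hJt : J < (ql.take (J + 1)).length := by simp; omega
    have hget : (ql.take (J + 1))[J] = ql[J] := by simp
    have hlen' : (ql.take (J + 1)).length ≤ ql.length := by simp
    refine Reach.seq ((applySite_reach hH3 hJt (a := fun _ x => pauliCoef (P ql[J]) x) ?_ ?_).mono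
      (Nat.add_le_add_left (applyCost_mono _ hlen') _) fun _ h => h) ?_
    · rw [hget, c1]; simp
    · intro s' hs' x u
      simp only [storedExp, CExp.eval, NExp.eval, hs'.2.2 2 le_rfl, c4]
    rintro s4 ⟨d1, d2, d3⟩
    refine Reach.setVar ⟨?_, ?_, d2.setVar (by norm_num) _, ?_⟩
    · rw [Mem.setVar_var, if_neg (by norm_num), d1.1 0 (by norm_num), c1]
      simpa using b0
    · simp [NExp.eval, d1.1 7, c1, b7]
    · intro w
      rw [Mem.setVar_carr, d3 w]
      simp only [hget]
      rw [htake, partialCoef_append P hnot]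
      refine Finset.sum_congr rfl fun u _ => ?_
      have : s3.carr 0 = s1.carr 0 := by rw [c3 0 (by norm_num)]; exact congrFun a2 0
      rw [this, coef_append gH.vanish hnot, gc]
  · rintro s1 ⟨-, g7, -⟩
    simp [NExp.eval, g7, hI2, expWeight]
  · refine ⟨by simp, by simp, ⟨?_, ?_, ?_, ?_, ?_, ?_, ?_⟩, ?_⟩
    · simp
    · simp [h1]
    · simp
    · intro p hp; simp at hp
    · intro p hp; simp at hp
    · intro q _; simp [harr]
    · intro i hi
      have : i ≠ 0 := by simp at hi; omega
      simp [this, hcarr]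
    · intro w
      simp only [List.take_zero, coef, List.not_mem_nil, not_false_eq_true, true_imp_iff,
        partialCoef, if_false]
      by_cases hw : ∀ q, w q = 0
      · simp [hw, idx]
      · rw [if_neg hw]
        push Not at hw
        obtain ⟨q, hq⟩ := hw
        exact (Finset.prod_eq_zero (Finset.mem_univ q) (if_neg hq)).symm
  · rintro s' ⟨g0, -, gH, gc⟩
    rw [List.take_length] at gH gc
    refine ⟨g0, gH, fun A => ?_⟩
    rw [trace_pauliOp_mul, obs]
    congr 1
    funext w
    rw [gc, partialCoef]
    refine Finset.prod_congr rfl fun q _ => ?_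
    by_cases hq : q ∈ ql
    · rw [if_pos hq]
    · rw [if_neg hq]
      have : P q = 0 := by
        by_contra h
        exact hq ((hP q).mpr h)
      rw [this]
      generalize w q = u
      fin_cases u <;> simp [pauliCoef]

end

/-! ### Noisy layers, the light cone and the whole program -/

section

variable {D r m n L : ℕ}

/-- The matrix of the gate with smaller qubit `q`. -/
def gateMat (arch : Architecture D r m n L) (ω : arch.Sample) (i : Fin L) (s : Fin m) (q : Fin n) :
    Matrix (Fin 2 × Fin 2) (Fin 2 × Fin 2) ℂ :=
  if h : q < arch.partner i s q then (ω.1 ⟨(i, s, q), h⟩).1 else 1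

theorem sublayerUnitary_eq (arch : Architecture D r m n L) (ω : arch.Sample) (i : Fin L)
    (s : Fin m) :
    sublayerUnitary arch ω i s = pairLayer (arch.partner i s) (gateMat arch ω i s) := by
  ext x y
  simp only [sublayerUnitary, pairLayer, Matrix.of_apply]
  refine Finset.prod_congr rfl fun q _ => ?_
  by_cases h : q < arch.partner i s q
  · rw [dif_pos h, if_pos h, gateMat, dif_pos h]
  · rw [dif_neg h, if_neg h]

theorem conjTranspose_mul_self_gate {κ : Type} [Fintype κ] [DecidableEq κ] (U : Gate κ) :
    U.1.conjTranspose * U.1 = 1 := (Matrix.mem_unitaryGroup_iff').mp U.2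

theorem gateMat_unitary (arch : Architecture D r m n L) (ω : arch.Sample) (i : Fin L)
    (s : Fin m) (q : Fin n) : (gateMat arch ω i s q).conjTranspose * gateMat arch ω i s q = 1 := by
  unfold gateMat
  split_ifs
  · exact conjTranspose_mul_self_gate _
  · simp

/-- The qubit `q` is at distance at most `R` from the support of `P`. -/
def Near (arch : Architecture D r m n L) (P : Fin n → Fin 4) (R : ℕ) (q : Fin n) : Prop :=
  ∃ q₀, P q₀ ≠ 0 ∧ ∀ k, |arch.pos q k - arch.pos q₀ k| ≤ (R : ℤ)

theorem Near.mono {arch : Architecture D r m n L} {P : Fin n → Fin 4} {R R' : ℕ} {q : Fin n}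
    (h : Near arch P R q) (hR : R ≤ R') : Near arch P R' q := by
  obtain ⟨q₀, h0, h1⟩ := h
  exact ⟨q₀, h0, fun k => (h1 k).trans (by exact_mod_cast hR)⟩

theorem Near.partner {arch : Architecture D r m n L} {P : Fin n → Fin 4} {R : ℕ} {q : Fin n}
    {i : Fin L} {s : Fin m} (h : Near arch P R (arch.partner i s q)) : Near arch P (R + r) q := by
  obtain ⟨q₀, h0, h1⟩ := h
  refine ⟨q₀, h0, fun k => ?_⟩
  have h2 := arch.range_le i s q k
  have h3 := h1 k
  rw [abs_le] at *
  push_cast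
  constructor <;> linarith

/-- A bound for the cost of a noisy layer. -/
def layerCost (m k : ℕ) : ℕ :=
  4 + (k + 1) * (15 + applyCost (siteTable (siteExp noiseEntry)) k) +
    (m + 1) * (23 + (k + 1) * (63 + applyCost (pairExp gateEntry) k))

section encode

variable (arch : Architecture D r m n L) (N : Op1 →ₗ[ℂ] Op1) (ω : arch.Sample)
  (P : Fin n → Fin 4) (ε δ c : ℝ)

theorem encode_partner (i : Fin L) (s : Fin m) (q : Fin n) :
    (encode arch N ω P ε δ c).nat 5 i s q = arch.partner i s q := by
  simp [encode]

/-- `finProdFinEquiv` numbers the pair `(a, b)` by `b + 2 * a`, the index that `gateEntry` uses. -/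
theorem encode_gate (i : Fin L) (s : Fin m) (q : Fin n) (hq : q < arch.partner i s q)
    (a b a' b' : Fin 2) :
    (encode arch N ω P ε δ c).cplx 5 i s q (b + 2 * a) (b' + 2 * a') =
      gateMat arch ω i s q (a, b) (a', b') := by
  have e : ∀ (a b : Fin 2) (h : (b : ℕ) + 2 * a < 4),
      (finProdFinEquiv.symm (⟨b + 2 * a, h⟩ : Fin (2 * 2))) = (a, b) := by
    intro a b h
    rw [Equiv.symm_apply_eq]
    rfl
  have h : ((i : ℕ) < L ∧ (s : ℕ) < m ∧ (q : ℕ) < n) ∧ (b : ℕ) + 2 * a < 4 ∧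
      (b' : ℕ) + 2 * a' < 4 := ⟨⟨i.2, s.2, q.2⟩, by omega, by omega⟩
  simp only [encode, dif_pos h]
  rw [dif_pos hq, e, e, gateMat, dif_pos hq]

theorem encode_noise (a b a' b' : Fin 2) (k : ℕ) :
    (encode arch N ω P ε δ c).cplx 4 a b a' b' k = N (Matrix.single a' b' 1) a b := by
  have h : ((a : ℕ) < 2 ∧ (b : ℕ) < 2) ∧ (a' : ℕ) < 2 ∧ (b' : ℕ) < 2 :=
    ⟨⟨a.2, b.2⟩, a'.2, b'.2⟩
  simp only [encode, dif_pos h]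

theorem encode_final (q : Fin n) (a b : Fin 2) (j k : ℕ) :
    (encode arch N ω P ε δ c).cplx 3 q a b j k = (ω.2 q).1 a b := by
  have h : (q : ℕ) < n ∧ (a : ℕ) < 2 ∧ (b : ℕ) < 2 := ⟨q.2, a.2, b.2⟩
  simp only [encode, dif_pos h]

variable {N}

/-- The product of the first `j` sublayers of a layer. -/
noncomputable def firstSub (i : Fin L) (j : ℕ) : Op n :=
  (((List.finRange m).take j).map (sublayerUnitary arch ω i)).reverse.prod

theorem firstSub_succ (i : Fin L) {j : ℕ} (hj : j < m) :
    firstSub arch ω i (j + 1) = sublayerUnitary arch ω i ⟨j, hj⟩ * firstSub arch ω i j := by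
  unfold firstSub
  rw [List.take_succ_eq_append_getElem (by simpa using hj)]
  simp

/-- Backwards, the noise of a layer comes first and then its sublayers from the last to the first,
each adding `r` to the radius. As `kmax` bounds all lists within the final radius, one cost bound
serves every step. -/
theorem layerProg_reach (hN : IsChannel N) {s : Mem} {ql : List (Fin n)} (h : Holds ql s)
    {i : Fin L} (h4 : s.var 4 = i) {R kmax : ℕ} (hR : ∀ q ∈ ql, Near arch P R q)
    (hk : ∀ ql' : List (Fin n), ql'.Nodup → (∀ q ∈ ql', Near arch P (R + m * r) q) →
      ql'.length ≤ kmax) :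
    Reach (encode arch N ω P ε δ c) layerProg s (layerCost m kmax) fun s' =>
      (∀ x, x < 4 → x ≠ 1 → x ≠ 2 → s'.var x = s.var x) ∧
        ∃ ql', Holds ql' s' ∧ (∀ q ∈ ql', Near arch P (R + m * r) q) ∧
          ∀ A, obs ql s (noisyLayer arch N ω A i) = obs ql' s' A := by
  have hlen : ql.length ≤ kmax := hk ql h.nodup fun q hq => (hR q hq).mono (by omega)
  refine Reach.mono (B := (2 + (kmax + 1) * (15 + applyCost (siteTable (siteExp noiseEntry)) kmax))
    + (2 + (m + 1) * (1 + 4 + 1 + (8 + 1 +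
      ((4 + (kmax + 1) * (63 + applyCost (pairExp gateEntry) kmax)) + (3 + 1)))))) ?_ ?_
    fun _ h => h
  swap
  · unfold layerCost
    have := Nat.mul_le_mul_left (m + 1) (show 1 + 4 + 1 + (8 + 1 +
      ((4 + (kmax + 1) * (63 + applyCost (pairExp gateEntry) kmax)) + (3 + 1))) ≤
      23 + (kmax + 1) * (63 + applyCost (pairExp gateEntry) kmax) by omega)
    omega
  refine Reach.seq ((siteLoop_reach h (N := fun _ => N)
    (a := fun _ => siteDual fun c d a b => N (Matrix.single a b 1) c d)
    (fun _ => isDualMatrix_siteDual N) (fun _ => hN.tracePreserving) ?_).mono ?_ fun _ h => h) ?_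
  · intro s' q _ _ x u
    rw [eval_siteExp]
    congr 1
    funext c' d a b
    simp only [noiseEntry, CExp.eval, NExp.eval]
    exact encode_noise arch N ω P ε δ c c' d a b 0
  · exact Nat.add_le_add_left (Nat.mul_le_mul (Nat.succ_le_succ hlen)
      (Nat.add_le_add_left (applyCost_mono _ hlen) _)) _
  rintro s1 ⟨f1, hH1, hA1⟩
  refine Reach.seq (Reach.setVar (Q := (· = s1.setVar 5 0)) rfl) ?_
  rintro _ rfl
  -- After `J` steps the last `J` sublayers have been absorbed and the product `firstSub` of the
  -- first `m - J` is left.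
  refine (Reach.loop m (fun J s' => (∀ x, x < 5 → x ≠ 1 → x ≠ 2 → s'.var x = s.var x) ∧
    s'.var 5 = J ∧ ∃ ql', Holds ql' s' ∧ (∀ q ∈ ql', Near arch P (R + J * r) q) ∧
      ∀ A, obs ql s (noisyLayer arch N ω A i) =
        obs ql' s' (firstSub arch ω i (m - J) * A * (firstSub arch ω i (m - J)).conjTranspose))
    ?_ ?_ ?_).mono le_rfl ?_
  · rintro J s2 hJ ⟨hv, h5, ql', hH, hnear, hA⟩
    refine ⟨by simp [NExp.eval, h5, expM, encode, hJ], ?_⟩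
    have hj : m - 1 - J < m := by omega
    refine Reach.seq (Reach.setVar (Q := (· = s2.setVar 6 (m - 1 - J))) ?_) ?_
    · simp [NExp.eval, h5, expM, encode]
    rintro _ rfl
    have v4 : (s2.setVar 6 (m - 1 - J)).var 4 = i := by simp [hv, h4]
    have v6 : (s2.setVar 6 (m - 1 - J)).var 6 = (⟨m - 1 - J, hj⟩ : Fin m) := by simp
    have hgrow : ∀ q, (q ∈ ql' ∨ arch.partner i ⟨m - 1 - J, hj⟩ q ∈ ql') →
        Near arch P (R + (J + 1) * r) q := by
      rintro q (hq | hq)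
      · exact (hnear q hq).mono (by rw [add_mul]; omega)
      · have := (hnear _ hq).partner
        exact this.mono (by rw [add_mul]; omega)
    refine Reach.seq (subProg_reach (hH.setVar (x := 6) (by norm_num) _) (kmax := kmax)
      (arch.partner_partner i ⟨m - 1 - J, hj⟩) ?_ (gateMat_unitary arch ω i ⟨m - 1 - J, hj⟩)
      ?_ ?_) ?_
    · intro q
      rw [v4, v6, encode_partner]
    · intro q hq a b c' d
      rw [v4, v6, encode_gate arch N ω P ε δ c i _ q hq]
    · intro ql'' hnd hsub
      refine hk ql'' hnd fun q hq => (hgrow q (hsub q hq)).mono ?_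
      have := Nat.mul_le_mul_right r (show J + 1 ≤ m by omega)
      omega
    rintro s3 ⟨g1, ql'', g2, g3, g4⟩
    refine Reach.setVar ⟨?_, ?_, ql'', g2.setVar (by norm_num) _, fun q hq => hgrow q (g3 q hq), ?_⟩
    · intro x hx h1 h2
      rw [Mem.setVar_var, if_neg (by omega), g1 x (by omega) h1 h2, Mem.setVar_var,
        if_neg (by omega), hv x hx h1 h2]
    · simp [NExp.eval, g1 5, h5]
    · intro A
      have e : m - J = (m - 1 - J) + 1 := by omega
      have e' : m - (J + 1) = m - 1 - J := by omega
      rw [hA A, e', e, firstSub_succ arch ω i hj, sublayerUnitary_eq]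
      have := g4 (firstSub arch ω i (m - 1 - J) * A * (firstSub arch ω i (m - 1 - J)).conjTranspose)
      simp only [Matrix.conjTranspose_mul, mul_assoc] at this ⊢
      exact this
  · rintro s' ⟨-, h5, -⟩
    simp [NExp.eval, h5, expM, encode]
  · refine ⟨?_, by simp, ql, hH1.setVar (by norm_num) _, by simpa using hR, fun A => ?_⟩
    · intro x hx h1 h2
      rw [Mem.setVar_var, if_neg (by omega), f1.1 x (by omega)]
    · rw [noisyLayer, tensorChannel_eq, hA1]
      have : layerUnitary arch ω i = firstSub arch ω i (m - 0) := by
        rw [layerUnitary, firstSub, Nat.sub_zero, List.take_of_length_le (by simp)]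
      rw [this]
      rfl
  · rintro s' ⟨hv, -, ql', hH, hnear, hA⟩
    refine ⟨fun x hx => hv x (by omega), ql', hH, hnear, fun A => ?_⟩
    rw [hA]
    simp [firstSub]

theorem drop_finRange_succ {t : ℕ} (ht : t < L) :
    (List.finRange L).drop (L - (t + 1)) =
      ⟨L - 1 - t, by omega⟩ :: (List.finRange L).drop (L - t) := by
  rw [List.drop_eq_getElem_cons (by simp; omega)]
  congr 1
  · ext
    simp
    omega
  · congr 1
    omega

/-- At stage `t` the last `t` layers have been absorbed and the support lies within distance `t * (m
* r)` of that of `P`. The depth may exceed `L`; the surplus rounds are skipped by the test of the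
program. -/
theorem layersProg_reach (hN : IsChannel N) {s : Mem} {ql : List (Fin n)} (h : Holds ql s)
    {l : ℕ} (h0 : s.var 0 = l) {kmax : ℕ} (hR : ∀ q ∈ ql, Near arch P 0 q)
    (hk : ∀ ql' : List (Fin n), ql'.Nodup → (∀ q ∈ ql', Near arch P (l * (m * r)) q) →
      ql'.length ≤ kmax) :
    Reach (encode arch N ω P ε δ c) layersProg s (2 + (l + 1) * (22 + layerCost m kmax)) fun s' =>
        ∃ ql', Holds ql' s' ∧
          ∀ A, obs ql s (((List.finRange L).drop (L - l)).foldl (noisyLayer arch N ω) A) =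
            obs ql' s' A := by
  refine Reach.mono (B := 2 + (l + 1) * (1 + 1 + 1 + ((1 + 4 + 1 + (9 + layerCost m kmax))
    + (3 + 1)))) ?_ ?_ fun _ h => h
  swap
  · exact Nat.add_le_add_left (Nat.mul_le_mul_left _ (by omega)) _
  refine Reach.seq (Reach.setVar (Q := (· = s.setVar 3 0)) rfl) ?_
  rintro _ rfl
  refine (Reach.loop l (fun t s' => s'.var 0 = l ∧ s'.var 3 = t ∧ ∃ ql', Holds ql' s' ∧
    (∀ q ∈ ql', Near arch P (t * (m * r)) q) ∧
      ∀ A, obs ql s (((List.finRange L).drop (L - t)).foldl (noisyLayer arch N ω) A) =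
        obs ql' s' A) ?_ ?_ ?_).mono le_rfl ?_
  · rintro t s1 ht ⟨g0, g3, ql', hH, hnear, hA⟩
    refine ⟨by simp [NExp.eval, g0, g3, ht], ?_⟩
    have hrad : t * (m * r) + m * r ≤ l * (m * r) := by
      rw [← Nat.succ_mul]; exact Nat.mul_le_mul_right _ ht
    refine Reach.seq (R := fun s' => s'.var 0 = l ∧ s'.var 3 = t ∧ ∃ ql', Holds ql' s' ∧
      (∀ q ∈ ql', Near arch P ((t + 1) * (m * r)) q) ∧
      ∀ A, obs ql s (((List.finRange L).drop (L - (t + 1))).foldl (noisyLayer arch N ω) A) =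
        obs ql' s' A) ?_ ?_
    · refine Reach.ifLt (fun hc => ?_) fun hc => ?_
      · have htL : t < L := by simpa [NExp.eval, g3, expL, encode] using hc
        refine Reach.mono (B := (8 + 1) + layerCost m kmax) ?_ le_rfl fun _ h => h
        refine Reach.seq (Reach.setVar (Q := (· = s1.setVar 4 (L - 1 - t))) ?_) ?_
        · simp [NExp.eval, g3, expL, encode]
        rintro _ rfl
        refine (layerProg_reach arch ω P ε δ c hN (hH.setVar (x := 4) (by norm_num) _)
          (i := ⟨L - 1 - t, by omega⟩) (by simp) hnear (kmax := kmax) ?_).mono le_rfl ?_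
        · intro ql'' hnd hsub
          exact hk ql'' hnd fun q hq => (hsub q hq).mono hrad
        · rintro s2 ⟨a1, ql'', a2, a3, a4⟩
          refine ⟨?_, ?_, ql'', a2, ?_, fun A => ?_⟩
          · rw [a1 0 (by norm_num) (by norm_num) (by norm_num)]; simpa using g0
          · rw [a1 3 (by norm_num) (by norm_num) (by norm_num)]; simpa using g3
          · rw [Nat.succ_mul]; exact a3
          · rw [drop_finRange_succ htL, List.foldl_cons, hA]
            exact a4 A
      · have htL : ¬ t < L := by simpa [NExp.eval, g3, expL, encode] using hc
        refine (Reach.skip ⟨g0, g3, ql', hH, fun q hq => (hnear q hq).mono ?_, fun A => ?_⟩).mono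
          (by omega) fun _ h => h
        · exact Nat.mul_le_mul_right _ (by omega)
        -- With `t ≥ L` both truncated differences are zero.
        · rw [show L - (t + 1) = L - t by omega]; exact hA A
    · rintro s2 ⟨b0, b3, ql'', bH, bn, bA⟩
      refine Reach.setVar ⟨by simpa using b0, by simp [NExp.eval, b3], ql'',
        bH.setVar (by norm_num) _, bn, bA⟩
  · rintro s' ⟨g0, g3, -⟩
    simp [NExp.eval, g0, g3]
  · refine ⟨by simpa using h0, by simp, ql, h.setVar (by norm_num) _, by simpa using hR,
      fun A => ?_⟩
    rw [List.drop_of_length_le (by simp)]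
    rfl
  · rintro s' ⟨-, -, ql', hH, -, hA⟩
    exact ⟨ql', hH, hA⟩

/-- A bound for the cost of the program. -/
def totalCost (m l k : ℕ) : ℕ :=
  11 + (l + 2) * 41 + (7 + (k + 1) * (145 + applyCost (siteTable storedExp) k)) +
    (2 + (k + 1) * (15 + applyCost (siteTable (siteExp finalEntry)) k)) +
    (2 + (l + 1) * (22 + layerCost m k))

theorem mainProg_reach (hN : IsChannel N) {l : ℕ}
    (hl : ∀ j, 4 * c ^ j ≤ δ * (ε * ε) ↔ l ≤ j) {kmax : ℕ}
    (hk : ∀ ql' : List (Fin n), ql'.Nodup → (∀ q ∈ ql', Near arch P (l * (m * r)) q) →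
      ql'.length ≤ kmax) :
    Reach (encode arch N ω P ε δ c) mainProg Mem.init (totalCost m l kmax) fun s' =>
      s'.carr 0 0 = (pauliOp P * lastLayers arch N ω l (zeroState n)).trace := by
  have hmem : ∀ q, q ∈ suppList P ↔ P q ≠ 0 := by simp [suppList]
  have hnd : (suppList P).Nodup := (List.nodup_finRange n).filter _
  have hnear : ∀ q ∈ suppList P, Near arch P 0 q :=
    fun q hq => ⟨q, (hmem q).mp hq, by simp⟩
  have hlen : (suppList P).length ≤ kmax :=
    hk _ hnd fun q hq => (hnear q hq).mono (Nat.zero_le _)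
  have hcost := fun T => applyCost_mono T hlen
  refine Reach.mono (B := (11 + (l + 2) * 41) + ((7 + (kmax + 1) * (145 + applyCost
    (siteTable storedExp) kmax)) + ((2 + (kmax + 1) * (15 + applyCost (siteTable
    (siteExp finalEntry)) kmax)) + (2 + (l + 1) * (22 + layerCost m kmax))))) ?_
    (by unfold totalCost; omega) fun _ h => h
  refine Reach.seq (depthProg_reach (by simp [Mem.init]) (by simp [encode])
    (by simp [encode]) (by simp [encode]) hl) ?_
  rintro s1 ⟨a1, a2, a3, a4⟩
  refine Reach.seq ((initProg_reach (P := P) hnd hmem ?_ ?_ ?_ ?_ ?_ ?_).mono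
    (Nat.add_le_add_left (Nat.mul_le_mul (Nat.succ_le_succ hlen)
      (Nat.add_le_add_left (hcost _) _)) _) fun _ h => h) ?_
  · rw [a2 1 (by norm_num) (by norm_num)]; rfl
  · intro a i; rw [a3]; rfl
  · intro i; rw [a4 0 (by norm_num)]; rfl
  · simp [encode, weight]
  · intro p hp
    simp [encode, hp]
  · intro q
    simp [encode]
  rintro s2 ⟨b1, b2, b3⟩
  refine Reach.seq ((siteLoop_reach b2 (N := fun q => conjMap (ω.2 q).1)
    (a := fun q => siteDual fun c d a b => conjMap (ω.2 q).1 (Matrix.single a b 1) c d)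
    (fun q => isDualMatrix_siteDual _) ?_ ?_).mono
    (Nat.add_le_add_left (Nat.mul_le_mul (Nat.succ_le_succ hlen)
      (Nat.add_le_add_left (hcost _) _)) _) fun _ h => h) ?_
  · intro q X
    rw [conjMap_apply, mul_assoc, Matrix.trace_mul_comm, mul_assoc, conjTranspose_mul_self_gate,
      mul_one]
  · intro s' q _ h8 x u
    rw [eval_siteExp]
    congr 1
    funext c' d a b
    simp only [finalEntry, CExp.eval, NExp.eval, h8]
    have e := encode_final arch N ω P ε δ c q
    have e1 := e c' a 0 0
    have e2 := e d b 0 0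
    rw [e1, e2, conjMap_apply, conj_apply_eq, Finset.sum_eq_single a, Finset.sum_eq_single b]
    · simp
    · intro z _ hz; simp [hz.symm]
    · simp
    · intro z _ hz; simp [hz.symm]
    · simp
  rintro s3 ⟨c1, c2, c3⟩
  refine (layersProg_reach arch ω P ε δ c hN c2 (l := l) ?_ hnear hk).mono le_rfl ?_
  · rw [c1.1 0 (by norm_num), b1, a1]
  · rintro s4 ⟨ql', -, d2⟩
    have e : singleLayer arch ω = prodOp fun q => (ω.2 q).1 := rfl
    -- Everything has been moved to the observable; on the initial state it evaluates to the
    -- coefficient of the identity, which is cell `0`.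
    rw [lastLayers, e, conj_prodOp, b3, c3, d2, obs, phi_zeroState, coef_zero]

end encode

end

section

/-! ### The running time -/

/-- Logarithms of both sides, with `log c⁻¹ > 0`. The natural-number ceiling includes the maximum
with `0`. -/
theorem pow_depth_le_iff {c ε δ : ℝ} (hc : 0 < c) (hc1 : c < 1) (hε : 0 < ε) (hδ : 0 < δ) (j : ℕ) :
    4 * c ^ j ≤ δ * (ε * ε) ↔
      ⌈1 / Real.log c⁻¹ * Real.log (4 / (δ * ε ^ 2))⌉₊ ≤ j := by
  have hlog : 0 < Real.log c⁻¹ := Real.log_pos ((one_lt_inv₀ hc).mpr hc1)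
  have hpos : 0 < δ * ε ^ 2 := by positivity
  rw [Nat.ceil_le, one_div, inv_mul_le_iff₀ hlog, Real.log_inv, ← sq]
  rw [Real.log_div (by norm_num) hpos.ne']
  rw [← Real.log_le_log_iff (by positivity) hpos, Real.log_mul (by norm_num) (by positivity),
    Real.log_pow]
  constructor <;> intro h <;> linarith

section count

variable {D r m n L : ℕ} (arch : Architecture D r m n L)

/-- The qubits sit at distinct sites, so they inject into the lattice points of a box of side `2 * R
+ 1`. -/
theorem card_box_le (p : Fin D → ℤ) (R : ℕ) (S : Finset (Fin n))
    (hS : ∀ q ∈ S, ∀ k, |arch.pos q k - p k| ≤ (R : ℤ)) : S.card ≤ (2 * R + 1) ^ D := by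
  have h := Finset.card_le_card_of_injOn (t := Fintype.piFinset fun k => Finset.Icc (p k - R) (p k + R))
    arch.pos (fun q hq => by
      rw [Finset.mem_coe, Fintype.mem_piFinset]
      intro k
      have := abs_le.mp (hS q hq k)
      rw [Finset.mem_Icc]
      constructor <;> linarith) (arch.pos_injective.injOn (s := (S : Set (Fin n))))
  refine h.trans (le_of_eq ?_)
  rw [Fintype.card_piFinset]
  have : ∀ k, (Finset.Icc (p k - R) (p k + R)).card = 2 * R + 1 := fun k => by
    rw [Int.card_Icc]; omega
  simp [this]

theorem mem_suppList {P : Fin n → Fin 4} {q : Fin n} : q ∈ suppList P ↔ P q ≠ 0 := by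
  simp [suppList]

theorem length_near_le (P : Fin n → Fin 4) (R : ℕ) {ql : List (Fin n)} (hnd : ql.Nodup)
    (h : ∀ q ∈ ql, Near arch P R q) : ql.length ≤ weight P * (2 * R + 1) ^ D := by
  classical
  rw [← List.toFinset_card_of_nodup hnd]
  have hsub : ql.toFinset ⊆ (suppList P).toFinset.biUnion fun q₀ =>
      ql.toFinset.filter fun q => ∀ k, |arch.pos q k - arch.pos q₀ k| ≤ (R : ℤ) := by
    intro q hq
    obtain ⟨q₀, h0, h1⟩ := h q (List.mem_toFinset.mp hq)
    rw [Finset.mem_biUnion]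
    exact ⟨q₀, List.mem_toFinset.mpr (mem_suppList.mpr h0), Finset.mem_filter.mpr ⟨hq, h1⟩⟩
  refine (Finset.card_le_card hsub).trans ((Finset.card_biUnion_le_card_mul _ _ _
    fun q₀ _ => card_box_le arch (arch.pos q₀) R _ fun q hq => (Finset.mem_filter.mp hq).2).trans ?_)
  exact Nat.mul_le_mul_right _ (List.toFinset_card_le _)

/-- Instead of one box for each qubit of the support, a single box around one of them contains the
whole light cone. -/
theorem length_near_le_of_isLocalPauli {A : ℕ} {P : Fin n → Fin 4} (hP : IsLocalPauli arch A P)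
    (R : ℕ) {ql : List (Fin n)} (hnd : ql.Nodup) (h : ∀ q ∈ ql, Near arch P R q) :
    ql.length ≤ (2 * (A * weight P + R) + 1) ^ D := by
  classical
  rcases ql with _ | ⟨q₁, ql⟩
  · exact Nat.zero_le _
  obtain ⟨q₀, h0, -⟩ := h q₁ List.mem_cons_self
  rw [← List.toFinset_card_of_nodup hnd]
  refine card_box_le arch (arch.pos q₀) _ _ fun q hq k => ?_
  obtain ⟨q₂, h2, h3⟩ := h q (List.mem_toFinset.mp hq)
  have e := hP q₂ q₀ h2 h0 k
  have e' := abs_add_le (arch.pos q k - arch.pos q₂ k) (arch.pos q₂ k - arch.pos q₀ k)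
  rw [sub_add_sub_cancel] at e'
  have := h3 k
  push_cast at *
  linarith

end count

theorem mul_applyCost_le (T : Fin 4 → Fin 4 → Fin 4 → Fin 4 → CExp) (a k : ℕ) :
    (k + 1) * (a + applyCost T k) ≤ (a + 2 * (136 + blockCost T)) * ((k + 1) ^ 2 * 4 ^ k) := by
  have h1 : 1 ≤ 4 ^ k := Nat.one_le_pow _ _ (by norm_num)
  have h2 : applyCost T k ≤ 2 * (136 + blockCost T) * ((k + 1) * 4 ^ k) := by
    unfold applyCost
    calc (4 ^ k + 1) * (36 * k + blockCost T + 100)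
        ≤ (2 * 4 ^ k) * ((136 + blockCost T) * (k + 1)) :=
          Nat.mul_le_mul (by omega) (by nlinarith)
      _ = _ := by ring
  have h3 : a ≤ a * ((k + 1) * 4 ^ k) := Nat.le_mul_of_pos_right _ (by positivity)
  calc (k + 1) * (a + applyCost T k)
      ≤ (k + 1) * (a * ((k + 1) * 4 ^ k) + 2 * (136 + blockCost T) * ((k + 1) * 4 ^ k)) :=
        Nat.mul_le_mul_left _ (by omega)
    _ = _ := by ring

/-- The factors come from the nested loops: layers, sublayers, listed qubits, and array cells with
their digit extraction. The block costs are constants of the fixed program. -/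
theorem exists_totalCost_le : ∃ C : ℕ, ∀ m l k : ℕ,
    totalCost m l k ≤ C * ((l + 1) * ((m + 1) * ((k + 1) ^ 2 * 4 ^ k))) := by
  set b₁ := 15 + 2 * (136 + blockCost (siteTable (siteExp noiseEntry))) with hb₁
  set b₂ := 63 + 2 * (136 + blockCost (pairExp gateEntry)) with hb₂
  set b₃ := 145 + 2 * (136 + blockCost (siteTable storedExp)) with hb₃
  set b₄ := 15 + 2 * (136 + blockCost (siteTable (siteExp finalEntry))) with hb₄
  refine ⟨200 + b₁ + b₂ + b₃ + b₄, fun m l k => ?_⟩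
  set Y := (k + 1) ^ 2 * 4 ^ k with hY
  have hY1 : 1 ≤ Y := Nat.one_le_iff_ne_zero.mpr (by positivity)
  have e1 := mul_applyCost_le (siteTable (siteExp noiseEntry)) 15 k
  have e2 := mul_applyCost_le (pairExp gateEntry) 63 k
  have e3 := mul_applyCost_le (siteTable storedExp) 145 k
  have e4 := mul_applyCost_le (siteTable (siteExp finalEntry)) 15 k
  rw [← hY, ← hb₁] at e1
  rw [← hY, ← hb₂] at e2
  rw [← hY, ← hb₃] at e3
  rw [← hY, ← hb₄] at e4
  clear_value b₁ b₂ b₃ b₄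
  clear hb₁ hb₂ hb₃ hb₄
  have hlayer : layerCost m k ≤ (27 + b₁ + b₂) * ((m + 1) * Y) := by
    unfold layerCost
    have h1 : (m + 1) * (23 + (k + 1) * (63 + applyCost (pairExp gateEntry) k)) ≤
        (m + 1) * (23 * Y + b₂ * Y) := Nat.mul_le_mul_left _ (by omega)
    have h2 : 4 + b₁ * Y ≤ (4 + b₁) * ((m + 1) * Y) := by
      have : Y ≤ (m + 1) * Y := Nat.le_mul_of_pos_left _ (by omega)
      calc 4 + b₁ * Y ≤ (4 + b₁) * Y := by rw [add_mul]; omega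
        _ ≤ _ := Nat.mul_le_mul_left _ this
    calc _ ≤ (4 + b₁) * ((m + 1) * Y) + (m + 1) * (23 * Y + b₂ * Y) := by omega
      _ = _ := by ring
  set Z := (m + 1) * Y with hZ
  have hYZ : Y ≤ Z := Nat.le_mul_of_pos_left _ (by omega)
  have hW : Z ≤ (l + 1) * Z := Nat.le_mul_of_pos_left _ (by omega)
  have hl : l + 1 ≤ (l + 1) * Z := Nat.le_mul_of_pos_right _ (by omega)
  have h1 : (l + 1) * (22 + layerCost m k) ≤ (49 + b₁ + b₂) * ((l + 1) * Z) := by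
    calc _ ≤ (l + 1) * (22 * Z + (27 + b₁ + b₂) * Z) := Nat.mul_le_mul_left _ (by omega)
      _ = _ := by ring
  have h3 : b₃ * Y ≤ b₃ * ((l + 1) * Z) := Nat.mul_le_mul_left _ (hYZ.trans hW)
  have h4 : b₄ * Y ≤ b₄ * ((l + 1) * Z) := Nat.mul_le_mul_left _ (hYZ.trans hW)
  have h5 : 22 + (l + 2) * 41 ≤ 104 * ((l + 1) * Z) := by omega
  unfold totalCost
  have : (200 + b₁ + b₂ + b₃ + b₄) * ((l + 1) * Z) = 47 * ((l + 1) * Z) + 104 * ((l + 1) * Z) +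
    (49 + b₁ + b₂) * ((l + 1) * Z) + b₃ * ((l + 1) * Z) + b₄ * ((l + 1) * Z) := by ring
  rw [this]
  omega

theorem exists_totalCost_le_exp : ∃ C : ℝ, 0 ≤ C ∧ ∀ m l k : ℕ,
    (totalCost m l k : ℝ) ≤ Real.exp (C + m + l + 4 * k) := by
  obtain ⟨C, hC⟩ := exists_totalCost_le
  refine ⟨C, by positivity, fun m l k => ?_⟩
  have e : ∀ x : ℕ, ((x : ℝ) + 1) ≤ Real.exp x := fun x => Real.add_one_le_exp _
  have h4 : (4 : ℝ) ^ k ≤ Real.exp (2 * k) := by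
    rw [mul_comm, Real.exp_nat_mul]
    refine pow_le_pow_left₀ (by norm_num) ?_ k
    -- At `x = 2` the bound reads `exp 2 ≥ 1 + 2 + 2`, which exceeds `4`.
    have := Real.quadratic_le_exp_of_nonneg (x := 2) (by norm_num)
    linarith
  calc (totalCost m l k : ℝ)
      ≤ ((C * ((l + 1) * ((m + 1) * ((k + 1) ^ 2 * 4 ^ k))) : ℕ) : ℝ) := by exact_mod_cast hC m l k
    _ ≤ Real.exp C * (Real.exp l * (Real.exp m * (Real.exp k ^ 2 * Real.exp (2 * k)))) := by
        push_cast
        gcongr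
        · linarith [e C]
        · exact e l
        · exact e m
        · exact e k
    _ = Real.exp (C + m + l + 4 * k) := by
        rw [← Real.exp_nat_mul, ← Real.exp_add, ← Real.exp_add, ← Real.exp_add, ← Real.exp_add]
        congr 1
        push_cast
        ring

/-- The three bounds of the running time. -/
theorem exists_runtime_bounds (D r m A : ℕ) (η : ℝ) (hD : 1 ≤ D) (hη : η < 1) : ∃ K : ℝ,
    ∀ (n L : ℕ) (arch : Architecture D r m n L) (P : Fin n → Fin 4) (c ε δ : ℝ), 0 < c → c < 1 →
      0 < ε → 0 < δ → ∀ l : ℕ, l = ⌈1 / Real.log c⁻¹ * Real.log (4 / (δ * ε ^ 2))⌉₊ →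
      ∃ k : ℕ, (∀ ql : List (Fin n), ql.Nodup → (∀ q ∈ ql, Near arch P (l * (m * r)) q) →
          ql.length ≤ k) ∧
        (totalCost m l k : ℝ) ≤ Real.exp (K * (((weight P : ℝ) + 1) * ((l : ℝ) + 1) ^ D)) ∧
        (1 ≤ weight P → IsLocalPauli arch A P →
          (totalCost m l k : ℝ) ≤ Real.exp (K * ((weight P : ℝ) + l) ^ D) ∧
          (ε ^ 2 * δ ≤ η → (totalCost m l k : ℝ) ≤ Real.exp (K *
            ((weight P : ℝ) + 1 / Real.log c⁻¹ * Real.log (1 / (ε ^ 2 * δ))) ^ D))) := by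
  obtain ⟨C, hC0, hC⟩ := exists_totalCost_le_exp
  -- The ratio that absorbs `log 4`: if `ε² * δ ≤ η` then `log 4 ≤ a * log (1 / (ε² * δ))`. The
  -- absolute value keeps it nonnegative when `η ≤ 0` as well, where the last bound is vacuous.
  set a : ℝ := |Real.log 4 / Real.log η⁻¹| with ha
  set K₁ : ℝ := C + m + 1 + 4 * (2 * (m * r) + 1) ^ D with hK₁
  set K₂ : ℝ := C + m + 1 + 4 * (2 * A + 2 * (m * r) + 1) ^ D with hK₂
  have hK₁0 : 0 ≤ K₁ := by positivity
  have hK₂0 : 0 ≤ K₂ := by positivity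
  have hK₃0 : 0 ≤ K₂ * (2 + a) ^ D := by positivity
  -- One nonnegative summand for each of the three bounds.
  refine ⟨K₁ + K₂ + K₂ * (2 + a) ^ D, ?_⟩
  intro n L arch P c ε δ hc hc1 hε hδ l hl
  have h1 : ∀ ql : List (Fin n), ql.Nodup → (∀ q ∈ ql, Near arch P (l * (m * r)) q) →
      ql.length ≤ weight P * (2 * (l * (m * r)) + 1) ^ D :=
    fun ql hnd h => length_near_le arch P _ hnd h
  have hDl : ∀ x : ℝ, 1 ≤ x → x ≤ x ^ D := fun x hx => le_self_pow₀ hx (by omega)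
  have bound1 : ∀ k : ℕ, k ≤ weight P * (2 * (l * (m * r)) + 1) ^ D →
      C + m + l + 4 * k ≤ K₁ * (((weight P : ℝ) + 1) * ((l : ℝ) + 1) ^ D) := by
    intro k hk
    have hk' : (k : ℝ) ≤ weight P * (2 * (l * (m * r)) + 1) ^ D := by exact_mod_cast hk
    have h2 : (2 * ((l : ℝ) * (m * r)) + 1) ^ D ≤ (2 * (m * r) + 1) ^ D * ((l : ℝ) + 1) ^ D := by
      rw [← mul_pow]
      refine pow_le_pow_left₀ (by positivity) ?_ D
      have h0 : (0 : ℝ) ≤ m * r := by positivity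
      have h0' : (0 : ℝ) ≤ l := by positivity
      nlinarith
    have h3 : (l : ℝ) + 1 ≤ ((l : ℝ) + 1) ^ D := hDl _ (by linarith [Nat.cast_nonneg (α := ℝ) l])
    set X := ((l : ℝ) + 1) ^ D
    set w := (weight P : ℝ)
    have hw : 0 ≤ w := Nat.cast_nonneg _
    have hl0 : (0 : ℝ) ≤ l := Nat.cast_nonneg _
    have h4 : X ≤ (w + 1) * X := by nlinarith
    have h5 : (k : ℝ) ≤ (2 * (m * r) + 1) ^ D * ((w + 1) * X) := by
      calc (k : ℝ) ≤ w * ((2 * (m * r) + 1) ^ D * X) := hk'.trans (by gcongr)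
        _ ≤ (w + 1) * ((2 * (m * r) + 1) ^ D * X) := by gcongr; linarith
        _ = _ := by ring
    have h6 : C + m ≤ (C + m) * ((w + 1) * X) := le_mul_of_one_le_right (by positivity) (by linarith)
    rw [hK₁, add_mul, add_mul, mul_assoc 4]
    linarith
  -- The same `k` must serve all bounds, so the box count is used only if `P` is local and
  -- nontrivial; then the minimum of both counts is taken.
  by_cases hP : 1 ≤ weight P ∧ IsLocalPauli arch A P
  swap
  · refine ⟨_, h1, (hC m l _).trans (Real.exp_le_exp.mpr ((bound1 _ le_rfl).trans ?_)),
      fun h2 h3 => absurd ⟨h2, h3⟩ hP⟩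
    gcongr
    linarith
  obtain ⟨hw1, hloc⟩ := hP
  refine ⟨min (weight P * (2 * (l * (m * r)) + 1) ^ D)
    ((2 * (A * weight P + l * (m * r)) + 1) ^ D), fun ql hnd h => le_min (h1 ql hnd h)
      (length_near_le_of_isLocalPauli arch hloc _ hnd h),
      (hC m l _).trans (Real.exp_le_exp.mpr ((bound1 _ (min_le_left _ _)).trans ?_)), fun _ _ => ?_⟩
  · gcongr
    linarith
  set k := min (weight P * (2 * (l * (m * r)) + 1) ^ D)
    ((2 * (A * weight P + l * (m * r)) + 1) ^ D) with hk
  have hk' : (k : ℝ) ≤ (2 * (A * weight P + l * (m * r)) + 1) ^ D := by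
    exact_mod_cast min_le_right _ _
  have hw : (1 : ℝ) ≤ weight P := by exact_mod_cast hw1
  have hl0 : (0 : ℝ) ≤ l := Nat.cast_nonneg _
  have bound2 : C + m + l + 4 * k ≤ K₂ * ((weight P : ℝ) + l) ^ D := by
    set w := (weight P : ℝ)
    have h2 : (2 * (A * w + (l : ℝ) * (m * r)) + 1) ^ D ≤
        (2 * A + 2 * (m * r) + 1) ^ D * (w + l) ^ D := by
      rw [← mul_pow]
      refine pow_le_pow_left₀ (by positivity) ?_ D
      have h0 : (0 : ℝ) ≤ m * r := by positivity
      have h0' : (0 : ℝ) ≤ A := by positivity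
      nlinarith [mul_nonneg h0 hl0, mul_nonneg h0' hl0, mul_nonneg h0 (by linarith : 0 ≤ w)]
    have h3 : w + l ≤ (w + l) ^ D := hDl _ (by linarith)
    set X := (w + l) ^ D
    have h6 : C + m ≤ (C + m) * X := le_mul_of_one_le_right (by positivity) (by linarith)
    rw [hK₂, add_mul, add_mul, mul_assoc 4]
    linarith
  refine ⟨(hC m l _).trans (Real.exp_le_exp.mpr (bound2.trans ?_)), fun hεη =>
    (hC m l _).trans (Real.exp_le_exp.mpr (bound2.trans ?_))⟩
  · gcongr
    linarith
  have hη0 : 0 < η := lt_of_lt_of_le (by positivity) hεη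
  have hlogη : 0 < Real.log η⁻¹ := Real.log_pos ((one_lt_inv₀ hη0).mpr hη)
  have hlogc : 0 < Real.log c⁻¹ := Real.log_pos ((one_lt_inv₀ hc).mpr hc1)
  have ha0 : 0 ≤ a := abs_nonneg _
  have ha' : Real.log 4 = a * Real.log η⁻¹ := by
    rw [ha, abs_of_nonneg (div_nonneg (Real.log_nonneg (by norm_num)) hlogη.le),
      div_mul_cancel₀ _ hlogη.ne']
  set y := Real.log (1 / (ε ^ 2 * δ)) with hy
  have hyη : Real.log η⁻¹ ≤ y := by
    rw [hy, one_div]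
    exact Real.log_le_log (by positivity) (inv_anti₀ (by positivity) hεη)
  have hlog4 : Real.log 4 ≤ a * y := ha'.trans_le (by gcongr)
  have hsplit : Real.log (4 / (δ * ε ^ 2)) = Real.log 4 + y := by
    rw [hy, ← Real.log_mul (by norm_num) (by positivity)]
    congr 1
    field_simp
  set x := 1 / Real.log c⁻¹ * y with hx
  have hx0 : 0 ≤ x := mul_nonneg (by positivity) (hlogη.le.trans hyη)
  -- The final `1` pays for the ceiling; it is absorbed below by `weight P ≥ 1`, whence the factor
  -- `2 + a`.
  have hlx : (l : ℝ) ≤ (1 + a) * x + 1 := by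
    have hle : 1 / Real.log c⁻¹ * Real.log (4 / (δ * ε ^ 2)) ≤ (1 + a) * x := by
      rw [hsplit, hx]
      calc 1 / Real.log c⁻¹ * (Real.log 4 + y) ≤ 1 / Real.log c⁻¹ * (a * y + y) := by gcongr
        _ = _ := by ring
    rw [hl]
    exact (Nat.cast_le.mpr (Nat.ceil_mono hle)).trans (Nat.ceil_lt_add_one (by positivity)).le
  have hfin : ((weight P : ℝ) + l) ^ D ≤ (2 + a) ^ D * ((weight P : ℝ) + x) ^ D := by
    rw [← mul_pow]
    refine pow_le_pow_left₀ (by positivity) ?_ D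
    nlinarith
  calc K₂ * ((weight P : ℝ) + l) ^ D ≤ K₂ * ((2 + a) ^ D * ((weight P : ℝ) + x) ^ D) := by gcongr
    _ = (K₂ * (2 + a) ^ D) * ((weight P : ℝ) + x) ^ D := by ring
    _ ≤ _ := by gcongr; linarith

end

section

set_option linter.unusedSectionVars false

/-! ### Pauli bases -/

section PauliBasis

variable {ι B : Type} [Fintype ι] [DecidableEq ι] [Fintype B] [Zero B]

/-- A complete family of Hermitian unitaries, containing the identity, such that any two different
members are told apart by the signs they get from the conjugation by a third one. -/
structure IsPauliBasis (σ : B → Matrix ι ι ℂ) : Prop where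
  zero : σ 0 = 1
  herm : ∀ b, (σ b).conjTranspose = σ b
  sq : ∀ b, σ b * σ b = 1
  expand : ∀ (X : Matrix ι ι ℂ) i j, ∑ b, (σ b * X).trace * σ b i j = Fintype.card ι * X i j
  twist : ∀ b b', b ≠ b' → ∃ (g : B) (s s' : ℝ), σ g * σ b * σ g = (s : ℂ) • σ b ∧
    σ g * σ b' * σ g = (s' : ℂ) • σ b' ∧ s * s' = -1

/-- The matrix, in the family `σ`, of the conjugation by `V`. -/
noncomputable def transfer (σ : B → Matrix ι ι ℂ) (V : Matrix ι ι ℂ) (a b : B) : ℝ :=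
  (σ a * (V * σ b * V.conjTranspose)).trace.re / Fintype.card ι

variable {σ : B → Matrix ι ι ℂ} (hσ : IsPauliBasis σ) {V : Matrix ι ι ℂ}

theorem transfer_conjTranspose (V : Matrix ι ι ℂ) (a b : B) :
    transfer σ V.conjTranspose a b = transfer σ V b a := by
  unfold transfer
  congr 2
  rw [Matrix.conjTranspose_conjTranspose, Matrix.trace_mul_comm]
  simp only [mul_assoc]
  rw [Matrix.trace_mul_comm]
  simp only [mul_assoc]

theorem trace_mul_mul_of_herm {X Y : Matrix ι ι ℂ} (hX : X.conjTranspose = X)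
    (hY : Y.conjTranspose = Y) : (X * Y).trace = ((X * Y).trace.re : ℂ) := by
  have h : star (X * Y).trace = (X * Y).trace := by
    rw [← Matrix.trace_conjTranspose, Matrix.conjTranspose_mul, hX, hY, Matrix.trace_mul_comm]
  exact (Complex.conj_eq_iff_re.mp h).symm

theorem IsPauliBasis.trace_conj [Nonempty ι] (hσ : IsPauliBasis σ) (a b : B) (V : Matrix ι ι ℂ) :
    (σ a * (V * σ b * V.conjTranspose)).trace = (Fintype.card ι : ℂ) * (transfer σ V a b : ℂ) := by
  rw [trace_mul_mul_of_herm (hσ.herm a) (by simp [Matrix.conjTranspose_mul, hσ.herm, mul_assoc]),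
    transfer]
  have : (Fintype.card ι : ℂ) ≠ 0 := by exact_mod_cast Fintype.card_ne_zero
  push_cast
  field_simp

theorem IsPauliBasis.trace_conj_eq_sum [Nonempty ι] (hσ : IsPauliBasis σ) (V X : Matrix ι ι ℂ)
    (a : B) : (σ a * (V * X * V.conjTranspose)).trace =
      ∑ b, (transfer σ V a b : ℂ) * (σ b * X).trace := by
  have hne : (Fintype.card ι : ℂ) ≠ 0 := by exact_mod_cast Fintype.card_ne_zero
  have hX : (Fintype.card ι : ℂ) • X = ∑ b, (σ b * X).trace • σ b := by
    ext i j
    rw [Matrix.smul_apply, smul_eq_mul, ← hσ.expand X i j, Matrix.sum_apply]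
    simp
  refine mul_left_cancel₀ hne ?_
  calc _ = (σ a * (V * ((Fintype.card ι : ℂ) • X) * V.conjTranspose)).trace := by simp
    _ = ∑ b, (σ b * X).trace * (σ a * (V * σ b * V.conjTranspose)).trace := by
      rw [hX]
      simp [Finset.mul_sum, Finset.sum_mul, Matrix.trace_sum]
    _ = _ := by
      rw [Finset.mul_sum]
      exact Finset.sum_congr rfl fun b _ => by rw [hσ.trace_conj]; ring

/-- The rows have norm one: these are the coordinates of `V† σ_a V`, an operator whose square is the
identity. -/
theorem IsPauliBasis.sum_transfer_sq [Nonempty ι] (hσ : IsPauliBasis σ)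
    (hV : V.conjTranspose * V = 1) (a : B) : ∑ b, transfer σ V a b ^ 2 = 1 := by
  have hne : (Fintype.card ι : ℂ) ≠ 0 := by exact_mod_cast Fintype.card_ne_zero
  have hV' : V * V.conjTranspose = 1 := mul_eq_one_comm.mp hV
  have h := hσ.trace_conj_eq_sum V (V.conjTranspose * σ a * V) a
  have e1 : V * (V.conjTranspose * σ a * V) * V.conjTranspose = σ a := by
    calc _ = (V * V.conjTranspose) * σ a * (V * V.conjTranspose) := by simp only [mul_assoc]
      _ = σ a := by rw [hV', one_mul, mul_one]
  have e2 : ∀ b, (σ b * (V.conjTranspose * σ a * V)).trace =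
      Fintype.card ι * (transfer σ V a b : ℂ) := by
    intro b
    have := hσ.trace_conj b a V.conjTranspose
    rwa [Matrix.conjTranspose_conjTranspose, transfer_conjTranspose] at this
  rw [e1, hσ.sq, Matrix.trace_one] at h
  simp only [e2] at h
  have h' : (Fintype.card ι : ℂ) * 1 = Fintype.card ι * ∑ b, (transfer σ V a b : ℂ) ^ 2 := by
    rw [mul_one, Finset.mul_sum]
    exact h.trans (Finset.sum_congr rfl fun b _ => by ring)
  have := mul_left_cancel₀ hne h'
  exact_mod_cast this.symm

/-- Conjugating both factors by the twisting element keeps the trace of the product but multiplies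
it by `s * s' = -1`. -/
theorem IsPauliBasis.trace_mul_eq_zero (hσ : IsPauliBasis σ) {a b : B} (h : a ≠ b) :
    (σ a * σ b).trace = 0 := by
  obtain ⟨g, s, s', h1, h2, h3⟩ := hσ.twist a b h
  have e : (σ g * σ a * σ g * (σ g * σ b * σ g)).trace = (σ a * σ b).trace := by
    calc _ = (σ g * (σ a * (σ g * σ g) * σ b * σ g)).trace := by simp only [mul_assoc]
      _ = _ := by
        rw [hσ.sq, mul_one, Matrix.trace_mul_comm]
        simp only [mul_assoc, hσ.sq, mul_one]
  rw [h1, h2] at e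
  have h3' : (s : ℂ) * s' = -1 := by exact_mod_cast h3
  simp only [Matrix.smul_mul, Matrix.mul_smul, Matrix.trace_smul, smul_eq_mul] at e
  rw [← mul_assoc, mul_comm (s' : ℂ), h3'] at e
  linear_combination (-1 / 2 : ℂ) * e

theorem IsPauliBasis.transfer_zero_right [DecidableEq B] [Nonempty ι] (hσ : IsPauliBasis σ)
    (hV : V.conjTranspose * V = 1) (a : B) : transfer σ V a 0 = if a = 0 then 1 else 0 := by
  have hV' : V * V.conjTranspose = 1 := mul_eq_one_comm.mp hV
  rw [transfer, hσ.zero, mul_one, hV', ← hσ.zero]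
  split_ifs with h
  · subst h
    rw [hσ.zero, mul_one, Matrix.trace_one]
    simp
  · rw [hσ.trace_mul_eq_zero h]
    simp

end PauliBasis

/-! ### The Pauli bases of one and two qubits -/

/-- The sign of `σ_g σ_b σ_g = ± σ_b`. -/
def pauliSign (g b : Fin 4) : ℤ := if g = 0 ∨ b = 0 ∨ g = b then 1 else -1

theorem pauli_twist (g b : Fin 4) :
    pauli g * pauli b * pauli g = ((pauliSign g b : ℝ) : ℂ) • pauli b := by
  fin_cases g <;> fin_cases b <;> ext i j <;> fin_cases i <;> fin_cases j <;>
    simp [pauli, pauliSign, Matrix.mul_apply]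

theorem exists_pauliSign_mul (b b' : Fin 4) (h : b ≠ b') :
    ∃ g, pauliSign g b * pauliSign g b' = -1 := by
  revert b b'
  decide

theorem isPauliBasis_pauli : IsPauliBasis pauli where
  zero := rfl
  herm b := by
    fin_cases b <;> ext i j <;> fin_cases i <;> fin_cases j <;> simp [pauli]
  sq b := by
    fin_cases b <;> ext i j <;> fin_cases i <;> fin_cases j <;> simp [pauli, Matrix.mul_apply]
  expand X i j := by
    fin_cases i <;> fin_cases j <;>
      simp [pauli, Matrix.mul_apply, Matrix.trace, Fin.sum_univ_four] <;>
      ring_nf <;> simp only [Complex.I_sq] <;> ring_nf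
  twist b b' h := by
    obtain ⟨g, hg⟩ := exists_pauliSign_mul b b' h
    exact ⟨g, _, _, pauli_twist g b, pauli_twist g b', by exact_mod_cast hg⟩

/-- The Pauli operators of two qubits. -/
noncomputable def pauli2 (b : Fin 4 × Fin 4) : Matrix (Fin 2 × Fin 2) (Fin 2 × Fin 2) ℂ :=
  pauli b.1 ⊗ₖ pauli b.2

theorem trace_kronecker_mul (A B : Op1) (X : Matrix (Fin 2 × Fin 2) (Fin 2 × Fin 2) ℂ) :
    ((A ⊗ₖ B) * X).trace =
      (B * Matrix.of fun q p => (A * Matrix.of fun q' p' => X (q', q) (p', p)).trace).trace := by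
  simp only [Matrix.trace, Matrix.diag, Matrix.mul_apply, Matrix.kroneckerMap_apply,
    Matrix.of_apply, Fintype.sum_prod_type, Fin.sum_univ_two]
  ring

theorem isPauliBasis_pauli2 : IsPauliBasis pauli2 where
  zero := by
    change pauli 0 ⊗ₖ pauli 0 = 1
    rw [isPauliBasis_pauli.zero, Matrix.one_kronecker_one]
  herm b := by
    rw [pauli2, Matrix.conjTranspose_kronecker, isPauliBasis_pauli.herm, isPauliBasis_pauli.herm]
  sq b := by
    rw [pauli2, ← Matrix.mul_kronecker_mul, isPauliBasis_pauli.sq, isPauliBasis_pauli.sq,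
      Matrix.one_kronecker_one]
  expand X i j := by
    have h : ∀ a, ∑ b, ((pauli a ⊗ₖ pauli b) * X).trace * (pauli a i.1 j.1 * pauli b i.2 j.2) =
        2 * ((pauli a * Matrix.of fun q' p' => X (q', i.2) (p', j.2)).trace * pauli a i.1 j.1) := by
      intro a
      have := isPauliBasis_pauli.expand
        (Matrix.of fun q p => (pauli a * Matrix.of fun q' p' => X (q', q) (p', p)).trace) i.2 j.2
      simp only [trace_kronecker_mul]
      calc _ = (∑ b, (pauli b * Matrix.of fun q p =>
            (pauli a * Matrix.of fun q' p' => X (q', q) (p', p)).trace).trace * pauli b i.2 j.2) *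
            pauli a i.1 j.1 := by
            rw [Finset.sum_mul]
            exact Finset.sum_congr rfl fun b _ => by ring
        _ = _ := by
          rw [this]
          simp
          ring
    have h2 := isPauliBasis_pauli.expand (Matrix.of fun q' p' => X (q', i.2) (p', j.2)) i.1 j.1
    rw [Fintype.sum_prod_type]
    simp only [pauli2, Matrix.kroneckerMap_apply, h]
    rw [← Finset.mul_sum, h2]
    simp
    ring
  twist b b' h := by
    have key : ∀ g b : Fin 4 × Fin 4, pauli2 g * pauli2 b * pauli2 g =
        (((pauliSign g.1 b.1 * pauliSign g.2 b.2 : ℤ) : ℝ) : ℂ) • pauli2 b := by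
      intro g b
      rw [pauli2, pauli2, ← Matrix.mul_kronecker_mul, ← Matrix.mul_kronecker_mul, pauli_twist,
        pauli_twist, Matrix.smul_kronecker, Matrix.kronecker_smul, smul_smul]
      push_cast
      rfl
    have h0 : ∀ c, pauliSign 0 c = 1 := by decide
    -- The twist acts on a tensor factor where the two Paulis differ and is the identity on the
    -- other.
    by_cases h1 : b.1 = b'.1
    · have h2 : b.2 ≠ b'.2 := fun h2 => h (Prod.ext h1 h2)
      obtain ⟨g, hg⟩ := exists_pauliSign_mul _ _ h2
      refine ⟨(0, g), _, _, key _ b, key _ b', ?_⟩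
      simp only [h0, one_mul]
      exact_mod_cast hg
    · obtain ⟨g, hg⟩ := exists_pauliSign_mul _ _ h1
      refine ⟨(g, 0), _, _, key _ b, key _ b', ?_⟩
      simp only [h0, mul_one]
      exact_mod_cast hg

/-- A unitary that permutes the letters `X, Y, Z` cyclically. -/
noncomputable def cyclicGate : Gate (Fin 2) :=
  ⟨!![(1 - Complex.I) / 2, (-1 - Complex.I) / 2; (1 - Complex.I) / 2, (1 + Complex.I) / 2], by
    rw [Matrix.mem_unitaryGroup_iff]
    ext i j
    have h2 : (starRingEnd ℂ) 2 = 2 := map_ofNat _ 2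
    fin_cases i <;> fin_cases j <;> simp [Matrix.mul_apply, Matrix.star_apply, h2] <;> ring_nf <;>
      simp [Complex.I_sq] <;> norm_num⟩

theorem cyclicGate_conj (b : Fin 4) : cyclicGate.1 * pauli b * cyclicGate.1.conjTranspose =
    pauli (![0, 2, 3, 1] b) := by
  have h2 : (starRingEnd ℂ) 2 = 2 := map_ofNat _ 2
  fin_cases b <;> ext i j <;> fin_cases i <;> fin_cases j <;>
    simp [pauli, cyclicGate, Matrix.mul_apply, h2] <;> ring_nf <;> simp [Complex.I_sq] <;> ring_nf

/-- Powers of the cyclic unitary are transitive on `X, Y, Z`. Hence Haar second moments see of a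
Pauli only which of its letters are the identity. -/
theorem exists_gate_conj_pauli (b b' : Fin 4) (h : b = 0 ↔ b' = 0) :
    ∃ W : Gate (Fin 2), W.1 * pauli b * W.1.conjTranspose = pauli b' := by
  have h2 : ∀ b, (cyclicGate * cyclicGate).1 * pauli b * (cyclicGate * cyclicGate).1.conjTranspose =
      pauli (![0, 2, 3, 1] (![0, 2, 3, 1] b)) := by
    intro b
    rw [← cyclicGate_conj, ← cyclicGate_conj]
    simp [Matrix.conjTranspose_mul, mul_assoc]
  have h3 : b' = b ∨ b' = ![0, 2, 3, 1] b ∨ b' = ![0, 2, 3, 1] (![0, 2, 3, 1] b) := by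
    revert b b'
    decide
  rcases h3 with rfl | rfl | rfl
  · exact ⟨1, by simp⟩
  · exact ⟨_, cyclicGate_conj b⟩
  · exact ⟨_, h2 b⟩

theorem exists_gate_conj_pauli2 (b b' : Fin 4 × Fin 4) (h : b.1 = 0 ↔ b'.1 = 0)
    (h' : b.2 = 0 ↔ b'.2 = 0) : ∃ W : Gate (Fin 2 × Fin 2),
      W.1 * pauli2 b * W.1.conjTranspose = pauli2 b' := by
  obtain ⟨W, hW⟩ := exists_gate_conj_pauli _ _ h
  obtain ⟨W', hW'⟩ := exists_gate_conj_pauli _ _ h'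
  refine ⟨⟨W.1 ⊗ₖ W'.1, Matrix.kronecker_mem_unitary W.2 W'.2⟩, ?_⟩
  simp only [pauli2, Matrix.conjTranspose_kronecker, ← Matrix.mul_kronecker_mul, hW, hW']

/-! ### Second moments of unitary two-designs -/

section Haar

variable {ι : Type} [Fintype ι] [DecidableEq ι]

instance haarGate_isProbabilityMeasure : IsProbabilityMeasure (haarGate ι) :=
  ⟨Measure.haarMeasure_self⟩

instance haarGate_isHaarMeasure : (haarGate ι).IsHaarMeasure := by
  unfold haarGate; infer_instance

/-- A right translate of the Haar probability measure is again one, and it is unique. -/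
instance haarGate_isMulRightInvariant : (haarGate ι).IsMulRightInvariant where
  map_mul_right_eq_self g := by
    have : IsProbabilityMeasure (Measure.map (· * g) (haarGate ι)) :=
      Measure.isProbabilityMeasure_map (measurable_mul_const g).aemeasurable
    exact Measure.isHaarMeasure_eq_of_isProbabilityMeasure _ _

end Haar

end

/-! ### Second moments of transfer matrices under a two-design -/

section

set_option linter.unusedSectionVars false

section Moments

variable {ι B : Type} [Fintype ι] [DecidableEq ι] [Fintype B] [Zero B] {σ : B → Matrix ι ι ℂ}

theorem integrable_of_continuous_gate {E : Type} [NormedAddCommGroup E] {ν : Measure (Gate ι)}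
    [IsFiniteMeasure ν] {f : Gate ι → E} (hf : Continuous f) : Integrable f ν :=
  hf.integrable_of_hasCompactSupport (HasCompactSupport.of_compactSpace f)

theorem continuous_gate_entry (x y : ι) : Continuous fun V : Gate ι => V.1 x y :=
  (continuous_apply y).comp ((continuous_apply x).comp continuous_subtype_val)

theorem continuous_transfer (a b : B) : Continuous fun V : Gate ι => transfer σ V.1 a b := by
  unfold transfer
  have h : Continuous fun V : Gate ι => V.1 := continuous_subtype_val
  fun_prop

theorem continuous_doubled_entry (O : Matrix (ι × ι) (ι × ι) ℂ) (x y : ι × ι) :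
    Continuous fun V : Gate ι => ((V.1 ⊗ₖ V.1) * O * (V.1 ⊗ₖ V.1).conjTranspose) x y := by
  simp only [conj_apply_eq, Matrix.kroneckerMap_apply]
  have h := fun x y => continuous_gate_entry (ι := ι) x y
  exact continuous_finsetSum _ fun a _ => continuous_finsetSum _ fun b _ =>
    (((h _ _).mul (h _ _)).mul (continuous_star.comp ((h _ _).mul (h _ _)))).mul continuous_const

theorem integral_sum_sum_mul {κ : Type} [Fintype κ] (ν : Measure (Gate ι)) [IsFiniteMeasure ν]
    (c : κ → κ → ℂ) (f : κ → κ → Gate ι → ℂ) (hf : ∀ x y, Continuous (f x y)) :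
    ∫ V, ∑ x, ∑ y, c x y * f x y V ∂ν = ∑ x, ∑ y, c x y * ∫ V, f x y V ∂ν := by
  have h : ∀ x y, Continuous fun V => c x y * f x y V := fun x y => continuous_const.mul (hf x y)
  refine (integral_finsetSum _ fun x _ => integrable_of_continuous_gate
    (continuous_finsetSum _ fun y _ => h x y)).trans (Finset.sum_congr rfl fun x _ => ?_)
  refine (integral_finsetSum _ fun y _ => integrable_of_continuous_gate (h x y)).trans ?_
  exact Finset.sum_congr rfl fun y _ => integral_const_mul _ _

/-- A product of two entries is a linear functional of `(V ⊗ V) (σ b ⊗ σ b') (V ⊗ V)†`, whose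
expectation is what the two-design property fixes. -/
theorem transfer_mul_transfer [Nonempty ι] (hσ : IsPauliBasis σ) (V : Matrix ι ι ℂ)
    (a b a' b' : B) : ((transfer σ V a b * transfer σ V a' b' : ℝ) : ℂ) =
      ∑ x, ∑ y, ((Fintype.card ι : ℂ)⁻¹ ^ 2 * (σ a ⊗ₖ σ a') x y) *
        ((V ⊗ₖ V) * (σ b ⊗ₖ σ b') * (V ⊗ₖ V).conjTranspose) y x := by
  have hne : (Fintype.card ι : ℂ) ≠ 0 := by exact_mod_cast Fintype.card_ne_zero
  have h1 := hσ.trace_conj a b V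
  have h2 := hσ.trace_conj a' b' V
  have h3 : ((σ a ⊗ₖ σ a') * ((V ⊗ₖ V) * (σ b ⊗ₖ σ b') * (V ⊗ₖ V).conjTranspose)).trace =
      (Fintype.card ι * (transfer σ V a b : ℂ)) * (Fintype.card ι * (transfer σ V a' b' : ℂ)) := by
    rw [← h1, ← h2, Matrix.conjTranspose_kronecker, ← Matrix.mul_kronecker_mul,
      ← Matrix.mul_kronecker_mul, ← Matrix.mul_kronecker_mul, Matrix.trace_kronecker]
  have h4 : ((σ a ⊗ₖ σ a') * ((V ⊗ₖ V) * (σ b ⊗ₖ σ b') * (V ⊗ₖ V).conjTranspose)).trace =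
      ∑ x, ∑ y, (σ a ⊗ₖ σ a') x y *
        ((V ⊗ₖ V) * (σ b ⊗ₖ σ b') * (V ⊗ₖ V).conjTranspose) y x := by
    simp only [Matrix.trace, Matrix.diag, Matrix.mul_apply (M := σ a ⊗ₖ σ a')]
  simp only [mul_assoc ((Fintype.card ι : ℂ)⁻¹ ^ 2), ← Finset.mul_sum]
  rw [← h4, h3]
  push_cast
  field_simp

theorem IsTwoDesign.integral_transfer_mul [Nonempty ι] (hσ : IsPauliBasis σ)
    {ν : Measure (Gate ι)} (hν : IsTwoDesign ν) (a b a' b' : B) :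
    ∫ V, transfer σ V.1 a b * transfer σ V.1 a' b' ∂ν =
      ∫ V, transfer σ V.1 a b * transfer σ V.1 a' b' ∂(haarGate ι) := by
  have := hν.isProbabilityMeasure
  have key : ∀ (ν : Measure (Gate ι)) [IsProbabilityMeasure ν],
      ((∫ V, transfer σ V.1 a b * transfer σ V.1 a' b' ∂ν : ℝ) : ℂ) =
        ∑ x, ∑ y, ((Fintype.card ι : ℂ)⁻¹ ^ 2 * (σ a ⊗ₖ σ a') x y) *
          ∫ V, ((V.1 ⊗ₖ V.1) * (σ b ⊗ₖ σ b') * (V.1 ⊗ₖ V.1).conjTranspose) y x ∂ν := by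
    intro ν _
    rw [← integral_complex_ofReal]
    simp only [transfer_mul_transfer hσ]
    exact integral_sum_sum_mul ν _ (fun x y (V : Gate ι) =>
      ((V.1 ⊗ₖ V.1) * (σ b ⊗ₖ σ b') * (V.1 ⊗ₖ V.1).conjTranspose) y x)
      fun x y => continuous_doubled_entry _ _ _
  have h := (key ν).trans (Eq.trans (Finset.sum_congr rfl fun x _ => Finset.sum_congr rfl
    fun y _ => by rw [hν.secondMoment]) (key (haarGate ι)).symm)
  exact_mod_cast h

theorem transfer_mul_left {s : ℝ} {W V : Matrix ι ι ℂ} {a : B} (b : B)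
    (h : W.conjTranspose * σ a * W = (s : ℂ) • σ a) :
    transfer σ (W * V) a b = s * transfer σ V a b := by
  have e : (σ a * (W * V * σ b * (W * V).conjTranspose)).trace =
      (s : ℂ) * (σ a * (V * σ b * V.conjTranspose)).trace := by
    calc _ = (σ a * W * (V * σ b * V.conjTranspose) * W.conjTranspose).trace := by
          simp only [Matrix.conjTranspose_mul, mul_assoc]
      _ = (W.conjTranspose * σ a * W * (V * σ b * V.conjTranspose)).trace := by
          rw [Matrix.trace_mul_comm]; simp only [mul_assoc]
      _ = _ := by rw [h]; simp
  rw [transfer, transfer, e, Complex.re_ofReal_mul]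
  ring

theorem transfer_mul_right {s : ℝ} {W V : Matrix ι ι ℂ} {b b' : B} (a : B)
    (h : W * σ b * W.conjTranspose = (s : ℂ) • σ b') :
    transfer σ (V * W) a b = s * transfer σ V a b' := by
  have e : (σ a * (V * W * σ b * (V * W).conjTranspose)).trace =
      (s : ℂ) * (σ a * (V * σ b' * V.conjTranspose)).trace := by
    calc _ = (σ a * (V * (W * σ b * W.conjTranspose) * V.conjTranspose)).trace := by
          simp only [Matrix.conjTranspose_mul, mul_assoc]
      _ = _ := by rw [h]; simp
  rw [transfer, transfer, e, Complex.re_ofReal_mul]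
  ring

/-- The members of a Pauli basis, as gates. -/
def IsPauliBasis.gate (hσ : IsPauliBasis σ) (g : B) : Gate ι :=
  ⟨σ g, by rw [Matrix.mem_unitaryGroup_iff, Matrix.star_eq_conjTranspose, hσ.herm, hσ.sq]⟩

/-- The expectation may be taken over Haar measure, which is invariant under multiplication by a
Pauli. If the columns differ, a twist from the right multiplies the integrand by `s * s' = -1`; if
the rows differ, a twist from the left does. -/
theorem IsTwoDesign.integral_transfer_eq_zero [Nonempty ι] (hσ : IsPauliBasis σ)
    {ν : Measure (Gate ι)} (hν : IsTwoDesign ν) {a b a' b' : B} (h : ¬ (a = a' ∧ b = b')) :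
    ∫ V, transfer σ V.1 a b * transfer σ V.1 a' b' ∂ν = 0 := by
  rw [hν.integral_transfer_mul hσ]
  by_cases ha : a = a'
  · have hb : b ≠ b' := fun hb => h ⟨ha, hb⟩
    obtain ⟨g, s, s', h1, h2, h3⟩ := hσ.twist b b' hb
    have e := integral_mul_right_eq_self (μ := haarGate ι)
      (fun V => transfer σ V.1 a b * transfer σ V.1 a' b') (hσ.gate g)
    have e2 : ∀ V : Gate ι, transfer σ (V * hσ.gate g).1 a b * transfer σ (V * hσ.gate g).1 a' b' =
        -1 * (transfer σ V.1 a b * transfer σ V.1 a' b') := by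
      intro V
      have r1 : transfer σ (V.1 * σ g) a b = s * transfer σ V.1 a b :=
        transfer_mul_right a (by rw [hσ.herm]; exact h1)
      have r2 : transfer σ (V.1 * σ g) a' b' = s' * transfer σ V.1 a' b' :=
        transfer_mul_right a' (by rw [hσ.herm]; exact h2)
      change transfer σ (V.1 * σ g) a b * transfer σ (V.1 * σ g) a' b' = _
      rw [r1, r2, ← h3]
      ring
    simp only [e2] at e
    rw [integral_const_mul] at e
    linarith
  · obtain ⟨g, s, s', h1, h2, h3⟩ := hσ.twist a a' ha
    have e := integral_mul_left_eq_self (μ := haarGate ι)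
      (fun V => transfer σ V.1 a b * transfer σ V.1 a' b') (hσ.gate g)
    have e2 : ∀ V : Gate ι, transfer σ (hσ.gate g * V).1 a b * transfer σ (hσ.gate g * V).1 a' b' =
        -1 * (transfer σ V.1 a b * transfer σ V.1 a' b') := by
      intro V
      have r1 : transfer σ (σ g * V.1) a b = s * transfer σ V.1 a b :=
        transfer_mul_left b (by rw [hσ.herm]; exact h1)
      have r2 : transfer σ (σ g * V.1) a' b' = s' * transfer σ V.1 a' b' :=
        transfer_mul_left b' (by rw [hσ.herm]; exact h2)
      change transfer σ (σ g * V.1) a b * transfer σ (σ g * V.1) a' b' = _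
      rw [r1, r2, ← h3]
      ring
    simp only [e2] at e
    rw [integral_const_mul] at e
    linarith

/-- The second moments of the entries of the transfer matrix. -/
noncomputable def moment (σ : B → Matrix ι ι ℂ) (ν : Measure (Gate ι)) (a b : B) : ℝ :=
  ∫ V, transfer σ V.1 a b * transfer σ V.1 a b ∂ν

/-- Right invariance of Haar measure absorbs the unitary that carries `σ b` to `σ b'`. -/
theorem IsTwoDesign.moment_congr [Nonempty ι] (hσ : IsPauliBasis σ) {ν : Measure (Gate ι)}
    (hν : IsTwoDesign ν) (a : B) {b b' : B}
    (h : ∃ W : Gate ι, W.1 * σ b * W.1.conjTranspose = σ b') : moment σ ν a b = moment σ ν a b' := by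
  obtain ⟨W, hW⟩ := h
  unfold moment
  rw [hν.integral_transfer_mul hσ, hν.integral_transfer_mul hσ]
  have e := integral_mul_right_eq_self (μ := haarGate ι)
      (fun V => transfer σ V.1 a b * transfer σ V.1 a b) W
  rw [← e]
  refine integral_congr_ae (Filter.Eventually.of_forall fun V => ?_)
  have r : transfer σ (V.1 * W.1) a b = transfer σ V.1 a b' := by
    rw [transfer_mul_right (s := 1) (b' := b') a (by rw [hW]; simp), one_mul]
  change transfer σ (V.1 * W.1) a b * transfer σ (V.1 * W.1) a b = _
  rw [r]

theorem sum_moment [Nonempty ι] (hσ : IsPauliBasis σ) (ν : Measure (Gate ι))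
    [IsProbabilityMeasure ν] (a : B) : ∑ b, moment σ ν a b = 1 := by
  unfold moment
  rw [← integral_finsetSum (f := fun b (V : Gate ι) => transfer σ V.1 a b * transfer σ V.1 a b) _
    fun b _ => integrable_of_continuous_gate
      ((continuous_transfer a b).mul (continuous_transfer a b))]
  have : ∀ V : Gate ι, ∑ b, transfer σ V.1 a b * transfer σ V.1 a b = 1 := fun V => by
    simpa only [sq] using hσ.sum_transfer_sq (conjTranspose_mul_self_gate V) a
  simp [this]

theorem moment_zero_right [DecidableEq B] [Nonempty ι] (hσ : IsPauliBasis σ) (ν : Measure (Gate ι))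
    [IsProbabilityMeasure ν] (a : B) : moment σ ν a 0 = if a = 0 then 1 else 0 := by
  unfold moment
  simp only [hσ.transfer_zero_right (conjTranspose_mul_self_gate _)]
  split_ifs <;> simp

end Moments

end

section

set_option linter.unusedSectionVars false

/-! ### The noise in the Pauli basis -/

section Transfer

variable {ι B : Type} [Fintype ι] [DecidableEq ι] [Nonempty ι] [Fintype B] [DecidableEq B] [Zero B]
  {σ : B → Matrix ι ι ℂ}

theorem IsPauliBasis.transfer_one (hσ : IsPauliBasis σ) (a b : B) :
    transfer σ 1 a b = if a = b then 1 else 0 := by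
  rw [transfer, one_mul, Matrix.conjTranspose_one, mul_one]
  split_ifs with h
  · rw [h, hσ.sq, Matrix.trace_one]
    simp
  · rw [hσ.trace_mul_eq_zero h]
    simp

theorem IsPauliBasis.transfer_mul (hσ : IsPauliBasis σ) (V W : Matrix ι ι ℂ) (a b : B) :
    transfer σ (V * W) a b = ∑ x, transfer σ V a x * transfer σ W x b := by
  have hne : (Fintype.card ι : ℂ) ≠ 0 := by exact_mod_cast Fintype.card_ne_zero
  have h := hσ.trace_conj a b (V * W)
  rw [show V * W * σ b * (V * W).conjTranspose = V * (W * σ b * W.conjTranspose) * V.conjTranspose by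
    simp only [Matrix.conjTranspose_mul, mul_assoc], hσ.trace_conj_eq_sum] at h
  simp only [hσ.trace_conj] at h
  have h' : (Fintype.card ι : ℂ) * (transfer σ (V * W) a b : ℂ) =
      Fintype.card ι * ∑ x, (transfer σ V a x : ℂ) * transfer σ W x b := by
    rw [← h, Finset.mul_sum]
    exact Finset.sum_congr rfl fun x _ => by ring
  exact_mod_cast mul_left_cancel₀ hne h'

theorem IsPauliBasis.transpose_mul_self (hσ : IsPauliBasis σ) {V : Matrix ι ι ℂ}
    (hV : V.conjTranspose * V = 1) :
    (Matrix.of (transfer σ V)).transpose * Matrix.of (transfer σ V) = 1 := by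
  ext a b
  rw [Matrix.mul_apply, Matrix.one_apply, ← hσ.transfer_one, ← hV, hσ.transfer_mul]
  simp [transfer_conjTranspose]

end Transfer

/-- The matrix of the normal form in the Pauli basis. -/
def normalFormMat (t d : Fin 3 → ℝ) : Matrix (Fin 4) (Fin 4) ℝ :=
  !![1, 0, 0, 0; t 0, d 0, 0, 0; t 1, 0, d 1, 0; t 2, 0, 0, d 2]

theorem trace_pauli_mul_normalFormMap (t d : Fin 3 → ℝ) (a : Fin 4) (X : Op1) :
    (pauli a * normalFormMap t d X).trace =
      ∑ b, (normalFormMat t d a b : ℂ) * (pauli b * X).trace := by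
  have h : (pauli a * normalFormMap t d X).trace = (X.trace / 2) * (pauli a * pauli 0).trace +
      ∑ k : Fin 3, (((t k : ℂ) * X.trace + (d k : ℂ) * (pauli k.succ * X).trace) / 2) *
        (pauli a * pauli k.succ).trace := by
    rw [normalFormMap, mul_add, Matrix.trace_add, Finset.mul_sum, Matrix.trace_sum]
    simp [isPauliBasis_pauli.zero]
  have h0 : (pauli 0 * X).trace = X.trace := by rw [isPauliBasis_pauli.zero, one_mul]
  have hg : ∀ b, (pauli a * pauli b).trace = if a = b then 2 else 0 := by
    intro b
    split_ifs with hab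
    · rw [hab, isPauliBasis_pauli.sq, Matrix.trace_one]
      simp
    · exact isPauliBasis_pauli.trace_mul_eq_zero hab
  simp only [h, hg, Fin.sum_univ_three, Fin.sum_univ_four, h0]
  fin_cases a <;> simp [normalFormMat]

/-- The matrix of the noise in the Pauli basis. -/
structure IsNoiseMatrix (N : Op1 →ₗ[ℂ] Op1) (c : ℝ) (M : Fin 4 → Fin 4 → ℝ) : Prop where
  dual : IsDualMatrix pauli N fun a b => (M a b : ℂ)
  zero : ∀ b, M 0 b = if b = 0 then 1 else 0
  sum_sq : ∑ a, ∑ b, M a b ^ 2 = 1 + 3 * c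

/-- In Pauli coordinates the two rotations are orthogonal matrices `R` and `S`, so `M = R *
normalFormMat t d * Sᵀ` has the Frobenius norm of the normal form, which is `1 + ‖d‖² + ‖t‖²` when
squared. Row `0` expresses trace preservation. -/
theorem exists_isNoiseMatrix {N : Op1 →ₗ[ℂ] Op1} (hN : ∀ A, (N A).trace = A.trace)
    {t d : Fin 3 → ℝ} (hnf : IsNormalForm N t d) : ∃ M, IsNoiseMatrix N (noiseParam t d) M := by
  obtain ⟨U, V, h⟩ := hnf
  have hσ := isPauliBasis_pauli
  set R := Matrix.of (transfer pauli U.1) with hR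
  set S := Matrix.of (transfer pauli V.1) with hS
  have hRR : R.transpose * R = 1 := hσ.transpose_mul_self (conjTranspose_mul_self_gate U)
  have hSS : S.transpose * S = 1 := hσ.transpose_mul_self (conjTranspose_mul_self_gate V)
  set M := R * normalFormMat t d * S.transpose with hM
  have hdual : IsDualMatrix pauli N fun a b => (M a b : ℂ) := by
    intro a X
    rw [h X, hσ.trace_conj_eq_sum]
    have e : ∀ (Q : Matrix (Fin 4) (Fin 4) ℝ) (v : Fin 4 → ℂ) (a : Fin 4),
        ∑ b, (Q a b : ℂ) * v b = (Q.map Complex.ofRealHom).mulVec v a := fun _ _ _ => rfl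
    have hV : (fun x => (pauli x * (V.1.conjTranspose * X * V.1)).trace) =
        (S.transpose.map Complex.ofRealHom).mulVec fun b => (pauli b * X).trace := by
      funext x
      have := hσ.trace_conj_eq_sum V.1.conjTranspose X x
      rw [Matrix.conjTranspose_conjTranspose] at this
      rw [this, ← e]
      simp [hS, transfer_conjTranspose]
    have hnf : (fun x => (pauli x * normalFormMap t d (V.1.conjTranspose * X * V.1)).trace) =
        ((normalFormMat t d).map Complex.ofRealHom).mulVec
          fun x => (pauli x * (V.1.conjTranspose * X * V.1)).trace := by
      funext x
      rw [trace_pauli_mul_normalFormMap, e]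
    rw [e M, hM, Matrix.map_mul, Matrix.map_mul, ← Matrix.mulVec_mulVec, ← Matrix.mulVec_mulVec,
      ← hV, ← hnf]
    rfl
  refine ⟨M, hdual, fun b => ?_, ?_⟩
  · have h1 := hdual 0 (pauli b)
    rw [hσ.zero, one_mul, hN, Finset.sum_eq_single b, hσ.sq, Matrix.trace_one] at h1
    · have h2 : (pauli b).trace = if b = 0 then 2 else 0 := by
        split_ifs with hb
        · rw [hb, hσ.zero, Matrix.trace_one]; simp
        · rw [← one_mul (pauli b), ← hσ.zero]
          exact hσ.trace_mul_eq_zero (Ne.symm hb)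
      rw [h2] at h1
      have h3 := congrArg Complex.re h1
      split_ifs at h3 ⊢ <;> simp at h3 ⊢ <;> linarith
    · intro x _ hx
      rw [hσ.trace_mul_eq_zero hx, mul_zero]
    · simp
  · have e : ∀ X : Matrix (Fin 4) (Fin 4) ℝ,
        ∑ a, ∑ b, X a b ^ 2 = (X.transpose * X).trace := by
      intro X
      simp only [Matrix.trace, Matrix.diag, Matrix.mul_apply, Matrix.transpose_apply, sq]
      exact Finset.sum_comm
    rw [e]
    have e2 : M.transpose * M =
        S * ((normalFormMat t d).transpose * normalFormMat t d) * S.transpose := by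
      calc _ = S * ((normalFormMat t d).transpose * (R.transpose * R) * normalFormMat t d) *
            S.transpose := by
            simp only [hM, Matrix.transpose_mul, Matrix.transpose_transpose, mul_assoc]
        _ = _ := by rw [hRR, mul_one]
    rw [e2, Matrix.trace_mul_comm, ← mul_assoc, hSS, one_mul, ← e]
    simp [normalFormMat, noiseParam, Fin.sum_univ_four, Fin.sum_univ_three]
    ring

/-! ### The noise parameter of a channel -/

/-- Parseval's identity for the Paulis. -/
theorem sum_normSq_eq (Y : Op1) : ∑ i, ∑ j, Complex.normSq (Y i j) =
    (∑ a, Complex.normSq (pauli a * Y).trace) / 2 := by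
  simp [Fin.sum_univ_four, pauli, Matrix.trace, Matrix.mul_apply, Complex.normSq_apply]
  ring

section PosSemidef

variable {κ : Type} [Fintype κ] [DecidableEq κ] {J : Matrix κ κ ℂ}

theorem exists_gram (hJ : J.PosSemidef) :
    ∃ G : Matrix κ κ ℂ, ∀ i j, J i j = ∑ k, star (G k i) * G k j := by
  open scoped MatrixOrder Matrix.Norms.L2Operator in
  obtain ⟨G, hG⟩ := CStarAlgebra.nonneg_iff_eq_star_mul_self.mp hJ.nonneg
  exact ⟨G, fun i j => by rw [hG]; simp [Matrix.mul_apply, Matrix.star_apply]⟩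

/-- The left side is the squared norm of a combination of Gram vectors that is orthogonal to the
vector of `p`. Its sign gives Cauchy–Schwarz and its vanishing gives the equality case. -/
theorem sum_normSq_minor {G : Matrix κ κ ℂ} (hG : ∀ i j, J i j = ∑ k, star (G k i) * G k j)
    (p i : κ) : ((∑ k, Complex.normSq (J p p * G k i - J p i * G k p) : ℝ) : ℂ) =
      J p p * (J p p * J i i - J p i * J i p) := by
  have hs : ∀ i j, star (J i j) = J j i := by
    intro i j
    rw [hG, hG, star_sum]
    exact Finset.sum_congr rfl fun k _ => by rw [star_mul, star_star]
  have h : ∀ α β : ℂ, ((∑ k, Complex.normSq (α * G k i - β * G k p) : ℝ) : ℂ) =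
      star α * α * J i i - star α * β * J i p - star β * α * J p i + star β * β * J p p := by
    intro α β
    rw [hG, hG, hG, hG, Complex.ofReal_sum]
    simp only [Finset.mul_sum]
    rw [← Finset.sum_sub_distrib, ← Finset.sum_sub_distrib, ← Finset.sum_add_distrib]
    refine Finset.sum_congr rfl fun k _ => ?_
    rw [Complex.normSq_eq_conj_mul_self]
    simp only [map_sub, map_mul, starRingEnd_apply]
    ring
  rw [h, hs, hs]
  ring

theorem normSq_le_of_posSemidef (hJ : J.PosSemidef) (p i : κ) :
    Complex.normSq (J p i) ≤ (J p p).re * (J i i).re := by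
  obtain ⟨G, hG⟩ := exists_gram hJ
  have hs : ∀ i j, star (J i j) = J j i := fun i j => hJ.isHermitian.apply j i
  have hd : ∀ i, J i i = ((∑ k, Complex.normSq (G k i) : ℝ) : ℂ) := by
    intro i
    rw [hG, Complex.ofReal_sum]
    exact Finset.sum_congr rfl fun k _ => (Complex.normSq_eq_conj_mul_self).symm
  have hd' : ∀ i, J i i = ((J i i).re : ℂ) := fun i => by rw [hd]; simp
  have h0 : 0 ≤ (J p p).re := by
    rw [hd]; exact Finset.sum_nonneg fun k _ => Complex.normSq_nonneg _
  have h1 := sum_normSq_minor hG p i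
  rw [← hs p i, Complex.star_def, Complex.mul_conj, hd' p, hd' i] at h1
  have h2 : ∑ k, Complex.normSq (((J p p).re : ℂ) * G k i - J p i * G k p) =
      (J p p).re * ((J p p).re * (J i i).re - Complex.normSq (J p i)) := by exact_mod_cast h1
  have h3 : 0 ≤ (J p p).re * ((J p p).re * (J i i).re - Complex.normSq (J p i)) :=
    h2 ▸ Finset.sum_nonneg fun k _ => Complex.normSq_nonneg _
  rcases h0.eq_or_lt with h0 | h0
  -- A vanishing diagonal entry means a vanishing Gram vector, hence a vanishing row.
  · have h4 : ∀ k, G k p = 0 := by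
      have h5 : ∑ k, Complex.normSq (G k p) = 0 := by
        have := hd p
        rw [hd' p, ← h0] at this
        exact_mod_cast this.symm
      intro k
      exact Complex.normSq_eq_zero.mp
        ((Finset.sum_eq_zero_iff_of_nonneg fun k _ => Complex.normSq_nonneg _).mp h5 k
          (Finset.mem_univ k))
    have : J p i = 0 := by rw [hG]; simp [h4]
    rw [this, ← h0]
    simp
  · have := nonneg_of_mul_nonneg_right h3 h0
    linarith

/-- Equality makes the Gram vectors of `p` and `i` parallel, so column `i` is a multiple of column
`p`. -/
theorem mul_eq_mul_of_normSq_eq (hJ : J.PosSemidef) {p i : κ}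
    (h : Complex.normSq (J p i) = (J p p).re * (J i i).re) (k : κ) :
    J p p * J k i = J p i * J k p := by
  obtain ⟨G, hG⟩ := exists_gram hJ
  have hs : ∀ i j, star (J i j) = J j i := fun i j => hJ.isHermitian.apply j i
  have hd' : ∀ i, J i i = ((J i i).re : ℂ) := fun i =>
    (Complex.conj_eq_iff_re.mp (hs i i)).symm
  have h1 := sum_normSq_minor hG p i
  have h0 : J p p * J i i - J p i * J i p = 0 := by
    rw [← hs p i, Complex.star_def, Complex.mul_conj, h, Complex.ofReal_mul, ← hd' p, ← hd' i,
      sub_self]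
  rw [h0, mul_zero] at h1
  have h3 : ∑ k, Complex.normSq (J p p * G k i - J p i * G k p) = 0 := by exact_mod_cast h1
  have h2 : ∀ l, J p p * G l i - J p i * G l p = 0 := fun l => Complex.normSq_eq_zero.mp
    ((Finset.sum_eq_zero_iff_of_nonneg fun k _ => Complex.normSq_nonneg _).mp h3 l
      (Finset.mem_univ l))
  rw [hG k i, hG k p, Finset.mul_sum, Finset.mul_sum]
  refine Finset.sum_congr rfl fun l _ => ?_
  linear_combination (star (G l k)) * h2 l

end PosSemidef

/-- The Choi matrix. -/
def choi (N : Op1 →ₗ[ℂ] Op1) : Matrix (Fin 2 × Fin 2) (Fin 2 × Fin 2) ℂ :=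
  Matrix.of fun a b => N (Matrix.single a.2 b.2 1) a.1 b.1

/-- The Choi matrix is `N ⊗ id` applied to the rank-one operator of the unnormalized maximally
entangled vector. -/
theorem IsChannel.posSemidef_choi {N : Op1 →ₗ[ℂ] Op1} (hN : IsChannel N) :
    (choi N).PosSemidef := by
  have h := hN.completelyPositive 2 (Matrix.vecMulVec (fun a => if a.1 = a.2 then 1 else 0)
    (star fun a => if a.1 = a.2 then 1 else 0)) (Matrix.posSemidef_vecMulVec_self_star _)
  convert h using 1
  ext a b
  simp only [choi, ampliate, Matrix.of_apply]
  refine congrFun (congrFun (congrArg N ?_) a.1) b.1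
  ext i j
  simp only [Matrix.single_apply, Matrix.vecMulVec_apply, Matrix.of_apply, Pi.star_apply]
  by_cases h1 : i = a.2 <;> by_cases h2 : j = b.2 <;> simp [h1, h2, eq_comm]

/-- The Hilbert–Schmidt norm of the superoperator, computed once in matrix units and once in Paulis.
The two changes of basis contribute factors `2` and `1 / 2`. -/
theorem sum_normSq_choi {N : Op1 →ₗ[ℂ] Op1} {c : ℝ} {M : Fin 4 → Fin 4 → ℝ}
    (hM : IsNoiseMatrix N c M) :
    ∑ a, ∑ b, Complex.normSq (choi N a b) = 1 + 3 * c := by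
  have h1 : ∑ a, ∑ b, Complex.normSq (choi N a b) = ∑ x, ∑ y, ∑ i, ∑ j,
      Complex.normSq (N (Matrix.single x y 1) i j) := by
    simp only [choi, Matrix.of_apply, Fintype.sum_prod_type, Fin.sum_univ_two]
    ring
  have h2 : ∀ a, ∑ x, ∑ y, Complex.normSq (pauli a * N (Matrix.single x y 1)).trace =
      2 * ∑ b, M a b ^ 2 := by
    intro a
    set Y : Op1 := ∑ b, (M a b : ℂ) • pauli b with hY
    have e1 : ∀ x y, (pauli a * N (Matrix.single x y 1)).trace = Y y x := by
      intro x y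
      rw [hM.dual, hY, Matrix.sum_apply]
      refine Finset.sum_congr rfl fun b _ => ?_
      rw [Matrix.smul_apply, smul_eq_mul, Matrix.trace_mul_single]
      simp
    have e2 : ∀ b, (pauli b * Y).trace = 2 * (M a b : ℂ) := by
      intro b
      rw [hY, Finset.mul_sum, Matrix.trace_sum, Finset.sum_eq_single b]
      · rw [Matrix.mul_smul, Matrix.trace_smul, isPauliBasis_pauli.sq, Matrix.trace_one]
        simp
        ring
      · intro b' _ hb'
        rw [Matrix.mul_smul, Matrix.trace_smul, isPauliBasis_pauli.trace_mul_eq_zero hb'.symm]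
        simp
      · simp
    simp only [e1]
    rw [Finset.sum_comm, sum_normSq_eq]
    simp only [e2, Complex.normSq_mul, Complex.normSq_ofReal]
    rw [Finset.mul_sum, Finset.sum_div]
    refine Finset.sum_congr rfl fun b _ => ?_
    norm_num
    ring
  rw [h1, ← hM.sum_sq]
  simp only [sum_normSq_eq, ← Finset.sum_div]
  calc _ = (∑ a, ∑ x, ∑ y, Complex.normSq (pauli a * N (Matrix.single x y 1)).trace) / 2 := by
        simp only [Fin.sum_univ_two, Fin.sum_univ_four]
        ring
    _ = _ := by
        simp only [h2, ← Finset.mul_sum]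
        ring

theorem IsChannel.trace_choi {N : Op1 →ₗ[ℂ] Op1} (hN : IsChannel N) :
    ∑ a, choi N a a = 2 := by
  have h : ∀ x, ∑ i, N (Matrix.single x x 1) i i = 1 := by
    intro x
    have := hN.tracePreserving (Matrix.single x x 1)
    simpa [Matrix.trace] using this
  simp only [choi, Matrix.of_apply, Fintype.sum_prod_type]
  rw [Finset.sum_comm]
  simp [h]

/-- The bounds `|J a b|² ≤ J a a * J b b` add up to the squared trace `4`, so the hypothesis makes
all of them equalities. Then the Choi matrix has rank one and there is a single Kraus operator. -/
theorem IsChannel.isUnitaryChannel_of_le {N : Op1 →ₗ[ℂ] Op1} (hN : IsChannel N)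
    (h : 4 ≤ ∑ a, ∑ b, Complex.normSq (choi N a b)) : IsUnitaryChannel N := by
  have hJ := hN.posSemidef_choi
  have htr := hN.trace_choi
  set J := choi N with hJdef
  have hs : ∀ i j, star (J i j) = J j i := fun i j => hJ.isHermitian.apply j i
  have htr' : ∑ a, (J a a).re = 2 := by
    have := congrArg Complex.re htr
    rw [Complex.re_sum] at this
    simpa using this
  have hsum : ∑ a, ∑ b, (J a a).re * (J b b).re = 4 := by
    rw [← Finset.sum_mul_sum, htr']
    norm_num
  have hle : ∀ a b, Complex.normSq (J a b) ≤ (J a a).re * (J b b).re :=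
    fun a b => normSq_le_of_posSemidef hJ a b
  have heq : ∀ a b, Complex.normSq (J a b) = (J a a).re * (J b b).re := by
    have h1 : ∑ a, ∑ b, Complex.normSq (J a b) = ∑ a, ∑ b, (J a a).re * (J b b).re :=
      le_antisymm (Finset.sum_le_sum fun a _ => Finset.sum_le_sum fun b _ => hle a b)
        (hsum.trans_le h)
    intro a b
    have h2 := (Finset.sum_eq_sum_iff_of_le fun a _ => Finset.sum_le_sum fun b _ => hle a b).mp h1
      a (Finset.mem_univ a)
    exact (Finset.sum_eq_sum_iff_of_le fun b _ => hle a b).mp h2 b (Finset.mem_univ b)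
  obtain ⟨p, hp⟩ : ∃ p, 0 < (J p p).re := by
    by_contra hcon
    push Not at hcon
    have := Finset.sum_nonpos fun a (_ : a ∈ Finset.univ) => hcon a
    linarith
  have hpp : J p p = ((J p p).re : ℂ) := (Complex.conj_eq_iff_re.mp (hs p p)).symm
  set x := (J p p).re with hx
  -- The Kraus operator is a column of the Choi matrix with positive diagonal entry, normalized by
  -- the square root of that entry.
  set K : Op1 := Matrix.of fun i a => J (i, a) p / (Real.sqrt x : ℂ) with hK
  have hsq : (Real.sqrt x : ℂ) * Real.sqrt x = x := by
    exact_mod_cast Real.mul_self_sqrt hp.le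
  have hne : (x : ℂ) ≠ 0 := by exact_mod_cast hp.ne'
  have hne' : (Real.sqrt x : ℂ) ≠ 0 := by exact_mod_cast (Real.sqrt_pos.mpr hp).ne'
  have hNK : ∀ A, N A = K * A * K.conjTranspose := by
    intro A
    ext i j
    rw [op1_apply_eq, conj_apply_eq]
    refine Finset.sum_congr rfl fun a _ => Finset.sum_congr rfl fun b _ => ?_
    congr 1
    have h1 := mul_eq_mul_of_normSq_eq hJ (heq p (j, b)) (i, a)
    rw [hpp, ← hs (j, b) p] at h1
    change J (i, a) (j, b) = _
    simp only [hK, Matrix.of_apply, star_div₀]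
    have : star (Real.sqrt x : ℂ) = Real.sqrt x := Complex.conj_ofReal _
    rw [this, div_mul_div_comm, hsq, eq_div_iff hne]
    linear_combination h1
  -- Trace preservation, tested on matrix units, makes the Kraus operator unitary.
  have hKK : K.conjTranspose * K = 1 := by
    ext a b
    have h1 := hN.tracePreserving (Matrix.single b a 1)
    rw [hNK, mul_assoc, Matrix.trace_mul_comm, mul_assoc, Matrix.trace_single_mul] at h1
    rw [Matrix.one_apply]
    split_ifs with hab
    · subst hab
      simpa using h1
    · rw [Matrix.trace_single_eq_of_ne _ _ _ (Ne.symm hab)] at h1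
      simpa using h1
  exact ⟨⟨K, Matrix.mem_unitaryGroup_iff'.mpr hKK⟩, hNK⟩

theorem noiseParam_lt_one {N : Op1 →ₗ[ℂ] Op1} (hN : IsChannel N) (hU : ¬ IsUnitaryChannel N)
    {c : ℝ} {M : Fin 4 → Fin 4 → ℝ} (hM : IsNoiseMatrix N c M) : c < 1 := by
  by_contra hc
  refine hU (hN.isUnitaryChannel_of_le ?_)
  rw [sum_normSq_choi hM]
  linarith

end

section

/-! ### Quadratic forms in the Pauli coordinates -/

section Forms

variable {n : ℕ}

/-- The quadratic form with matrix `F`. -/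
def quad {W : Type} [Fintype W] (F : W → W → ℝ) (x : W → ℝ) : ℝ :=
  ∑ w, ∑ w', F w w' * (x w * x w')

/-- A nonnegative form on Pauli coordinates which is diagonal on the qubits of `T`, whose diagonal
depends there on the support only, of mass at most `τ`, and at most `μ` outside of the identity. -/
structure Good (T : Finset (Fin n)) (μ τ : ℝ) (F : (Fin n → Fin 4) → (Fin n → Fin 4) → ℝ) :
    Prop where
  nonneg : ∀ x, 0 ≤ quad F x
  offDiag : ∀ w w' q, q ∈ T → w q ≠ w' q → F w w' = 0
  supp : ∀ w w' : Fin n → Fin 4, (∀ q ∈ T, (w q = 0 ↔ w' q = 0)) → (∀ q ∉ T, w q = w' q) →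
    F w w = F w' w'
  mass_le : ∑ w, F w w ≤ τ
  mass_ne_le : ∑ w, F w w - F 0 0 ≤ μ

theorem diag_nonneg_of_quad_nonneg {W : Type} [Fintype W] [DecidableEq W] {F : W → W → ℝ}
    (h : ∀ x, 0 ≤ quad F x) (w : W) : 0 ≤ F w w := by
  have := h (Pi.single w 1)
  rw [quad, Finset.sum_eq_single w, Finset.sum_eq_single w] at this
  · simpa using this
  · intro w' _ hw'; simp [Pi.single_eq_of_ne hw']
  · simp
  · intro w' _ hw'; simp [Pi.single_eq_of_ne hw']
  · simp

theorem quad_eq_of_diag {W : Type} [Fintype W] {F : W → W → ℝ}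
    (h : ∀ w w', w ≠ w' → F w w' = 0) (x : W → ℝ) : quad F x = ∑ w, F w w * x w ^ 2 := by
  refine Finset.sum_congr rfl fun w _ => ?_
  rw [Finset.sum_eq_single w]
  · rw [sq]
  · intro w' _ hw'; rw [h w w' hw'.symm, zero_mul]
  · simp

theorem Good.eq_zero_of_ne {μ τ : ℝ} {F : (Fin n → Fin 4) → (Fin n → Fin 4) → ℝ}
    (hF : Good Finset.univ μ τ F) (w w' : Fin n → Fin 4) (h : w ≠ w') : F w w' = 0 := by
  obtain ⟨q, hq⟩ := Function.ne_iff.mp h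
  exact hF.offDiag w w' q (Finset.mem_univ q) hq

/-! ### The action of a gate -/

theorem update2_update2 {β : Type} (w : Fin n → β) {q q' : Fin n} (h : q ≠ q') (a a' b b' : β) :
    update2 (update2 w q q' a a') q q' b b' = update2 w q q' b b' := by
  funext z
  by_cases h1 : z = q
  · subst h1; rw [update2_left _ h, update2_left _ h]
  · by_cases h2 : z = q'
    · subst h2; rw [update2_right, update2_right]
    · rw [update2_other _ h1 h2, update2_other _ h1 h2, update2_other _ h1 h2]

theorem update2_self {β : Type} (w : Fin n → β) {q q' : Fin n} (h : q ≠ q') :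
    update2 w q q' (w q) (w q') = w := by
  funext z
  by_cases h1 : z = q
  · subst h1; rw [update2_left _ h]
  · by_cases h2 : z = q'
    · subst h2; rw [update2_right]
    · rw [update2_other _ h1 h2]

theorem sum_update2_swap {q q' : Fin n} (h : q ≠ q')
    (f : (Fin n → Fin 4) → Fin 4 × Fin 4 → ℝ) :
    ∑ w, ∑ b : Fin 4 × Fin 4, f (update2 w q q' b.1 b.2) (w q, w q') = ∑ w, ∑ b, f w b := by
  rw [← Finset.sum_product', ← Finset.sum_product']
  have hinv : Function.Involutive fun p : (Fin n → Fin 4) × (Fin 4 × Fin 4) =>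
      (update2 p.1 q q' p.2.1 p.2.2, (p.1 q, p.1 q')) := by
    rintro ⟨w, b, b'⟩
    simp only [update2_update2 w h, update2_self w h, update2_left w h, update2_right]
  exact Fintype.sum_equiv hinv.toPerm _ (fun p => f p.1 p.2) fun p => rfl

/-- The action on Pauli coordinates of a gate on `q, q'` with transfer matrix `t`. -/
def gateAct (q q' : Fin n) (t : Fin 4 × Fin 4 → Fin 4 × Fin 4 → ℝ) (x : (Fin n → Fin 4) → ℝ)
    (w : Fin n → Fin 4) : ℝ :=
  ∑ b, t (w q, w q') b * x (update2 w q q' b.1 b.2)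

theorem sum_mul_gateAct {q q' : Fin n} (h : q ≠ q') (t : Fin 4 × Fin 4 → Fin 4 × Fin 4 → ℝ)
    (x g : (Fin n → Fin 4) → ℝ) : ∑ w, g w * gateAct q q' t x w =
      ∑ w, (∑ a, g (update2 w q q' a.1 a.2) * t a (w q, w q')) * x w := by
  have := sum_update2_swap h fun w b => g w * (t (w q, w q') b * x (update2 w q q' b.1 b.2))
  simp only [update2_update2 _ h, update2_self _ h, update2_left _ h, update2_right] at this
  simp only [gateAct, Finset.mul_sum, Finset.sum_mul]
  rw [← this]
  exact Finset.sum_congr rfl fun w _ => Finset.sum_congr rfl fun b _ => by ring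

theorem quad_gateAct {q q' : Fin n} (h : q ≠ q') (t : Fin 4 × Fin 4 → Fin 4 × Fin 4 → ℝ)
    (F : (Fin n → Fin 4) → (Fin n → Fin 4) → ℝ) (x : (Fin n → Fin 4) → ℝ) :
    quad F (gateAct q q' t x) = ∑ w, ∑ w', ∑ a, ∑ a',
      (F (update2 w q q' a.1 a.2) (update2 w' q q' a'.1 a'.2) * (x w * x w')) *
        (t a (w q, w q') * t a' (w' q, w' q')) := by
  have h1 : ∀ w, ∑ w', F w w' * (gateAct q q' t x w * gateAct q q' t x w') =
      (∑ w', (∑ a', F w (update2 w' q q' a'.1 a'.2) * t a' (w' q, w' q')) * x w') *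
        gateAct q q' t x w := by
    intro w
    rw [← sum_mul_gateAct h t x (F w), Finset.sum_mul]
    exact Finset.sum_congr rfl fun w' _ => by ring
  rw [quad]
  simp only [h1]
  rw [sum_mul_gateAct h t x]
  refine Finset.sum_congr rfl fun w _ => ?_
  simp only [Finset.sum_mul]
  rw [Finset.sum_comm]
  refine Finset.sum_congr rfl fun w' _ => Finset.sum_congr rfl fun a _ =>
    Finset.sum_congr rfl fun a' _ => by ring

/-- The expectation of a form after a random gate whose transfer matrix has second moments `m`. -/
def gateForm (q q' : Fin n) (m : Fin 4 × Fin 4 → Fin 4 × Fin 4 → ℝ)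
    (F : (Fin n → Fin 4) → (Fin n → Fin 4) → ℝ) (w w' : Fin n → Fin 4) : ℝ :=
  if w q = w' q ∧ w q' = w' q' then
    ∑ a : Fin 4 × Fin 4, F (update2 w q q' a.1 a.2) (update2 w' q q' a.1 a.2) * m a (w q, w q')
  else 0

theorem gateForm_self (q q' : Fin n) (m : Fin 4 × Fin 4 → Fin 4 × Fin 4 → ℝ)
    (F : (Fin n → Fin 4) → (Fin n → Fin 4) → ℝ) (w : Fin n → Fin 4) : gateForm q q' m F w w =
      ∑ a : Fin 4 × Fin 4, F (update2 w q q' a.1 a.2) (update2 w q q' a.1 a.2) *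
        m a (w q, w q') := by
  simp [gateForm]

/-- The form becomes diagonal at `q, q'` because mixed moments vanish, and its diagonal depends
there on the support only because the moments do. The rows of `m` sum to one, so the mass is
conserved. Only the identity is carried to the identity, so the mass outside of it is conserved too.
-/
theorem Good.gate {T : Finset (Fin n)} {μ τ : ℝ} {F : (Fin n → Fin 4) → (Fin n → Fin 4) → ℝ}
    (hF : Good T μ τ F) {q q' : Fin n} (h : q ≠ q') {m : Fin 4 × Fin 4 → Fin 4 × Fin 4 → ℝ}
    (hsum : ∀ a, ∑ b, m a b = 1) (hzero : ∀ a, m a 0 = if a = 0 then 1 else 0)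
    (hsupp : ∀ a b b', (b.1 = 0 ↔ b'.1 = 0) → (b.2 = 0 ↔ b'.2 = 0) → m a b = m a b')
    (hnonneg : ∀ x, 0 ≤ quad (gateForm q q' m F) x) :
    Good (insert q (insert q' T)) μ τ (gateForm q q' m F) := by
  have hmass : ∑ w, gateForm q q' m F w w = ∑ w, F w w := by
    simp only [gateForm_self]
    have := sum_update2_swap h fun w b => F w w * m (w q, w q') b
    simp only [update2_left _ h, update2_right] at this
    rw [this]
    simp only [← Finset.mul_sum, hsum, mul_one]
  have h00 : gateForm q q' m F 0 0 = F 0 0 := by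
    have h0 := hzero
    change ∀ a, m a (0, 0) = _ at h0
    rw [gateForm_self]
    simp only [Pi.zero_apply, h0, mul_ite, mul_one, mul_zero]
    rw [Finset.sum_ite_eq' Finset.univ (0 : Fin 4 × Fin 4), if_pos (Finset.mem_univ _)]
    have := update2_self (0 : Fin n → Fin 4) h
    simp only [Pi.zero_apply] at this
    simp [this]
  refine ⟨hnonneg, fun w w' z hz hne => ?_, fun w w' h1 h2 => ?_, hmass.trans_le hF.mass_le, ?_⟩
  · unfold gateForm
    split_ifs with heq
    · have hzq : z ≠ q := fun e => hne (e ▸ heq.1)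
      have hzq' : z ≠ q' := fun e => hne (e ▸ heq.2)
      have hzT : z ∈ T := by simpa [hzq, hzq'] using hz
      refine Finset.sum_eq_zero fun a _ => ?_
      rw [hF.offDiag _ _ z hzT (by rwa [update2_other _ hzq hzq', update2_other _ hzq hzq']),
        zero_mul]
    · rfl
  · rw [gateForm_self, gateForm_self]
    refine Finset.sum_congr rfl fun a _ => ?_
    congr 1
    · have hcase : ∀ z, z = q ∨ z = q' ∨ z ≠ q ∧ z ≠ q' := fun z => by tauto
      refine hF.supp _ _ (fun z hz => ?_) fun z hz => ?_
      · rcases hcase z with rfl | rfl | ⟨hq, hq'⟩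
        · rw [update2_left _ h, update2_left _ h]
        · rw [update2_right, update2_right]
        · rw [update2_other _ hq hq', update2_other _ hq hq']
          exact h1 z (by simp [hz])
      · rcases hcase z with rfl | rfl | ⟨hq, hq'⟩
        · rw [update2_left _ h, update2_left _ h]
        · rw [update2_right, update2_right]
        · rw [update2_other _ hq hq', update2_other _ hq hq']
          exact h2 z (by simp [hz, hq, hq'])
    · exact hsupp _ _ _ (h1 q (by simp)) (h1 q' (by simp))
  · rw [hmass, h00]; exact hF.mass_ne_le

/-! ### The action of the noise -/

/-- The action on Pauli coordinates of a tensor product of single-qubit maps with matrix `M`. -/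
def noiseAct (M : Fin 4 → Fin 4 → ℝ) (x : (Fin n → Fin 4) → ℝ) (w : Fin n → Fin 4) : ℝ :=
  ∑ v, (∏ q, M (w q) (v q)) * x v

/-- The form after the noise. -/
def noiseForm (M : Fin 4 → Fin 4 → ℝ) (F : (Fin n → Fin 4) → (Fin n → Fin 4) → ℝ)
    (w w' : Fin n → Fin 4) : ℝ :=
  ∑ v, F v v * ((∏ q, M (v q) (w q)) * ∏ q, M (v q) (w' q))

theorem Good.quad_noiseAct {μ τ : ℝ} {F : (Fin n → Fin 4) → (Fin n → Fin 4) → ℝ}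
    (hF : Good Finset.univ μ τ F) (M : Fin 4 → Fin 4 → ℝ) (x : (Fin n → Fin 4) → ℝ) :
    quad F (noiseAct M x) = quad (noiseForm M F) x := by
  rw [quad_eq_of_diag hF.eq_zero_of_ne]
  simp only [quad, noiseForm, noiseAct, Finset.sum_mul]
  have h1 : ∀ w, F w w * (∑ v, (∏ q, M (w q) (v q)) * x v) ^ 2 =
      ∑ v, ∑ v', F w w * ((∏ q, M (w q) (v q)) * ∏ q, M (w q) (v' q)) * (x v * x v') := by
    intro w
    rw [sq, Finset.sum_mul_sum, Finset.mul_sum]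
    refine Finset.sum_congr rfl fun v _ => ?_
    rw [Finset.mul_sum]
    exact Finset.sum_congr rfl fun v' _ => by ring
  simp only [h1]
  rw [Finset.sum_comm]
  exact Finset.sum_congr rfl fun v _ => Finset.sum_comm

/-- On the set of words with a given support `f` is constant and the sum of products factorizes. So
`κ` enters only through `κ 0` and the sum of its other three values. -/
theorem sum_mul_prod_congr {f : (Fin n → Fin 4) → ℝ}
    (hf : ∀ w w' : Fin n → Fin 4, (∀ q, w q = 0 ↔ w' q = 0) → f w = f w') {κ κ' : Fin 4 → ℝ}
    (h0 : κ 0 = κ' 0) (hsum : ∑ a, κ a = ∑ a, κ' a) :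
    ∑ w, f w * ∏ q, κ (w q) = ∑ w, f w * ∏ q, κ' (w q) := by
  let s : (Fin n → Fin 4) → Fin n → Bool := fun w q => decide (w q = 0)
  rw [← Finset.sum_fiberwise Finset.univ s, ← Finset.sum_fiberwise Finset.univ s]
  refine Finset.sum_congr rfl fun b _ => ?_
  have hfib : (Finset.univ.filter fun w => s w = b) =
      Fintype.piFinset fun q => Finset.univ.filter fun a : Fin 4 => decide (a = 0) = b q := by
    ext w
    simp [s, funext_iff]
  have hrep : ∀ κ : Fin 4 → ℝ, ∑ w ∈ Finset.univ.filter (fun w => s w = b), f w * ∏ q, κ (w q) =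
      f (fun q => if b q then 0 else 1) *
        ∏ q, ∑ a ∈ Finset.univ.filter (fun a : Fin 4 => decide (a = 0) = b q), κ a := by
    intro κ
    rw [Finset.prod_univ_sum, ← hfib, Finset.mul_sum]
    refine Finset.sum_congr rfl fun w hw => ?_
    congr 1
    refine hf _ _ fun q => ?_
    have hb : decide (w q = 0) = b q := congrFun (Finset.mem_filter.mp hw).2 q
    rw [← hb]
    by_cases hq : w q = 0 <;> simp [hq]
  rw [hrep, hrep]
  congr 1
  refine Finset.prod_congr rfl fun q _ => ?_
  have e1 : (Finset.univ.filter fun a : Fin 4 => decide (a = 0) = true) = {0} := by decide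
  have e2 : (Finset.univ.filter fun a : Fin 4 => decide (a = 0) = false) = {1, 2, 3} := by decide
  rw [Fin.sum_univ_four, Fin.sum_univ_four] at hsum
  cases b q
  · rw [e2]
    simp
    linarith
  · rw [e1]
    simpa using h0

/-- The new mass weights `F w w` by the squared row norms of `M` at the letters of `w`. As `F`
depends on supports only, these may be averaged over `X, Y, Z`, which gives `c` per nontrivial
letter. The noise may destroy diagonality; the next layer of gates restores it. -/
theorem Good.noise {μ τ c : ℝ} {F : (Fin n → Fin 4) → (Fin n → Fin 4) → ℝ}
    (hF : Good Finset.univ μ τ F) {N : Op1 →ₗ[ℂ] Op1} {M : Fin 4 → Fin 4 → ℝ}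
    (hM : IsNoiseMatrix N c M) (hc : 0 ≤ c) (hc1 : c ≤ 1) :
    Good ∅ (c * μ) τ (noiseForm M F) := by
  have hdiag : ∀ w, 0 ≤ F w w := diag_nonneg_of_quad_nonneg hF.nonneg
  set κ : Fin 4 → ℝ := fun a => ∑ b, M a b ^ 2 with hκ
  -- Row `0` has norm one and all squared rows sum to `1 + 3 * c`, so the other three average to
  -- `c`.
  set κ' : Fin 4 → ℝ := ![1, c, c, c] with hκ'
  have h0 : κ 0 = κ' 0 := by simp [hκ, hκ', hM.zero]
  have hsum : ∑ a, κ a = ∑ a, κ' a := by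
    rw [hM.sum_sq]
    simp [hκ', Fin.sum_univ_four]
    ring
  have hmass : ∑ w, noiseForm M F w w = ∑ w, F w w * ∏ q, κ' (w q) := by
    rw [← sum_mul_prod_congr (fun w w' h => hF.supp w w' (fun q _ => h q) (by simp)) h0 hsum]
    simp only [noiseForm]
    rw [Finset.sum_comm]
    refine Finset.sum_congr rfl fun v _ => ?_
    rw [← Finset.mul_sum]
    congr 1
    rw [hκ, Finset.prod_univ_sum, Fintype.piFinset_univ]
    refine Finset.sum_congr rfl fun w _ => ?_
    rw [← Finset.prod_mul_distrib]
    exact Finset.prod_congr rfl fun q _ => (sq _).symm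
  have hκ1 : ∀ a, 0 ≤ κ' a ∧ κ' a ≤ 1 := by
    intro a
    fin_cases a <;> simp [hκ', hc, hc1]
  have hprod : ∀ w : Fin n → Fin 4, ∏ q, κ' (w q) ≤ 1 := fun w =>
    Finset.prod_le_one (fun q _ => (hκ1 _).1) fun q _ => (hκ1 _).2
  -- One nontrivial letter already gives the factor `c`; the remaining factors are only bounded by
  -- `1`.
  have hprod' : ∀ w : Fin n → Fin 4, w ≠ 0 → ∏ q, κ' (w q) ≤ c := by
    intro w hw
    obtain ⟨q, hq⟩ := Function.ne_iff.mp hw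
    have hcq : κ' (w q) = c := by
      generalize w q = a at hq
      fin_cases a <;> simp_all
    rw [← Finset.mul_prod_erase _ _ (Finset.mem_univ q), hcq]
    exact mul_le_of_le_one_right hc
      (Finset.prod_le_one (fun q _ => (hκ1 _).1) fun q _ => (hκ1 _).2)
  -- Non-unital noise can only move mass to the identity, so subtracting the new identity entry
  -- costs nothing.
  have h00 : F 0 0 ≤ noiseForm M F 0 0 := by
    refine le_trans (le_of_eq ?_) (Finset.single_le_sum (f := fun v => F v v *
      ((∏ q, M (v q) ((0 : Fin n → Fin 4) q)) * ∏ q, M (v q) ((0 : Fin n → Fin 4) q)))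
      (fun v _ => mul_nonneg (hdiag v) (mul_self_nonneg _)) (Finset.mem_univ 0))
    simp [hM.zero]
  refine ⟨fun x => ?_, by simp, fun w w' _ h2 => ?_, ?_, ?_⟩
  · rw [← hF.quad_noiseAct]
    exact hF.nonneg _
  · rw [funext fun q => h2 q (by simp)]
  · rw [hmass]
    exact (Finset.sum_le_sum fun w _ => mul_le_of_le_one_right (hdiag w) (hprod w)).trans
      hF.mass_le
  · have h1 : ∑ w, F w w * ∏ q, κ' (w q) ≤ F 0 0 + c * (∑ w, F w w - F 0 0) := by
      rw [← Finset.add_sum_erase _ _ (Finset.mem_univ (0 : Fin n → Fin 4)),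
        ← Finset.add_sum_erase Finset.univ (fun w => F w w) (Finset.mem_univ (0 : Fin n → Fin 4)),
        add_sub_cancel_left, Finset.mul_sum]
      refine add_le_add (mul_le_of_le_one_right (hdiag 0) (hprod 0)) (Finset.sum_le_sum fun w hw => ?_)
      rw [mul_comm c]
      exact mul_le_mul_of_nonneg_left (hprod' w (Finset.ne_of_mem_erase hw)) (hdiag w)
    have h2 := mul_le_mul_of_nonneg_left hF.mass_ne_le hc
    rw [hmass]
    linarith

end Forms

end

section

/-! ### Layers as sequences of gates, in Pauli coordinates -/

section Sequence

variable {D r m n L : ℕ}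

/-- The Pauli coordinates of an operator. -/
noncomputable def pauliVec (A : Op n) (w : Fin n → Fin 4) : ℝ := (coord pauli w A).re

/-- The Pauli coordinates of the operator are real. -/
def HasRealCoords (A : Op n) : Prop := ∀ w, (coord pauli w A).im = 0

theorem HasRealCoords.coord_eq {A : Op n} (h : HasRealCoords A) (w : Fin n → Fin 4) :
    coord pauli w A = (pauliVec A w : ℂ) := Complex.ext rfl (h w)

theorem HasRealCoords.sub {A B : Op n} (hA : HasRealCoords A) (hB : HasRealCoords B) :
    HasRealCoords (A - B) := fun w => by rw [map_sub, Complex.sub_im, hA, hB, sub_zero]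

theorem pauliVec_sub (A B : Op n) (w : Fin n → Fin 4) :
    pauliVec (A - B) w = pauliVec A w - pauliVec B w := by
  rw [pauliVec, map_sub, Complex.sub_re]; rfl

theorem isDualMatrix2_transfer (V : Matrix (Fin 2 × Fin 2) (Fin 2 × Fin 2) ℂ) :
    IsDualMatrix2 pauli V fun u v x y => (transfer pauli2 V (u, v) (x, y) : ℂ) := by
  intro u v X
  have := isPauliBasis_pauli2.trace_conj_eq_sum V X (u, v)
  rwa [Fintype.sum_prod_type] at this

theorem pauliVec_pairMat {q q' : Fin n} (h : q ≠ q')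
    (V : Matrix (Fin 2 × Fin 2) (Fin 2 × Fin 2) ℂ) (A : Op n) :
    pauliVec (pairMat V q q' * A * (pairMat V q q').conjTranspose) =
      gateAct q q' (transfer pauli2 V) (pauliVec A) := by
  funext w
  rw [pauliVec, coord_pairMat h (isDualMatrix2_transfer V), gateAct, Fintype.sum_prod_type]
  simp only [Complex.re_sum, Complex.re_ofReal_mul, pauliVec]

theorem HasRealCoords.pairMat {q q' : Fin n} (h : q ≠ q')
    (V : Matrix (Fin 2 × Fin 2) (Fin 2 × Fin 2) ℂ) {A : Op n} (hA : HasRealCoords A) :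
    HasRealCoords (pairMat V q q' * A * (pairMat V q q').conjTranspose) := by
  intro w
  rw [coord_pairMat h (isDualMatrix2_transfer V)]
  simp only [Complex.im_sum, Complex.im_ofReal_mul, hA _, mul_zero, Finset.sum_const_zero]

theorem coord_tensorOp_real {N : Fin n → Op1 →ₗ[ℂ] Op1} {M : Fin n → Fin 4 → Fin 4 → ℝ}
    (hM : ∀ q, IsDualMatrix pauli (N q) fun a b => (M q a b : ℂ)) (A : Op n) (w : Fin n → Fin 4) :
    coord pauli w (tensorOp N A) = ∑ v, ((∏ q, M q (w q) (v q) : ℝ) : ℂ) * coord pauli v A := by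
  rw [coord_tensorOp hM]
  push_cast
  rfl

theorem pauliVec_tensorOp {N : Fin n → Op1 →ₗ[ℂ] Op1} {M : Fin n → Fin 4 → Fin 4 → ℝ}
    (hM : ∀ q, IsDualMatrix pauli (N q) fun a b => (M q a b : ℂ)) (A : Op n) (w : Fin n → Fin 4) :
    pauliVec (tensorOp N A) w = ∑ v, (∏ q, M q (w q) (v q)) * pauliVec A v := by
  rw [pauliVec, coord_tensorOp_real hM]
  simp only [Complex.re_sum, Complex.re_ofReal_mul, pauliVec]

theorem HasRealCoords.tensorOp {N : Fin n → Op1 →ₗ[ℂ] Op1} {M : Fin n → Fin 4 → Fin 4 → ℝ}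
    (hM : ∀ q, IsDualMatrix pauli (N q) fun a b => (M q a b : ℂ)) {A : Op n}
    (hA : HasRealCoords A) : HasRealCoords (tensorOp N A) := by
  intro w
  rw [coord_tensorOp_real hM]
  simp only [Complex.im_sum, Complex.im_ofReal_mul, hA _, mul_zero, Finset.sum_const_zero]

theorem pauliVec_tensorChannel {N : Op1 →ₗ[ℂ] Op1} {c : ℝ} {M : Fin 4 → Fin 4 → ℝ}
    (hM : IsNoiseMatrix N c M) (A : Op n) :
    pauliVec (tensorChannel N A) = noiseAct M (pauliVec A) :=
  funext fun w => pauliVec_tensorOp (M := fun _ => M) (fun _ => hM.dual) A w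

/-! #### Sequences of gates -/

variable (arch : Architecture D r m n L)

/-- The action of the gate at the location `k` on an operator. -/
noncomputable def gateStep (g : arch.GateLoc → Gate (Fin 2 × Fin 2)) (A : Op n)
    (k : arch.GateLoc) : Op n :=
  pairMat (g k).1 k.1.2.2 (arch.partner k.1.1 k.1.2.1 k.1.2.2) * A *
    (pairMat (g k).1 k.1.2.2 (arch.partner k.1.1 k.1.2.1 k.1.2.2)).conjTranspose

/-- The gates of a sublayer on the given qubits. -/
def sublayerGates (i : Fin L) (qs : List (Fin n)) (s : Fin m) : List arch.GateLoc :=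
  qs.filterMap fun q => if h : q < arch.partner i s q then some ⟨(i, s, q), h⟩ else none

/-- The gates of a layer. -/
def layerGates (i : Fin L) : List arch.GateLoc :=
  (List.finRange m).flatMap (sublayerGates arch i (List.finRange n))

theorem mem_sublayerGates {i : Fin L} {qs : List (Fin n)} {s : Fin m} {k : arch.GateLoc} :
    k ∈ sublayerGates arch i qs s ↔ k.1.1 = i ∧ k.1.2.1 = s ∧ k.1.2.2 ∈ qs := by
  obtain ⟨⟨i', s', q⟩, hk⟩ := k
  simp only [sublayerGates, List.mem_filterMap]
  constructor
  · rintro ⟨q', hq', h⟩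
    split_ifs at h with hlt
    simp only [Option.some.injEq, Subtype.mk.injEq, Prod.mk.injEq] at h
    obtain ⟨rfl, rfl, rfl⟩ := h
    exact ⟨rfl, rfl, hq'⟩
  · rintro ⟨rfl, rfl, hq⟩
    exact ⟨q, hq, by rw [dif_pos hk]⟩

theorem mem_layerGates {i : Fin L} {k : arch.GateLoc} : k ∈ layerGates arch i ↔ k.1.1 = i := by
  simp [layerGates, mem_sublayerGates]

theorem nodup_layerGates (i : Fin L) : (layerGates arch i).Nodup := by
  refine List.nodup_flatMap.mpr ⟨fun s _ => ?_, ?_⟩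
  · refine (List.nodup_finRange n).filterMap ?_
    intro q q' k hk hk'
    rw [Option.mem_def] at hk hk'
    split_ifs at hk hk'
    have e := Option.some.inj (hk.trans hk'.symm)
    exact congrArg (fun k : arch.GateLoc => k.1.2.2) e
  · refine (List.nodup_finRange m).imp ?_
    intro s s' hne k hk hk'
    rw [mem_sublayerGates] at hk hk'
    exact hne (hk.2.1.symm.trans hk'.2.1)

/-- Gates of a sublayer have disjoint supports, so they can be applied one by one; this lets their
independent expectations be taken in turn. -/
theorem foldl_sublayerGates (ω : arch.Sample) (i : Fin L) (s : Fin m) {qs : List (Fin n)}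
    (hqs : qs.Nodup) (A : Op n) : (sublayerGates arch i qs s).foldl (gateStep arch ω.1) A =
      pairLayer (arch.partner i s) (fun q => if q ∈ qs then gateMat arch ω i s q else 1) * A *
        (pairLayer (arch.partner i s)
          (fun q => if q ∈ qs then gateMat arch ω i s q else 1)).conjTranspose := by
  induction qs using List.reverseRecOn with
  | nil => simp [sublayerGates, pairLayer_one (arch.partner_partner i s)]
  | append_singleton qs q ih =>
    have hnd := List.nodup_append.mp hqs
    have hq : q ∉ qs := fun h => hnd.2.2 q h q (by simp) rfl
    have e : sublayerGates arch i (qs ++ [q]) s =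
        sublayerGates arch i qs s ++ sublayerGates arch i [q] s := by
      simp [sublayerGates]
    rw [e, List.foldl_append, ih hnd.1]
    have hV : (fun z => if z ∈ qs ++ [q] then gateMat arch ω i s z else 1) =
        Function.update (fun z => if z ∈ qs then gateMat arch ω i s z else 1) q
          (gateMat arch ω i s q) := by
      funext z
      by_cases hz : z = q
      · subst hz; simp
      · simp [hz]
    have hV1 : Function.update (fun z => if z ∈ qs then gateMat arch ω i s z else 1) q 1 =
        fun z => if z ∈ qs then gateMat arch ω i s z else 1 := by
      rw [Function.update_eq_self_iff]
      simp [hq]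
    by_cases hlt : q < arch.partner i s q
    · rw [hV, pairLayer_update (arch.partner_partner i s) _ hlt, hV1]
      simp only [sublayerGates, List.filterMap_cons, dif_pos hlt, List.filterMap_nil,
        List.foldl_cons, List.foldl_nil, gateStep, gateMat, Matrix.conjTranspose_mul, mul_assoc]
    · have : pairLayer (arch.partner i s)
          (fun z => if z ∈ qs ++ [q] then gateMat arch ω i s z else 1) =
          pairLayer (arch.partner i s) fun z => if z ∈ qs then gateMat arch ω i s z else 1 := by
        refine pairLayer_congr fun z hz => ?_
        have hne : z ≠ q := by rintro rfl; exact hlt hz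
        simp [hne]
      rw [this]
      simp [sublayerGates, hlt]

theorem foldl_layerGates (ω : arch.Sample) (i : Fin L) (A : Op n) :
    (layerGates arch i).foldl (gateStep arch ω.1) A =
      layerUnitary arch ω i * A * (layerUnitary arch ω i).conjTranspose := by
  have h : ∀ (ss : List (Fin m)) (A : Op n),
      (ss.flatMap (sublayerGates arch i (List.finRange n))).foldl (gateStep arch ω.1) A =
      (ss.map (sublayerUnitary arch ω i)).reverse.prod * A *
        ((ss.map (sublayerUnitary arch ω i)).reverse.prod).conjTranspose := by
    intro ss
    induction ss with
    | nil => simp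
    | cons s ss ih =>
      intro A
      rw [List.flatMap_cons, List.foldl_append, ih,
        foldl_sublayerGates arch ω i s (List.nodup_finRange n)]
      simp only [List.mem_finRange, if_true, ← sublayerUnitary_eq, List.map_cons,
        List.reverse_cons, List.prod_append, List.prod_singleton, Matrix.conjTranspose_mul,
        mul_assoc]
  exact h _ A

end Sequence

end

section

/-! ### Expectations -/

/-- Resampling one independent coordinate does not change an expectation. -/
theorem lintegral_pi_update {ι : Type} [Fintype ι] [DecidableEq ι] {X : ι → Type}
    [∀ i, MeasurableSpace (X i)] (μ : ∀ i, Measure (X i)) [∀ i, IsProbabilityMeasure (μ i)]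
    {f : (∀ i, X i) → ENNReal} (hf : Measurable f) (k : ι) :
    ∫⁻ g, f g ∂(Measure.pi μ) = ∫⁻ g, ∫⁻ v, f (Function.update g k v) ∂(μ k) ∂(Measure.pi μ) := by
  have hx : ∀ i, Nonempty (X i) := fun i => nonempty_of_isProbabilityMeasure (μ i)
  let x : ∀ i, X i := fun i => (hx i).some
  set h : (∀ i, X i) → ENNReal := fun g => ∫⁻ v, f (Function.update g k v) ∂(μ k) with hh
  have hm : Measurable h := by
    have := hf.lmarginal μ (s := {k})
    rwa [lmarginal_singleton] at this
  rw [lintegral_eq_lmarginal_univ x, lintegral_eq_lmarginal_univ x,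
    lmarginal_erase' f hf (Finset.mem_univ k), lmarginal_erase' h hm (Finset.mem_univ k)]
  congr 1
  funext g
  simp [hh]

section Gate

variable {n : ℕ}

/-- In the expansion over rows and columns of both copies of the transfer matrix only the terms with
equal rows and equal columns survive. -/
theorem integral_quad_gateAct {ν : Measure (Gate (Fin 2 × Fin 2))} (hν : IsTwoDesign ν)
    {q q' : Fin n} (h : q ≠ q') (F : (Fin n → Fin 4) → (Fin n → Fin 4) → ℝ)
    (x : (Fin n → Fin 4) → ℝ) :
    ∫ V, quad F (gateAct q q' (transfer pauli2 V.1) x) ∂ν =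
      quad (gateForm q q' (moment pauli2 ν) F) x := by
  have := hν.isProbabilityMeasure
  have hc : ∀ a b a' b', Continuous fun V : Gate (Fin 2 × Fin 2) =>
      transfer pauli2 V.1 a b * transfer pauli2 V.1 a' b' := fun a b a' b' =>
    (continuous_transfer a b).mul (continuous_transfer a' b')
  have hE : ∀ a b a' b', ∫ V, transfer pauli2 V.1 a b * transfer pauli2 V.1 a' b' ∂ν =
      if a = a' ∧ b = b' then moment pauli2 ν a b else 0 := by
    intro a b a' b'
    split_ifs with hab
    · rw [← hab.1, ← hab.2, moment]
    · exact hν.integral_transfer_eq_zero isPauliBasis_pauli2 hab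
  simp only [quad_gateAct h]
  let W := Fin n → Fin 4
  let B := Fin 4 × Fin 4
  let C : W × W × B × B → ℝ := fun p => F (update2 p.1 q q' p.2.2.1.1 p.2.2.1.2)
    (update2 p.2.1 q q' p.2.2.2.1 p.2.2.2.2) * (x p.1 * x p.2.1)
  let G : W × W × B × B → Gate (Fin 2 × Fin 2) → ℝ := fun p V =>
    transfer pauli2 V.1 p.2.2.1 (p.1 q, p.1 q') * transfer pauli2 V.1 p.2.2.2 (p.2.1 q, p.2.1 q')
  have e : ∀ V : Gate (Fin 2 × Fin 2), ∑ w, ∑ w', ∑ a, ∑ a',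
      (F (update2 w q q' a.1 a.2) (update2 w' q q' a'.1 a'.2) * (x w * x w')) *
        (transfer pauli2 V.1 a (w q, w q') * transfer pauli2 V.1 a' (w' q, w' q')) =
      ∑ p, C p * G p V := by
    intro V
    rw [Fintype.sum_prod_type]
    refine Finset.sum_congr rfl fun w _ => ?_
    rw [Fintype.sum_prod_type]
    refine Finset.sum_congr rfl fun w' _ => ?_
    exact (Fintype.sum_prod_type (fun p : B × B => C (w, w', p) * G (w, w', p) V)).symm
  simp only [e]
  have hi : ∫ V, ∑ p, C p * G p V ∂ν = ∑ p, C p * ∫ V, G p V ∂ν :=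
    (integral_finsetSum _ fun p _ => integrable_of_continuous_gate
      (continuous_const.mul (hc _ _ _ _))).trans
      (Finset.sum_congr rfl fun p _ => integral_const_mul _ _)
  rw [hi]
  simp only [C, G, hE, quad, gateForm]
  rw [Fintype.sum_prod_type]
  refine Finset.sum_congr rfl fun w _ => ?_
  rw [Fintype.sum_prod_type]
  refine Finset.sum_congr rfl fun w' _ => ?_
  rw [Fintype.sum_prod_type]
  split_ifs with hw
  · rw [Finset.sum_mul]
    refine Finset.sum_congr rfl fun a _ => ?_
    rw [Finset.sum_eq_single a]
    · rw [if_pos ⟨rfl, Prod.ext hw.1 hw.2⟩]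
      ring
    · intro a' _ ha'
      rw [if_neg fun hh => ha' hh.1.symm, mul_zero]
    · simp
  · rw [zero_mul]
    refine Finset.sum_eq_zero fun a _ => Finset.sum_eq_zero fun a' _ => ?_
    rw [if_neg fun hh => hw ⟨(Prod.ext_iff.mp hh.2).1, (Prod.ext_iff.mp hh.2).2⟩, mul_zero]

theorem continuous_quad_gateAct (q q' : Fin n) (F : (Fin n → Fin 4) → (Fin n → Fin 4) → ℝ)
    (x : (Fin n → Fin 4) → ℝ) : Continuous fun V : Gate (Fin 2 × Fin 2) =>
      quad F (gateAct q q' (transfer pauli2 V.1) x) := by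
  have h := fun a b => continuous_transfer (σ := pauli2) a b
  unfold quad gateAct
  fun_prop

theorem lintegral_quad_gateAct {ν : Measure (Gate (Fin 2 × Fin 2))} (hν : IsTwoDesign ν)
    {q q' : Fin n} (h : q ≠ q') {F : (Fin n → Fin 4) → (Fin n → Fin 4) → ℝ}
    (hF : ∀ x, 0 ≤ quad F x) (x : (Fin n → Fin 4) → ℝ) :
    ∫⁻ V, ENNReal.ofReal (quad F (gateAct q q' (transfer pauli2 V.1) x)) ∂ν =
      ENNReal.ofReal (quad (gateForm q q' (moment pauli2 ν) F) x) := by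
  have := hν.isProbabilityMeasure
  rw [← integral_quad_gateAct hν h, ofReal_integral_eq_lintegral_ofReal
    (integrable_of_continuous_gate (continuous_quad_gateAct q q' F x))
    (Filter.Eventually.of_forall fun V => hF _)]

theorem Good.gate_moment {T : Finset (Fin n)} {μ τ : ℝ}
    {F : (Fin n → Fin 4) → (Fin n → Fin 4) → ℝ} (hF : Good T μ τ F) {q q' : Fin n} (h : q ≠ q')
    {ν : Measure (Gate (Fin 2 × Fin 2))} (hν : IsTwoDesign ν) :
    Good (insert q (insert q' T)) μ τ (gateForm q q' (moment pauli2 ν) F) := by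
  have := hν.isProbabilityMeasure
  refine hF.gate h (sum_moment isPauliBasis_pauli2 ν) (moment_zero_right isPauliBasis_pauli2 ν)
    (fun a b b' h1 h2 => hν.moment_congr isPauliBasis_pauli2 a
      (exists_gate_conj_pauli2 b b' h1 h2)) fun x => ?_
  rw [← integral_quad_gateAct hν h]
  exact integral_nonneg fun V => hF.nonneg _

end Gate

section Circuit

variable {D r m n L : ℕ} {arch : Architecture D r m n L}

/-- A random operator with measurable entries and real Pauli coordinates. -/
structure RandomOp (arch : Architecture D r m n L)
    (A : (arch.GateLoc → Gate (Fin 2 × Fin 2)) → Op n) : Prop where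
  measurable : ∀ x y, Measurable fun g => A g x y
  real : ∀ g, HasRealCoords (A g)

/-- The random operator does not depend on the gate at the location `k`. -/
def IndepOf (k : arch.GateLoc) (A : (arch.GateLoc → Gate (Fin 2 × Fin 2)) → Op n) : Prop :=
  ∀ g V, A (Function.update g k V) = A g

theorem RandomOp.measurable_pauliVec {A : (arch.GateLoc → Gate (Fin 2 × Fin 2)) → Op n}
    (hA : RandomOp arch A) (w : Fin n → Fin 4) : Measurable fun g => pauliVec (A g) w := by
  have h := hA.measurable
  simp only [pauliVec, coord_apply, Matrix.trace, Matrix.diag, Matrix.mul_apply]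
  refine Complex.measurable_re.comp ?_
  exact Finset.measurable_sum _ fun x _ => Finset.measurable_sum _ fun y _ =>
    (h y x).const_mul _

theorem RandomOp.measurable_quad {A : (arch.GateLoc → Gate (Fin 2 × Fin 2)) → Op n}
    (hA : RandomOp arch A) (F : (Fin n → Fin 4) → (Fin n → Fin 4) → ℝ) :
    Measurable fun g => ENNReal.ofReal (quad F (pauliVec (A g))) := by
  refine ENNReal.measurable_ofReal.comp ?_
  exact Finset.measurable_sum _ fun x _ => Finset.measurable_sum _ fun y _ =>
    ((hA.measurable_pauliVec x).mul (hA.measurable_pauliVec y)).const_mul _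

theorem RandomOp.const {A : Op n} (hA : HasRealCoords A) : RandomOp arch fun _ => A :=
  ⟨fun _ _ => measurable_const, fun _ => hA⟩

theorem RandomOp.sub {A B : (arch.GateLoc → Gate (Fin 2 × Fin 2)) → Op n} (hA : RandomOp arch A)
    (hB : RandomOp arch B) : RandomOp arch fun g => A g - B g :=
  ⟨fun x y => (hA.measurable x y).sub (hB.measurable x y), fun g => (hA.real g).sub (hB.real g)⟩

theorem RandomOp.gateStep {A : (arch.GateLoc → Gate (Fin 2 × Fin 2)) → Op n}
    (hA : RandomOp arch A) (k : arch.GateLoc) : RandomOp arch fun g => gateStep arch g (A g) k := by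
  have h := hA.measurable
  have hg : ∀ x y, Measurable fun g : arch.GateLoc → Gate (Fin 2 × Fin 2) => (g k).1 x y :=
    fun x y => (continuous_gate_entry x y).measurable.comp (measurable_pi_apply k)
  have hp : ∀ x y, Measurable fun g : arch.GateLoc → Gate (Fin 2 × Fin 2) =>
      pairMat (g k).1 k.1.2.2 (arch.partner k.1.1 k.1.2.1 k.1.2.2) x y :=
    fun x y => (hg _ _).mul_const _
  refine ⟨fun x y => ?_, fun g => (hA.real g).pairMat k.2.ne _⟩
  simp only [NoisyCircuit.gateStep, conj_apply_eq]
  exact Finset.measurable_sum _ fun a _ => Finset.measurable_sum _ fun b _ =>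
    ((hp _ _).mul (continuous_star.measurable.comp (hp _ _))).mul (h _ _)

theorem IndepOf.gateStep {A : (arch.GateLoc → Gate (Fin 2 × Fin 2)) → Op n} {k k' : arch.GateLoc}
    (h : IndepOf k A) (hne : k' ≠ k) : IndepOf k fun g => gateStep arch g (A g) k' := by
  intro g V
  simp only [NoisyCircuit.gateStep, h g V, Function.update_of_ne hne]

theorem RandomOp.foldl_gateStep {A : (arch.GateLoc → Gate (Fin 2 × Fin 2)) → Op n}
    (hA : RandomOp arch A) (ks : List arch.GateLoc) :
    RandomOp arch fun g => ks.foldl (NoisyCircuit.gateStep arch g) (A g) := by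
  induction ks generalizing A with
  | nil => exact hA
  | cons k ks ih => exact ih (hA.gateStep k)

theorem IndepOf.foldl_gateStep {A : (arch.GateLoc → Gate (Fin 2 × Fin 2)) → Op n}
    {k : arch.GateLoc} (h : IndepOf k A) {ks : List arch.GateLoc} (hk : k ∉ ks) :
    IndepOf k fun g => ks.foldl (NoisyCircuit.gateStep arch g) (A g) := by
  induction ks generalizing A with
  | nil => exact h
  | cons k' ks ih =>
    rw [List.mem_cons, not_or] at hk
    exact ih (h.gateStep (Ne.symm hk.1)) hk.2

variable {ν₂ : arch.GateLoc → Measure (Gate (Fin 2 × Fin 2))}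

/-- The expectation of a form in the Pauli coordinates of a random operator. -/
noncomputable def meanQuad (ν₂ : arch.GateLoc → Measure (Gate (Fin 2 × Fin 2)))
    (F : (Fin n → Fin 4) → (Fin n → Fin 4) → ℝ)
    (A : (arch.GateLoc → Gate (Fin 2 × Fin 2)) → Op n) : ENNReal :=
  ∫⁻ g, ENNReal.ofReal (quad F (pauliVec (A g))) ∂(Measure.pi ν₂)

/-- `A` does not involve the gate at `k`, so this gate can be integrated out first with `A` frozen.
-/
theorem meanQuad_gateStep (hν : ∀ k, IsTwoDesign (ν₂ k))
    {F : (Fin n → Fin 4) → (Fin n → Fin 4) → ℝ} (hF : ∀ x, 0 ≤ quad F x)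
    {A : (arch.GateLoc → Gate (Fin 2 × Fin 2)) → Op n} (hA : RandomOp arch A) {k : arch.GateLoc}
    (hk : IndepOf k A) : meanQuad ν₂ F (fun g => gateStep arch g (A g) k) =
      meanQuad ν₂ (gateForm k.1.2.2 (arch.partner k.1.1 k.1.2.1 k.1.2.2)
        (moment pauli2 (ν₂ k)) F) A := by
  have := fun k => (hν k).isProbabilityMeasure
  rw [meanQuad, lintegral_pi_update ν₂ ((hA.gateStep k).measurable_quad F) k]
  refine lintegral_congr fun g => ?_
  simp only [hk g, gateStep, pauliVec_pairMat k.2.ne, Function.update_self]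
  exact lintegral_quad_gateAct (hν k) k.2.ne hF _

/-- The gates are integrated out from the last to the first. The resulting form depends on the laws
of the gates but not on the input `A`, and it is diagonal at every qubit that some gate touches. -/
theorem exists_good_gates (hν : ∀ k, IsTwoDesign (ν₂ k)) (ks : List arch.GateLoc)
    (hks : ks.Nodup) {T : Finset (Fin n)} {μ τ : ℝ} {F : (Fin n → Fin 4) → (Fin n → Fin 4) → ℝ}
    (hF : Good T μ τ F) : ∃ T' F', Good T' μ τ F' ∧ T ⊆ T' ∧
      (∀ k ∈ ks, k.1.2.2 ∈ T' ∧ arch.partner k.1.1 k.1.2.1 k.1.2.2 ∈ T') ∧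
      ∀ A, RandomOp arch A → (∀ k ∈ ks, IndepOf k A) →
        meanQuad ν₂ F (fun g => ks.foldl (gateStep arch g) (A g)) = meanQuad ν₂ F' A := by
  induction ks using List.reverseRecOn generalizing T F with
  | nil => exact ⟨T, F, hF, subset_rfl, by simp, fun A _ _ => rfl⟩
  | append_singleton ks k ih =>
    have hnd := List.nodup_append.mp hks
    have hk : k ∉ ks := fun h => hnd.2.2 k h k (by simp) rfl
    obtain ⟨T', F', h1, h2, h3, h4⟩ := ih hnd.1 (hF.gate_moment k.2.ne (hν k))
    refine ⟨T', F', h1, fun q hq => h2 (by simp [hq]), fun k' hk' => ?_, fun A hA hi => ?_⟩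
    · rcases List.mem_append.mp hk' with hk' | hk'
      · exact h3 k' hk'
      · rw [List.mem_singleton.mp hk']
        exact ⟨h2 (by simp), h2 (by simp)⟩
    · rw [← h4 A hA fun k' hk' => hi k' (by simp [hk'])]
      simp only [List.foldl_append, List.foldl_cons, List.foldl_nil]
      exact meanQuad_gateStep hν hF.nonneg (hA.foldl_gateStep ks)
        ((hi k (by simp)).foldl_gateStep hk)

/-! #### Layers -/

variable {N : Op1 →ₗ[ℂ] Op1} {c : ℝ} {M : Fin 4 → Fin 4 → ℝ}

theorem noisyLayer_eq (ω : arch.Sample) (A : Op n) (i : Fin L) : noisyLayer arch N ω A i =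
    tensorChannel N ((layerGates arch i).foldl (gateStep arch ω.1) A) := by
  rw [foldl_layerGates]; rfl

theorem RandomOp.noisyLayer (hM : IsNoiseMatrix N c M)
    {A : (arch.GateLoc → Gate (Fin 2 × Fin 2)) → Op n} (hA : RandomOp arch A)
    (u : Fin n → Gate (Fin 2)) (i : Fin L) :
    RandomOp arch fun g => noisyLayer arch N (g, u) (A g) i := by
  have h := hA.foldl_gateStep (layerGates arch i)
  simp only [noisyLayer_eq]
  refine ⟨fun x y => ?_, fun g => (h.real g).tensorOp (M := fun _ => M) fun _ => hM.dual⟩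
  exact Finset.measurable_sum _ fun a _ => Finset.measurable_sum _ fun b _ =>
    (h.measurable a b).const_mul _

theorem RandomOp.foldl_noisyLayer (hM : IsNoiseMatrix N c M)
    {A : (arch.GateLoc → Gate (Fin 2 × Fin 2)) → Op n} (hA : RandomOp arch A)
    (u : Fin n → Gate (Fin 2)) (is : List (Fin L)) :
    RandomOp arch fun g => is.foldl (NoisyCircuit.noisyLayer arch N (g, u)) (A g) := by
  induction is generalizing A with
  | nil => exact hA
  | cons i is ih => exact ih (hA.noisyLayer hM u i)

theorem IndepOf.foldl_noisyLayer {A : (arch.GateLoc → Gate (Fin 2 × Fin 2)) → Op n}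
    {k : arch.GateLoc} (h : IndepOf k A) (u : Fin n → Gate (Fin 2)) {is : List (Fin L)}
    (hk : k.1.1 ∉ is) :
    IndepOf k fun g => is.foldl (NoisyCircuit.noisyLayer arch N (g, u)) (A g) := by
  induction is generalizing A with
  | nil => exact h
  | cons i is ih =>
    rw [List.mem_cons, not_or] at hk
    refine ih (A := fun g => NoisyCircuit.noisyLayer arch N (g, u) (A g) i) (fun g V => ?_) hk.2
    simp only [noisyLayer_eq]
    exact congrArg _ (h.foldl_gateStep (fun hmem => hk.1 ((mem_layerGates arch).mp hmem)) g V)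

/-- Per layer, the noise contracts the mass outside of the identity by `c` and the gates keep it.
One form serves all inputs that are independent of these layers, deterministic or random. -/
theorem exists_good_layers (hν : ∀ k, IsTwoDesign (ν₂ k)) (hM : IsNoiseMatrix N c M)
    (hc : 0 ≤ c) (hc1 : c ≤ 1) (u : Fin n → Gate (Fin 2)) (is : List (Fin L)) (his : is.Nodup)
    {μ τ : ℝ} {F : (Fin n → Fin 4) → (Fin n → Fin 4) → ℝ} (hF : Good Finset.univ μ τ F) :
    ∃ F', Good Finset.univ (c ^ is.length * μ) τ F' ∧
      ∀ A, RandomOp arch A → (∀ k : arch.GateLoc, k.1.1 ∈ is → IndepOf k A) →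
        meanQuad ν₂ F (fun g => is.foldl (noisyLayer arch N (g, u)) (A g)) =
          meanQuad ν₂ F' A := by
  induction is using List.reverseRecOn generalizing μ F with
  | nil => exact ⟨F, by simpa using hF, fun A _ _ => rfl⟩
  | append_singleton is i ih =>
    have hnd := List.nodup_append.mp his
    have hi : i ∉ is := fun h => hnd.2.2 i h i (by simp) rfl
    obtain ⟨T, F₁, h1, -, h3, h4⟩ :=
      exists_good_gates hν (layerGates arch i) (nodup_layerGates arch i) (hF.noise hM hc hc1)
    -- Every qubit meets a gate of the layer, either as its smaller or as its larger qubit, so the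
    -- form is diagonal everywhere before the next noise is treated.
    have hT : T = Finset.univ := by
      refine Finset.eq_univ_of_forall fun q => ?_
      obtain ⟨s, hs⟩ := arch.covers i q
      rcases lt_or_gt_of_ne hs with hlt | hlt
      · have := (h3 ⟨(i, s, arch.partner i s q), by rwa [arch.partner_partner]⟩
          ((mem_layerGates arch).mpr rfl)).2
        simpa [arch.partner_partner] using this
      · exact (h3 ⟨(i, s, q), hlt⟩ ((mem_layerGates arch).mpr rfl)).1
    subst hT
    obtain ⟨F', h5, h6⟩ := ih hnd.1 h1
    refine ⟨F', ?_, fun A hA hind => ?_⟩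
    · rw [List.length_append, List.length_singleton, pow_succ, mul_assoc]
      exact h5
    · rw [← h6 A hA fun k hk => hind k (by simp [hk]), ← h4 _ (hA.foldl_noisyLayer hM u is)
        fun k hk => ?_]
      · refine lintegral_congr fun g => ?_
        simp only [List.foldl_append, List.foldl_cons, List.foldl_nil, noisyLayer_eq,
          pauliVec_tensorChannel hM]
        rw [hF.quad_noiseAct]
      · have hki := (mem_layerGates arch).mp hk
        exact (hind k (by simp [hki])).foldl_noisyLayer u (by rwa [hki])

end Circuit

end

section

/-! ### The final layer of single-qubit gates -/

section Single

variable {n : ℕ}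

theorem isDualMatrix_transfer (U : Op1) :
    IsDualMatrix pauli (conjMap U) fun a b => (transfer pauli U a b : ℂ) := fun a X =>
  isPauliBasis_pauli.trace_conj_eq_sum U X a

/-- The expectation, over the final layer, of the square of the coordinate `P`. -/
noncomputable def singleForm (ν₁ : Fin n → Measure (Gate (Fin 2))) (P : Fin n → Fin 4)
    (v v' : Fin n → Fin 4) : ℝ :=
  ∏ q, ∫ V, transfer pauli V.1 (P q) (v q) * transfer pauli V.1 (P q) (v' q) ∂(ν₁ q)

/-- The coordinate `P` after the final layer, from the coordinates before it. -/
noncomputable def singleAct (P : Fin n → Fin 4) (u : Fin n → Gate (Fin 2))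
    (x : (Fin n → Fin 4) → ℝ) : ℝ :=
  ∑ v, (∏ q, transfer pauli (u q).1 (P q) (v q)) * x v

variable {ν₁ : Fin n → Measure (Gate (Fin 2))}

theorem singleAct_sq (P : Fin n → Fin 4) (u : Fin n → Gate (Fin 2)) (x : (Fin n → Fin 4) → ℝ) :
    singleAct P u x ^ 2 = ∑ v, ∑ v', (x v * x v') *
      ∏ q, transfer pauli (u q).1 (P q) (v q) * transfer pauli (u q).1 (P q) (v' q) := by
  rw [singleAct, sq, Finset.sum_mul_sum]
  refine Finset.sum_congr rfl fun v _ => Finset.sum_congr rfl fun v' _ => ?_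
  rw [Finset.prod_mul_distrib]
  ring

theorem integrable_prod_transfer (hν : ∀ q, IsTwoDesign (ν₁ q)) (P v v' : Fin n → Fin 4) :
    Integrable (fun u : Fin n → Gate (Fin 2) => ∏ q, transfer pauli (u q).1 (P q) (v q) *
      transfer pauli (u q).1 (P q) (v' q)) (Measure.pi ν₁) := by
  have := fun q => (hν q).isProbabilityMeasure
  exact Integrable.fintype_prod (f := fun q (V : Gate (Fin 2)) =>
    transfer pauli V.1 (P q) (v q) * transfer pauli V.1 (P q) (v' q)) fun q =>
      integrable_of_continuous_gate ((continuous_transfer _ _).mul (continuous_transfer _ _))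

theorem integrable_singleAct_sq (hν : ∀ q, IsTwoDesign (ν₁ q)) (P : Fin n → Fin 4)
    (x : (Fin n → Fin 4) → ℝ) :
    Integrable (fun u => singleAct P u x ^ 2) (Measure.pi ν₁) := by
  simp only [singleAct_sq]
  exact integrable_finsetSum _ fun v _ => integrable_finsetSum _ fun v' _ =>
    (integrable_prod_transfer hν P v v').const_mul _

theorem integral_singleAct_sq (hν : ∀ q, IsTwoDesign (ν₁ q)) (P : Fin n → Fin 4)
    (x : (Fin n → Fin 4) → ℝ) :
    ∫ u, singleAct P u x ^ 2 ∂(Measure.pi ν₁) = quad (singleForm ν₁ P) x := by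
  have := fun q => (hν q).isProbabilityMeasure
  simp only [singleAct_sq, quad]
  refine (integral_finsetSum _ fun v _ => integrable_finsetSum _ fun v' _ =>
    (integrable_prod_transfer hν P v v').const_mul _).trans (Finset.sum_congr rfl fun v _ => ?_)
  refine (integral_finsetSum _ fun v' _ => (integrable_prod_transfer hν P v v').const_mul _).trans
    (Finset.sum_congr rfl fun v' _ => ?_)
  rw [integral_const_mul, mul_comm, singleForm]
  congr 1
  exact integral_fintype_prod_eq_prod (fun q (V : Gate (Fin 2)) =>
    transfer pauli V.1 (P q) (v q) * transfer pauli V.1 (P q) (v' q))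

/-- The starting point of the backward propagation. The final layer alone already makes the form
diagonal with mass one, whatever `P` is. -/
theorem good_singleForm (hν : ∀ q, IsTwoDesign (ν₁ q)) (P : Fin n → Fin 4) :
    Good Finset.univ 1 1 (singleForm ν₁ P) := by
  have := fun q => (hν q).isProbabilityMeasure
  have hnonneg : ∀ x, 0 ≤ quad (singleForm ν₁ P) x := fun x => by
    rw [← integral_singleAct_sq hν]
    exact integral_nonneg fun _ => sq_nonneg _
  have hmass : ∑ w, singleForm ν₁ P w w = 1 := by
    have e : ∀ q, ∑ b, moment pauli (ν₁ q) (P q) b = 1 := fun q =>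
      sum_moment isPauliBasis_pauli (ν₁ q) (P q)
    calc _ = ∏ q, ∑ b, moment pauli (ν₁ q) (P q) b := by
          rw [Finset.prod_univ_sum, Fintype.piFinset_univ]; rfl
      _ = 1 := by simp [e]
  refine ⟨hnonneg, fun w w' q _ hq => ?_, fun w w' h _ => ?_, hmass.le, ?_⟩
  · exact Finset.prod_eq_zero (Finset.mem_univ q)
      ((hν q).integral_transfer_eq_zero isPauliBasis_pauli fun h => hq h.2)
  · exact Finset.prod_congr rfl fun q _ => (hν q).moment_congr isPauliBasis_pauli (P q)
      (exists_gate_conj_pauli _ _ (h q (Finset.mem_univ q)))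
  · rw [hmass]
    linarith [diag_nonneg_of_quad_nonneg hnonneg 0]

end Single

/-! ### The accuracy of the truncation -/

section Accuracy

variable {D r m n L : ℕ} {arch : Architecture D r m n L}
  {ν₂ : arch.GateLoc → Measure (Gate (Fin 2 × Fin 2))} {ν₁ : Fin n → Measure (Gate (Fin 2))}
  {N : Op1 →ₗ[ℂ] Op1} {c : ℝ} {M : Fin 4 → Fin 4 → ℝ}

theorem circuitMeasure_isProbabilityMeasure (hν₂ : ∀ k, IsTwoDesign (ν₂ k))
    (hν₁ : ∀ q, IsTwoDesign (ν₁ q)) : IsProbabilityMeasure (circuitMeasure arch ν₂ ν₁) := by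
  have := fun q => (hν₁ q).isProbabilityMeasure
  have := fun k => (hν₂ k).isProbabilityMeasure
  unfold circuitMeasure
  infer_instance

theorem pauliVec_singleLayer (ω : arch.Sample) (A : Op n) (P : Fin n → Fin 4) :
    pauliVec (singleLayer arch ω * A * (singleLayer arch ω).conjTranspose) P =
      singleAct P ω.2 (pauliVec A) := by
  have e : singleLayer arch ω = prodOp fun q => (ω.2 q).1 := rfl
  rw [e, conj_prodOp, pauliVec_tensorOp fun q => isDualMatrix_transfer (ω.2 q).1]
  rfl

theorem HasRealCoords.singleLayer (ω : arch.Sample) {A : Op n} (hA : HasRealCoords A) :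
    HasRealCoords (singleLayer arch ω * A * (singleLayer arch ω).conjTranspose) := by
  have e : NoisyCircuit.singleLayer arch ω = prodOp fun q => (ω.2 q).1 := rfl
  rw [e, conj_prodOp]
  exact hA.tensorOp fun q => isDualMatrix_transfer (ω.2 q).1

theorem measurable_singleAct {A : (arch.GateLoc → Gate (Fin 2 × Fin 2)) → Op n}
    (hA : RandomOp arch A) (P : Fin n → Fin 4) :
    Measurable fun ω : arch.Sample => singleAct P ω.2 (pauliVec (A ω.1)) := by
  refine Finset.measurable_sum _ fun v _ => Measurable.mul ?_
    ((hA.measurable_pauliVec v).comp measurable_fst)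
  exact Finset.measurable_prod _ fun q _ =>
    (continuous_transfer (P q) (v q)).measurable.comp ((measurable_pi_apply q).comp measurable_snd)

theorem lintegral_singleAct_sq (hν₂ : ∀ k, IsTwoDesign (ν₂ k)) (hν₁ : ∀ q, IsTwoDesign (ν₁ q))
    {A : (arch.GateLoc → Gate (Fin 2 × Fin 2)) → Op n} (hA : RandomOp arch A)
    (P : Fin n → Fin 4) :
    ∫⁻ ω, ENNReal.ofReal (singleAct P ω.2 (pauliVec (A ω.1)) ^ 2) ∂(circuitMeasure arch ν₂ ν₁) =
      meanQuad ν₂ (singleForm ν₁ P) A := by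
  have := fun q => (hν₁ q).isProbabilityMeasure
  have := fun k => (hν₂ k).isProbabilityMeasure
  rw [circuitMeasure, lintegral_prod _ (((measurable_singleAct hA P).pow_const
    2).ennreal_ofReal.aemeasurable), meanQuad]
  refine lintegral_congr fun g => ?_
  rw [← integral_singleAct_sq hν₁, ofReal_integral_eq_lintegral_ofReal
    (integrable_singleAct_sq hν₁ P _) (Filter.Eventually.of_forall fun _ => sq_nonneg _)]

/-! #### The initial state and the identity coordinate -/

theorem coord_zeroState (w : Fin n → Fin 4) :
    coord pauli w (zeroState n) = ((∏ q, (![1, 0, 0, 1] : Fin 4 → ℝ) (w q) : ℝ) : ℂ) := by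
  have e : zeroState n = prodOp fun _ => Matrix.single 0 0 1 :=
    single_eq_prodOp (0 : Fin n → Fin 2) 0
  rw [e, coord_prodOp, Complex.ofReal_prod]
  refine Finset.prod_congr rfl fun q _ => ?_
  rw [Matrix.trace_mul_single]
  generalize w q = a
  fin_cases a <;> simp [pauli]

theorem hasRealCoords_zeroState : HasRealCoords (zeroState n) := fun w => by
  rw [coord_zeroState]; exact Complex.ofReal_im _

/-- The coordinates of the initial state are `0` or `1`, so the mass of a diagonal form bounds its
value there. -/
theorem pauliVec_zeroState_sq_le (w : Fin n → Fin 4) : pauliVec (zeroState n) w ^ 2 ≤ 1 := by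
  have h : ∀ a : Fin 4, 0 ≤ (![1, 0, 0, 1] : Fin 4 → ℝ) a ∧ (![1, 0, 0, 1] : Fin 4 → ℝ) a ≤ 1 := by
    intro a
    fin_cases a <;> simp
  rw [pauliVec, coord_zeroState, Complex.ofReal_re]
  exact pow_le_one₀ (Finset.prod_nonneg fun q _ => (h _).1)
    (Finset.prod_le_one (fun q _ => (h _).1) fun q _ => (h _).2)

theorem Good.quad_zeroState_le {μ τ : ℝ} {F : (Fin n → Fin 4) → (Fin n → Fin 4) → ℝ}
    (hF : Good Finset.univ μ τ F) : quad F (pauliVec (zeroState n)) ≤ τ := by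
  rw [quad_eq_of_diag hF.eq_zero_of_ne]
  exact (Finset.sum_le_sum fun w _ => mul_le_of_le_one_right
    (diag_nonneg_of_quad_nonneg hF.nonneg w) (pauliVec_zeroState_sq_le w)).trans hF.mass_le

/-- The identity coordinate is the trace, which gates and noise preserve. Hence it cancels in the
truncation error. -/
theorem pauliVec_gateStep_zero (g : arch.GateLoc → Gate (Fin 2 × Fin 2)) (A : Op n)
    (k : arch.GateLoc) : pauliVec (gateStep arch g A k) 0 = pauliVec A 0 := by
  rw [gateStep, pauliVec_pairMat k.2.ne, gateAct]
  have h : ∀ b : Fin 4 × Fin 4, transfer pauli2 (g k).1 (0, 0) b = if b = 0 then 1 else 0 := by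
    intro b
    rw [← transfer_conjTranspose]
    exact isPauliBasis_pauli2.transfer_zero_right (by
      rw [Matrix.conjTranspose_conjTranspose]
      exact mul_eq_one_comm.mp (conjTranspose_mul_self_gate (g k))) b
  have h2 := update2_self (0 : Fin n → Fin 4) k.2.ne
  simp only [Pi.zero_apply] at h2
  simp only [Pi.zero_apply, h, ite_mul, one_mul, zero_mul]
  rw [Finset.sum_ite_eq' Finset.univ (0 : Fin 4 × Fin 4), if_pos (Finset.mem_univ _)]
  simp [h2]

theorem pauliVec_tensorChannel_zero (hM : IsNoiseMatrix N c M) (A : Op n) :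
    pauliVec (tensorChannel N A) 0 = pauliVec A 0 := by
  rw [pauliVec_tensorChannel hM, noiseAct, Finset.sum_eq_single 0]
  · simp [hM.zero]
  · intro v _ hv
    obtain ⟨q, hq⟩ := Function.ne_iff.mp hv
    rw [Finset.prod_eq_zero (Finset.mem_univ q), zero_mul]
    rw [Pi.zero_apply, hM.zero]
    exact if_neg hq
  · simp

theorem pauliVec_noisyLayer_zero (hM : IsNoiseMatrix N c M) (ω : arch.Sample) (A : Op n)
    (is : List (Fin L)) : pauliVec (is.foldl (noisyLayer arch N ω) A) 0 = pauliVec A 0 := by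
  have h : ∀ (ks : List arch.GateLoc) (A : Op n),
      pauliVec (ks.foldl (gateStep arch ω.1) A) 0 = pauliVec A 0 := by
    intro ks
    induction ks with
    | nil => exact fun _ => rfl
    | cons k ks ih => exact fun A => (ih _).trans (pauliVec_gateStep_zero ω.1 A k)
  induction is generalizing A with
  | nil => rfl
  | cons i is ih =>
    rw [List.foldl_cons, ih, noisyLayer_eq, pauliVec_tensorChannel_zero hM, h]

theorem foldl_noisyLayer_sub (ω : arch.Sample) (A B : Op n) (is : List (Fin L)) :
    is.foldl (noisyLayer arch N ω) (A - B) =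
      is.foldl (noisyLayer arch N ω) A - is.foldl (noisyLayer arch N ω) B := by
  induction is generalizing A B with
  | nil => rfl
  | cons i is ih =>
    rw [List.foldl_cons, List.foldl_cons, List.foldl_cons, ← ih]
    congr 1
    simp only [noisyLayer, tensorChannel_eq, mul_sub, sub_mul, map_sub]

/-- The form without its identity component. -/
def offIdentity (F : (Fin n → Fin 4) → (Fin n → Fin 4) → ℝ) (w w' : Fin n → Fin 4) : ℝ :=
  if w = 0 ∨ w' = 0 then 0 else F w w'

theorem Good.offIdentity {μ τ : ℝ} {F : (Fin n → Fin 4) → (Fin n → Fin 4) → ℝ}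
    (hF : Good Finset.univ μ τ F) : Good Finset.univ μ μ (offIdentity F) := by
  have hoff : ∀ w w', w ≠ w' → NoisyCircuit.offIdentity F w w' = 0 := fun w w' h => by
    unfold NoisyCircuit.offIdentity
    split_ifs
    · rfl
    · exact hF.eq_zero_of_ne w w' h
  have hmass : ∑ w, NoisyCircuit.offIdentity F w w = ∑ w, F w w - F 0 0 := by
    rw [← Finset.add_sum_erase _ _ (Finset.mem_univ (0 : Fin n → Fin 4)),
      ← Finset.add_sum_erase Finset.univ (fun w => F w w) (Finset.mem_univ (0 : Fin n → Fin 4)),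
      add_sub_cancel_left, NoisyCircuit.offIdentity, if_pos (Or.inl rfl), zero_add]
    exact Finset.sum_congr rfl fun w hw => by
      simp [NoisyCircuit.offIdentity, Finset.ne_of_mem_erase hw]
  refine ⟨fun x => ?_, fun w w' q _ hq => hoff w w' fun h => hq (congrFun h q), fun w w' h h2 => ?_,
    hmass.trans_le hF.mass_ne_le, ?_⟩
  · rw [quad_eq_of_diag hoff]
    refine Finset.sum_nonneg fun w _ => mul_nonneg ?_ (sq_nonneg _)
    unfold NoisyCircuit.offIdentity
    split_ifs
    · exact le_rfl
    · exact diag_nonneg_of_quad_nonneg hF.nonneg w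
  · have h0 : w = 0 ↔ w' = 0 := by
      simp only [funext_iff, Pi.zero_apply]
      exact forall_congr' fun q => h q (Finset.mem_univ q)
    simp only [NoisyCircuit.offIdentity, h0, hF.supp w w' h h2]
  · rw [hmass]
    simpa [NoisyCircuit.offIdentity] using hF.mass_ne_le

/-- The identity term drops out as the traces agree; the others obey `(a - b)² ≤ 2a² + 2b²`, so that
a bound for each operator separately suffices. -/
theorem Good.quad_sub_le {μ τ : ℝ} {F : (Fin n → Fin 4) → (Fin n → Fin 4) → ℝ}
    (hF : Good Finset.univ μ τ F) {A B : Op n} (h : pauliVec A 0 = pauliVec B 0) :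
    quad F (pauliVec (A - B)) ≤ 2 * quad (NoisyCircuit.offIdentity F) (pauliVec A) +
      2 * quad (NoisyCircuit.offIdentity F) (pauliVec B) := by
  rw [quad_eq_of_diag hF.eq_zero_of_ne, quad_eq_of_diag hF.offIdentity.eq_zero_of_ne,
    quad_eq_of_diag hF.offIdentity.eq_zero_of_ne, Finset.mul_sum, Finset.mul_sum,
    ← Finset.sum_add_distrib]
  refine Finset.sum_le_sum fun w _ => ?_
  rw [pauliVec_sub]
  by_cases hw : w = 0
  · subst hw
    simp [h, NoisyCircuit.offIdentity]
  · have h0 := diag_nonneg_of_quad_nonneg hF.nonneg w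
    simp only [NoisyCircuit.offIdentity, hw, or_self, if_false]
    nlinarith [mul_nonneg h0 (sq_nonneg (pauliVec A w + pauliVec B w))]

/-- The mean square error of the truncation to the last `l` layers. -/
theorem lintegral_error_le (hν₂ : ∀ k, IsTwoDesign (ν₂ k)) (hν₁ : ∀ q, IsTwoDesign (ν₁ q))
    (hM : IsNoiseMatrix N c M) (hc : 0 ≤ c) (hc1 : c ≤ 1) (P : Fin n → Fin 4) {l : ℕ} (hl : l ≤ L) :
    ∃ A, RandomOp arch A ∧
      (∀ ω, (pauliOp P * lastLayers arch N ω l (zeroState n)).trace -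
        (pauliOp P * circuit arch N ω (zeroState n)).trace =
          (singleAct P ω.2 (pauliVec (A ω.1)) : ℂ)) ∧
      ∫⁻ ω, ENNReal.ofReal (singleAct P ω.2 (pauliVec (A ω.1)) ^ 2) ∂(circuitMeasure arch ν₂ ν₁) ≤
        ENNReal.ofReal (4 * c ^ l) := by
  have := fun k => (hν₂ k).isProbabilityMeasure
  -- An arbitrary choice: noisy layers do not use the single-qubit gates.
  let u : Fin n → Gate (Fin 2) := fun _ => 1
  set is₁ := (List.finRange L).take (L - l) with his₁
  set is₂ := (List.finRange L).drop (L - l) with his₂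
  have hsplit : is₁ ++ is₂ = List.finRange L := List.take_append_drop _ _
  have hnd : (is₁ ++ is₂).Nodup := hsplit ▸ List.nodup_finRange L
  have hnd' := List.nodup_append.mp hnd
  have hlen : is₂.length = l := by
    rw [his₂, List.length_drop, List.length_finRange]
    omega
  let B : (arch.GateLoc → Gate (Fin 2 × Fin 2)) → Op n := fun g =>
    is₁.foldl (noisyLayer arch N (g, u)) (zeroState n)
  have h0 : RandomOp arch fun _ => zeroState n := RandomOp.const hasRealCoords_zeroState
  have hB : RandomOp arch B := h0.foldl_noisyLayer hM u is₁
  -- By linearity the error is the image under the kept layers of the initial state minus the output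
  -- of the discarded layers.
  have hdiff : RandomOp arch fun g => zeroState n - B g := h0.sub hB
  have hA := hdiff.foldl_noisyLayer hM u is₂
  refine ⟨_, hA, fun ω => ?_, ?_⟩
  · rw [← pauliVec_singleLayer, ← ((hA.real ω.1).singleLayer ω).coord_eq,
      foldl_noisyLayer_sub, mul_sub, sub_mul, map_sub]
    have e1 : circuit arch N ω (zeroState n) = singleLayer arch ω *
        is₂.foldl (noisyLayer arch N (ω.1, u)) (B ω.1) * (singleLayer arch ω).conjTranspose := by
      have e2 : (List.finRange L).drop (L - L) = is₁ ++ is₂ := by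
        rw [Nat.sub_self, List.drop_zero, hsplit]
      rw [circuit, lastLayers, e2, List.foldl_append]
      rfl
    rw [e1]
    rfl
  · rw [lintegral_singleAct_sq hν₂ hν₁ hA]
    obtain ⟨F, hF, hFA⟩ :=
      exists_good_layers hν₂ hM hc hc1 u is₂ hnd'.2.1 (good_singleForm hν₁ P)
    rw [hlen, mul_one] at hF
    -- The off-identity part, of mass at most `c ^ l`, is pulled back through the discarded layers
    -- as well; no contraction is needed there, only that the mass does not grow.
    obtain ⟨F', hF', hFB⟩ := exists_good_layers hν₂ hM hc hc1 u is₁ hnd'.1 hF.offIdentity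
    have hindep : ∀ k, IndepOf k fun _ : arch.GateLoc → Gate (Fin 2 × Fin 2) => zeroState n :=
      fun _ _ _ => rfl
    rw [hFA _ hdiff fun k hk g V => ?_]
    swap
    -- The discarded layers use other gates than the kept ones, so the difference is independent of
    -- the latter.
    · have hk1 : k.1.1 ∉ is₁ := fun h => hnd'.2.2 _ h _ hk rfl
      exact congrArg (zeroState n - ·) (((hindep k).foldl_noisyLayer u hk1) g V)
    have h4 : (4 : ℝ) * c ^ l = 2 * c ^ l + 2 * c ^ l := by ring
    have hcl : 0 ≤ c ^ l := pow_nonneg hc l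
    calc meanQuad ν₂ F (fun g => zeroState n - B g)
        ≤ ∫⁻ g, (ENNReal.ofReal (2 * c ^ l) + ENNReal.ofReal 2 *
            ENNReal.ofReal (quad (offIdentity F) (pauliVec (B g)))) ∂(Measure.pi ν₂) := by
          refine lintegral_mono fun g => ?_
          have hz : pauliVec (zeroState n) 0 = pauliVec (B g) 0 :=
            (pauliVec_noisyLayer_zero hM (g, u) (zeroState n) is₁).symm
          rw [← ENNReal.ofReal_mul (by norm_num), ← ENNReal.ofReal_add (by positivity)
            (mul_nonneg (by norm_num) (hF.offIdentity.nonneg _))]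
          refine ENNReal.ofReal_le_ofReal ((hF.quad_sub_le hz).trans ?_)
          have := hF.offIdentity.quad_zeroState_le
          linarith
      _ = ENNReal.ofReal (2 * c ^ l) + ENNReal.ofReal 2 * meanQuad ν₂ (offIdentity F) B := by
          rw [lintegral_add_left measurable_const, lintegral_const, measure_univ, mul_one,
            lintegral_const_mul _ (hB.measurable_quad _)]
          rfl
      _ ≤ ENNReal.ofReal (2 * c ^ l) + ENNReal.ofReal 2 * ENNReal.ofReal (c ^ l) := by
          rw [hFB _ h0 fun k _ => hindep k, meanQuad, lintegral_const, measure_univ, mul_one]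
          gcongr
          exact hF'.quad_zeroState_le
      _ = ENNReal.ofReal (4 * c ^ l) := by
          rw [← ENNReal.ofReal_mul (by norm_num), h4, ENNReal.ofReal_add (by positivity)
            (by positivity)]

/-- Markov's inequality for the squared error, whose mean is at most `4 * c ^ l ≤ δ * ε²`. -/
theorem accuracy (hν₂ : ∀ k, IsTwoDesign (ν₂ k)) (hν₁ : ∀ q, IsTwoDesign (ν₁ q))
    (hM : IsNoiseMatrix N c M) (hc : 0 ≤ c) (hc1 : c ≤ 1) (P : Fin n → Fin 4) {ε δ : ℝ}
    (hε : 0 < ε) (hδ : 0 < δ) {l : ℕ} (hl : 4 * c ^ l ≤ δ * (ε * ε)) :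
    ENNReal.ofReal (1 - δ) ≤ circuitMeasure arch ν₂ ν₁
      {ω | ‖(pauliOp P * lastLayers arch N ω l (zeroState n)).trace -
        (pauliOp P * circuit arch N ω (zeroState n)).trace‖ ≤ ε} := by
  have := circuitMeasure_isProbabilityMeasure (arch := arch) hν₂ hν₁
  rcases le_total L l with hL | hL
  -- If `l ≥ L` nothing is discarded and there is no error.
  · have e : ∀ ω, lastLayers arch N ω l (zeroState n) = circuit arch N ω (zeroState n) := by
      intro ω
      rw [circuit, lastLayers, lastLayers, Nat.sub_eq_zero_of_le hL, Nat.sub_self]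
    have : {ω | ‖(pauliOp P * lastLayers arch N ω l (zeroState n)).trace -
        (pauliOp P * circuit arch N ω (zeroState n)).trace‖ ≤ ε} = Set.univ := by
      refine Set.eq_univ_of_forall fun ω => ?_
      rw [Set.mem_ofPred_eq, e, sub_self, norm_zero]
      exact hε.le
    rw [this, measure_univ]
    exact ENNReal.ofReal_le_one.mpr (by linarith)
  obtain ⟨A, hA, hdiff, hint⟩ := lintegral_error_le (arch := arch) hν₂ hν₁ hM hc hc1 P hL
  simp only [hdiff, Complex.norm_real, Real.norm_eq_abs]
  set f : arch.Sample → ℝ := fun ω => singleAct P ω.2 (pauliVec (A ω.1)) with hf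
  have hm : Measurable f := measurable_singleAct hA P
  have hε2 : 0 < ENNReal.ofReal (ε * ε) := ENNReal.ofReal_pos.mpr (by positivity)
  have hmarkov := mul_meas_ge_le_lintegral (μ := circuitMeasure arch ν₂ ν₁)
    ((hm.pow_const 2).ennreal_ofReal) (ENNReal.ofReal (ε * ε))
  have hbad : circuitMeasure arch ν₂ ν₁
      {ω | ENNReal.ofReal (ε * ε) ≤ ENNReal.ofReal (f ω ^ 2)} ≤ ENNReal.ofReal δ := by
    have h1 : ENNReal.ofReal (ε * ε) * circuitMeasure arch ν₂ ν₁
        {ω | ENNReal.ofReal (ε * ε) ≤ ENNReal.ofReal (f ω ^ 2)} ≤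
        ENNReal.ofReal (ε * ε) * ENNReal.ofReal δ := by
      refine hmarkov.trans (hint.trans ?_)
      rw [← ENNReal.ofReal_mul (by positivity), mul_comm (ε * ε)]
      exact ENNReal.ofReal_le_ofReal hl
    exact (ENNReal.mul_le_mul_iff_right hε2.ne' ENNReal.ofReal_ne_top).mp h1
  have hcover : (Set.univ : Set arch.Sample) ⊆ {ω | |f ω| ≤ ε} ∪
      {ω | ENNReal.ofReal (ε * ε) ≤ ENNReal.ofReal (f ω ^ 2)} := by
    intro ω _
    by_cases h : |f ω| ≤ ε
    · exact Or.inl h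
    · refine Or.inr (ENNReal.ofReal_le_ofReal ?_)
      rw [← sq_abs, sq]
      push Not at h
      exact mul_le_mul h.le h.le hε.le (abs_nonneg _)
  have h1 := (measure_mono hcover).trans
    ((measure_union_le (μ := circuitMeasure arch ν₂ ν₁) _ _).trans (add_le_add_right hbad _))
  rw [measure_univ] at h1
  rw [ENNReal.ofReal_sub _ hδ.le, ENNReal.ofReal_one]
  exact tsub_le_iff_right.mpr h1

end Accuracy

end

end NoisyCircuit

open NoisyCircuit

theorem mainTheorem4 :
    ∃ prog : Prog, ∀ (D r m A : ℕ) (η : ℝ), 1 ≤ D → η < 1 → ∃ K : ℝ,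
      ∀ (n L : ℕ) (arch : Architecture D r m n L)
        (ν₂ : arch.GateLoc → Measure (Gate (Fin 2 × Fin 2)))
        (ν₁ : Fin n → Measure (Gate (Fin 2)))
        (_ : ∀ g, IsTwoDesign (ν₂ g)) (_ : ∀ q, IsTwoDesign (ν₁ q))
        (N : Op1 →ₗ[ℂ] Op1) (_ : IsChannel N) (_ : ¬ IsUnitaryChannel N)
        (t d : Fin 3 → ℝ) (_ : IsNormalForm N t d) (c : ℝ) (_ : c = noiseParam t d) (_ : 0 < c)
        (P : Fin n → Fin 4) (ε δ : ℝ) (_ : 0 < ε) (_ : 0 < δ)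
        (l : ℕ) (_ : l = ⌈1 / Real.log c⁻¹ * Real.log (4 / (δ * ε ^ 2))⌉₊)
        (Chat : arch.Sample → ℂ)
        (_ : ∀ ω, Chat ω = (pauliOp P * lastLayers arch N ω l (zeroState n)).trace),
        ENNReal.ofReal (1 - δ) ≤ circuitMeasure arch ν₂ ν₁
            {ω | ‖Chat ω - (pauliOp P * circuit arch N ω (zeroState n)).trace‖ ≤ ε} ∧
        ∀ ω : arch.Sample, ∃ (T : ℕ) (s : Mem),
          Run (encode arch N ω P ε δ c) prog Mem.init T s ∧
          s.carr 0 0 = Chat ω ∧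
          (T : ℝ) ≤ Real.exp (K * (((weight P : ℝ) + 1) * ((l : ℝ) + 1) ^ D)) ∧
          (1 ≤ weight P → IsLocalPauli arch A P →
            (T : ℝ) ≤ Real.exp (K * ((weight P : ℝ) + l) ^ D) ∧
            (ε ^ 2 * δ ≤ η →
              (T : ℝ) ≤ Real.exp (K *
                ((weight P : ℝ) + 1 / Real.log c⁻¹ * Real.log (1 / (ε ^ 2 * δ))) ^ D))) := by
  refine ⟨mainProg, fun D r m A η hD hη => ?_⟩
  obtain ⟨K, hK⟩ := exists_runtime_bounds D r m A η hD hη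
  refine ⟨K, ?_⟩
  intro n L arch ν₂ ν₁ hν₂ hν₁ N hN hU t d hnf c hc hc0 P ε δ hε hδ l hl Chat hChat
  -- From here on the normal form enters only through the noise matrix and `c`.
  obtain ⟨M, hM⟩ := exists_isNoiseMatrix hN.tracePreserving hnf
  rw [← hc] at hM
  have hc1 : c < 1 := noiseParam_lt_one hN hU hM
  have hdepth : ∀ j, 4 * c ^ j ≤ δ * (ε * ε) ↔ l ≤ j := fun j => by
    rw [hl]; exact pow_depth_le_iff hc0 hc1 hε hδ j
  constructor
  · simp only [hChat]
    exact accuracy hν₂ hν₁ hM hc0.le hc1.le P hε hδ ((hdepth l).mpr le_rfl)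
  · intro ω
    obtain ⟨k, hk, b1, b2⟩ := hK n L arch P c ε δ hc0 hc1 hε hδ l hl
    obtain ⟨T, s, hrun, hT, hs⟩ := mainProg_reach arch ω P ε δ c hN hdepth hk
    have hT' : (T : ℝ) ≤ totalCost m l k := by exact_mod_cast hT
    refine ⟨T, s, hrun, by rw [hs, hChat], hT'.trans b1, fun h1 h2 => ?_⟩
    exact ⟨hT'.trans (b2 h1 h2).1, fun h3 => hT'.trans ((b2 h1 h2).2 h3)⟩
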